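/- **Preliminary scattering formula for the massless Spin-Boson model.** *Model.* Let $e_1>0$, $\Lambda>0$, $\mu\in(0,\tfrac12)$, $g>0$, $\omega(k)=|k|$ on $\mathbb R^3$, and $f(k)=e^{-k^2/\Lambda^2}|k|^{-\frac12+\mu}$. On $\mathcal H=\mathbb C^2\otimes\mathcal F$, where $\mathcal F$ is the bosonic Fock space over $\mathfrak h=L^2(\mathbb R^3,\mathbb C)$, let $$H=K+H_f+gV,\qquad K=\begin{pmatrix}e_1&0\\0&0\end{pmatrix},\quad H_f=\int\omega(k)\,a(k)^*a(k)\,d^3k,\quad V=\sigma_1\otimes(a(f)+a(f)^*),\quad \sigma_1=\begin{pmatrix}0&1\\1&0\end{pmatrix}$$ (a self-adjoint operator with domain $\mathbb C^2\otimes\mathcal D(H_f)$). Let $\lambda_0=\inf\sigma(H)$ and let $\Psi_{\lambda_0}\ne0$ be a (not necessarily normalized) ground state, $\Psi_{\lambda_0}\in\mathcal D(H)$ and $H\Psi_{\lambda_0}=\lambda_0\Psi_{\lambda_0}$. Inner products are antilinear in the first argument. *Asymptotic operators.* Let $\mathfrak h_0=C_c^\infty(\mathbb R^3\setminus\{0\},\mathbb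 C)$. For $h\in\mathfrak h_0$ put $h_t(k)=h(k)e^{-it\omega(k)}$ and $a_t(h)=e^{itH}a(h_t)e^{-itH}$, let $a_\pm(h)\Psi=\lim_{t\to\pm\infty}a_t(h)\Psi$ for $\Psi\in\mathbb C^2\otimes\mathcal D(H_f^{1/2})$, and let $a_\pm(h)^*$ be the adjoint of $a_\pm(h)$. For $h,l\in\mathfrak h_0$ define $$S(h,l)=\|\Psi_{\lambda_0}\|^{-2}\langle a_+(h)^*\Psi_{\lambda_0},a_-(l)^*\Psi_{\lambda_0}\rangle,\qquad T(h,l)=S(h,l)-\langle h,l\rangle_2 .$$ *Theorem.* For every $h\in\mathfrak h_0$ the limits defining $a_\pm(h)$ exist on all of $\mathbb C^2\otimes\mathcal D(H_f^{1/2})$, and $\Psi_{\lambda_0}$ lies in the domain of $a_\pm(h)^*$. For all $h,l\in\mathfrak h_0$ the function $$W(k)=|k|^2\,l(k)\int d\Sigma\,\overline{h(|k|,\Sigma)}\,f(|k|,\Sigma)$$ (spherical coordinates, $d\Sigma$ the solid angle) belongs to $\mathfrak h_0$, and $$T(h,l)=-2\pi i g\,\|\Psi_{\lambda_0}\|^{-2}\big\langle\sigma_1\Psi_{\lambda_0},a_-(W)^*\Psi_{\lambda_0}\big\rangle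 .$$ Moreover $$T(h,l)=\lim_{t\to-\infty}\int d^3k\,d^3k'\,\overline{h(k)}\,l(k')\,\delta(\omega(k)-\omega(k'))\,T_t(k,k'),\qquad T_t(k,k')=-2\pi i g f(k)\|\Psi_{\lambda_0}\|^{-2}\langle\sigma_1\Psi_{\lambda_0},a_t(k')^*\Psi_{\lambda_0}\rangle .$$ Here the integral is taken on the energy shell $|k|=|k'|$, that is, it stands for $$\int_0^\infty dr\int d\Sigma\,d\Sigma'\; r^4\,\overline{h(r,\Sigma)}\,l(r,\Sigma')\,T_t\big((r,\Sigma),(r,\Sigma')\big),$$ which converges absolutely for every $t\in\mathbb R$; and $\langle\Phi,a_t(k)^*\Psi\rangle=e^{-it\omega(k)}\langle a(k)e^{-itH}\Phi,e^{-itH}\Psi\rangle$, where $a(k)$ is the point-wise annihilation operator $(a(k)\Psi)^{(n)}(k_1,\dots,k_n)=\sqrt{n+1}\,\psi^{(n+1)}(k,k_1,\dots,k_n)$ (defined for almost every $k$). -/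

import Mathlib

open MeasureTheory Filter Topology Set
open scoped ENNReal ContDiff ComplexConjugate InnerProductSpace LinearPMap

noncomputable section

namespace SpinBoson

/-! ## Unbounded operators on a complex Hilbert space -/

section Operators

variable {X : Type*} [NormedAddCommGroup X] [InnerProductSpace ℂ X]

open scoped Classical in
/-- The value `A ψ` of a partially defined operator, extended by `0` off its domain. -/
def opApply (A : X →ₗ.[ℂ] X) (ψ : X) : X :=
  if hψ : ψ ∈ A.domain then A ⟨ψ, hψ⟩ else 0

/-- The spectrum of an unbounded operator `A`: the complement of the set of all `z` for which
`A - z : D(A) → X` is bijective with a bounded inverse `R`. -/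
def opSpectrum (A : X →ₗ.[ℂ] X) : Set ℂ :=
  {z | ¬ ∃ R : X →L[ℂ] X,
    (∀ φ, (R φ, φ + z • R φ) ∈ A.graph) ∧
    (∀ ψ χ, (ψ, χ) ∈ A.graph → R (χ - z • ψ) = ψ)}

/-- The bottom `inf σ(A)` of the spectrum of a self-adjoint operator that is bounded below. -/
def specInf (A : X →ₗ.[ℂ] X) : ℝ := sInf {r : ℝ | (r : ℂ) ∈ opSpectrum A}

/-- `Ψ` is a (not necessarily normalized) ground state of `A`: a nonzero vector of `D(A)` with
`A Ψ = λ₀ Ψ`, where `λ₀ = inf σ(A)`. -/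
def IsGroundState (A : X →ₗ.[ℂ] X) (Ψ : X) : Prop :=
  Ψ ≠ 0 ∧ (Ψ, (specInf A : ℂ) • Ψ) ∈ A.graph

/-- `U` is the strongly continuous one-parameter unitary group `U t = e^{-itA}`: its infinitesimal
generator, on exactly the domain of `A`, is `-iA`. By Stone's theorem such a group exists if and
only if `A` is self-adjoint, and it is then unique. -/
structure IsUnitaryGroupOf (A : X →ₗ.[ℂ] X) (U : ℝ → X →L[ℂ] X) : Prop where
  zero : U 0 = ContinuousLinearMap.id ℂ X
  add : ∀ s t, U (s + t) = (U s).comp (U t)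
  norm_map : ∀ t ψ, ‖U t ψ‖ = ‖ψ‖
  continuous : ∀ ψ, Continuous fun t => U t ψ
  generator : ∀ ψ φ, (ψ, φ) ∈ A.graph ↔ HasDerivAt (fun t => U t ψ) (-Complex.I • φ) 0

open scoped Classical in
/-- The time evolution `evolution A t = e^{-itA}` generated by a self-adjoint operator `A`
(with the value `0` if `A` does not generate a unitary group). -/
def evolution (A : X →ₗ.[ℂ] X) : ℝ → X →L[ℂ] X :=
  if hU : ∃ U, IsUnitaryGroupOf A U then hU.choose else 0

end Operators

/-! ## The bosonic Fock space over `L²(ℝ³)` -/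

/-- Momentum space `ℝ³`. -/
abbrev R3 : Type := EuclideanSpace ℝ (Fin 3)

/-- `L²(ℝ³ × ⋯ × ℝ³)`, with `n` factors. -/
abbrev L2n (n : ℕ) : Type := Lp ℂ 2 (volume : Measure (Fin n → R3))

/-- Permuting the particles preserves the Lebesgue measure. -/
theorem measurePreserving_perm (n : ℕ) (σ : Equiv.Perm (Fin n)) :
    MeasurePreserving (fun x : Fin n → R3 => x ∘ σ) volume volume := by
  have h := volume_measurePreserving_piCongrLeft (fun _ : Fin n => R3) σ.symm
  convert h using 1
  ext x i
  have := MeasurableEquiv.piCongrLeft_apply_apply (β := fun _ : Fin n => R3) σ.symm x (σ i)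
  simp only [Equiv.symm_apply_apply] at this
  rw [this]
  rfl

/-- The `n`-boson space: the symmetric functions in `L²(ℝ³ × ⋯ × ℝ³)`. -/
def symL2 (n : ℕ) : Submodule ℂ (L2n n) where
  carrier := {ψ | ∀ σ : Equiv.Perm (Fin n),
    (fun x : Fin n → R3 => ψ (x ∘ σ)) =ᵐ[volume] fun x => ψ x}
  zero_mem' := by
    intro σ
    have h0 := Lp.coeFn_zero (E := ℂ) (p := 2) (μ := (volume : Measure (Fin n → R3)))
    filter_upwards [h0, (measurePreserving_perm n σ).quasiMeasurePreserving.ae h0] with x h1 h2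
    rw [h2, h1]; rfl
  add_mem' := by
    intro ψ φ hψ hφ σ
    have h0 := Lp.coeFn_add ψ φ
    filter_upwards [h0, (measurePreserving_perm n σ).quasiMeasurePreserving.ae h0, hψ σ, hφ σ]
      with x h1 h2 h3 h4
    rw [h1, h2, Pi.add_apply, Pi.add_apply, h3, h4]
  smul_mem' := by
    intro c ψ hψ σ
    have h0 := Lp.coeFn_smul c ψ
    filter_upwards [h0, (measurePreserving_perm n σ).quasiMeasurePreserving.ae h0, hψ σ]
      with x h1 h2 h3
    rw [h1, h2, Pi.smul_apply, Pi.smul_apply, h3]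

theorem isClosed_symL2 (n : ℕ) : IsClosed (symL2 n : Set (L2n n)) := by
  have key : (symL2 n : Set (L2n n)) = ⋂ σ : Equiv.Perm (Fin n),
      {ψ | Lp.compMeasurePreserving _ (measurePreserving_perm n σ) ψ = ψ} := by
    ext ψ
    simp only [SetLike.mem_coe, mem_iInter, mem_ofPred_eq]
    refine forall_congr' fun σ => ?_
    have hc := Lp.coeFn_compMeasurePreserving ψ (measurePreserving_perm n σ)
    constructor
    · intro h
      exact Lp.ext (hc.trans h)
    · intro h
      rw [h] at hc
      exact hc.symm
  rw [key]
  refine isClosed_iInter fun σ => isClosed_eq ?_ continuous_id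
  exact (Lp.isometry_compMeasurePreserving (measurePreserving_perm n σ)).continuous

instance (n : ℕ) : CompleteSpace (symL2 n) := (isClosed_symL2 n).completeSpace_coe

/-- The bosonic Fock space: the Hilbert space direct sum of the `n`-boson spaces. -/
abbrev Fock : Type := lp (fun n : ℕ => symL2 n) 2

/-- The wave function `ψ⁽ⁿ⁾` of the `n`-boson component of a Fock vector. -/
abbrev wave (ψ : Fock) (n : ℕ) : (Fin n → R3) → ℂ := ((ψ n : symL2 n) : L2n n)

theorem wave_zero (n : ℕ) : wave 0 n =ᵐ[volume] 0 := Lp.coeFn_zero _ _ _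

theorem wave_add (ψ φ : Fock) (n : ℕ) : wave (ψ + φ) n =ᵐ[volume] wave ψ n + wave φ n :=
  Lp.coeFn_add _ _

theorem wave_smul (c : ℂ) (ψ : Fock) (n : ℕ) : wave (c • ψ) n =ᵐ[volume] c • wave ψ n :=
  Lp.coeFn_smul _ _

/-- `(k₁, …, kₙ) ↦ (k, k₁, …, kₙ)`. -/
abbrev addBoson {n : ℕ} (k : R3) (x : Fin n → R3) : Fin (n + 1) → R3 := Fin.cons k x

theorem measurePreserving_addBoson (n : ℕ) :
    MeasurePreserving (fun p : (Fin n → R3) × R3 => addBoson p.2 p.1)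
      (volume.prod volume) volume := by
  have h := (volume_preserving_piFinSuccAbove (fun _ : Fin (n + 1) => R3) 0).symm
  have h2 := h.comp (Measure.measurePreserving_swap
    (μ := (volume : Measure (Fin n → R3))) (ν := (volume : Measure R3)))
  have h3 : (fun p : (Fin n → R3) × R3 => addBoson p.2 p.1) =
      (MeasurableEquiv.piFinSuccAbove (fun _ : Fin (n + 1) => R3) 0).symm ∘ Prod.swap := by
    funext p
    simp [MeasurableEquiv.piFinSuccAbove_symm_apply, Fin.insertNthEquiv]
  rw [h3]
  exact h2

theorem ae_addBoson {n : ℕ} {p : (Fin (n + 1) → R3) → Prop} (h : ∀ᵐ y, p y) :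
    ∀ᵐ x : Fin n → R3, ∀ᵐ k : R3, p (addBoson k x) :=
  Measure.ae_ae_of_ae_prod ((measurePreserving_addBoson n).quasiMeasurePreserving.ae h)

/-- Multiplication by the function `m n` on the `n`-boson component, on its natural (maximal)
domain. -/
def multOp (m : ∀ n : ℕ, (Fin n → R3) → ℝ) : Fock →ₗ.[ℂ] Fock :=
  Submodule.toLinearPMap
    { carrier := {p | ∀ n, wave p.2 n =ᵐ[volume] fun x => (m n x : ℂ) * wave p.1 n x}
      zero_mem' := by
        intro n
        filter_upwards [wave_zero n] with x hx
        simp only [Prod.fst_zero, Prod.snd_zero, hx, Pi.zero_apply, mul_zero]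
      add_mem' := by
        intro p q hp hq n
        filter_upwards [wave_add p.1 q.1 n, wave_add p.2 q.2 n, hp n, hq n] with x h1 h2 h3 h4
        simp only [Prod.fst_add, Prod.snd_add, h1, h2, Pi.add_apply, h3, h4, mul_add]
      smul_mem' := by
        intro c p hp n
        filter_upwards [wave_smul c p.1 n, wave_smul c p.2 n, hp n] with x h1 h2 h3
        simp only [Prod.smul_fst, Prod.smul_snd, h1, h2, Pi.smul_apply, h3, smul_eq_mul]
        ring }

/-- The free field Hamiltonian `H_f = ∫ ω(k) a(k)* a(k) dk` with `ω(k) = |k|`: on the `n`-boson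
component, multiplication by `|k₁| + ⋯ + |kₙ|`. -/
def fieldH : Fock →ₗ.[ℂ] Fock := multOp fun _ x => ∑ i, ‖x i‖

/-- The square root `H_f^{1/2}`. -/
def fieldHSqrt : Fock →ₗ.[ℂ] Fock := multOp fun _ x => √(∑ i, ‖x i‖)

/-- The annihilation operator `a(h)`,
`(a(h)ψ)⁽ⁿ⁾(k₁,…,kₙ) = √(n+1) ∫ conj(h(k)) ψ⁽ⁿ⁺¹⁾(k,k₁,…,kₙ) dk`, on its maximal domain in Fock
space. For square integrable `h` the integrals converge for almost every `(k₁,…,kₙ)`, and this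
operator is the closure of its restriction to the vectors with finitely many bosons and Schwartz
wave functions. -/
def annih (h : R3 → ℂ) : Fock →ₗ.[ℂ] Fock :=
  Submodule.toLinearPMap
    { carrier := {p | ∀ n,
        (∀ᵐ x : Fin n → R3, Integrable fun k : R3 =>
          conj (h k) * wave p.1 (n + 1) (addBoson k x)) ∧
        wave p.2 n =ᵐ[volume] fun x =>
          (√(n + 1 : ℝ) : ℂ) * ∫ k : R3, conj (h k) * wave p.1 (n + 1) (addBoson k x)}
      zero_mem' := by
        intro n
        have h0 := ae_addBoson (wave_zero (n + 1))
        constructor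
        · filter_upwards [h0] with x hx
          refine (integrable_zero R3 ℂ volume).congr ?_
          filter_upwards [hx] with k hk
          simp only [Prod.fst_zero, hk, Pi.zero_apply, mul_zero]
        · filter_upwards [h0, wave_zero n] with x hx hx2
          rw [integral_eq_zero_of_ae]
          · simpa using hx2
          · filter_upwards [hx] with k hk
            simp only [Prod.fst_zero, hk, Pi.zero_apply, mul_zero]
      add_mem' := by
        intro p q hp hq n
        have h0 : ∀ᵐ x : Fin n → R3, (fun k : R3 =>
            conj (h k) * wave (p + q).1 (n + 1) (addBoson k x)) =ᵐ[volume]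
            fun k => conj (h k) * wave p.1 (n + 1) (addBoson k x)
              + conj (h k) * wave q.1 (n + 1) (addBoson k x) := by
          filter_upwards [ae_addBoson (wave_add p.1 q.1 (n + 1))] with x hx
          filter_upwards [hx] with k hk
          simp only [Prod.fst_add, hk, Pi.add_apply, mul_add]
        constructor
        · filter_upwards [h0, (hp n).1, (hq n).1] with x h1 h2 h3
          exact (h2.add h3).congr h1.symm
        · filter_upwards [h0, (hp n).1, (hq n).1, (hp n).2, (hq n).2, wave_add p.2 q.2 n]
            with x h1 h2 h3 h4 h5 h6
          rw [integral_congr_ae h1, integral_add h2 h3]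
          simp only [Prod.snd_add, h6, Pi.add_apply, h4, h5, mul_add]
      smul_mem' := by
        intro c p hp n
        have h0 : ∀ᵐ x : Fin n → R3, (fun k : R3 =>
            conj (h k) * wave (c • p).1 (n + 1) (addBoson k x)) =ᵐ[volume]
            fun k => c * (conj (h k) * wave p.1 (n + 1) (addBoson k x)) := by
          filter_upwards [ae_addBoson (wave_smul c p.1 (n + 1))] with x hx
          filter_upwards [hx] with k hk
          simp only [Prod.smul_fst, hk, Pi.smul_apply, smul_eq_mul]
          ring
        constructor
        · filter_upwards [h0, (hp n).1] with x h1 h2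
          exact (h2.const_mul c).congr h1.symm
        · filter_upwards [h0, (hp n).2, wave_smul c p.2 n] with x h1 h4 h6
          rw [integral_congr_ae h1, integral_const_mul]
          simp only [Prod.smul_snd, h6, Pi.smul_apply, h4, smul_eq_mul]
          ring }

/-! ## The Spin-Boson model -/

/-- The Hilbert space `ℂ² ⊗ Fock`, identified with `Fock ⊕ Fock`: the pair `(ψ₀, ψ₁)` stands for
`(1,0)ᵀ ⊗ ψ₀ + (0,1)ᵀ ⊗ ψ₁`. -/
abbrev Hilb : Type := PiLp 2 fun _ : Fin 2 => Fock

/-- `M ⊗ 1` for a `2 × 2` matrix `M`. -/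
def spinOp (M : Matrix (Fin 2) (Fin 2) ℂ) : Hilb →ₗ[ℂ] Hilb where
  toFun ψ := WithLp.toLp 2 fun i => ∑ j, M i j • ψ j
  map_add' ψ φ := by
    ext1 i
    simp [Finset.sum_add_distrib, smul_add]
  map_smul' c ψ := by
    ext1 i
    simp [smul_smul, mul_comm, smul_add]

/-- `1 ⊗ A` for an operator `A` on Fock space, with domain `ℂ² ⊗ D(A)`. -/
def fieldOp (A : Fock →ₗ.[ℂ] Fock) : Hilb →ₗ.[ℂ] Hilb :=
  Submodule.toLinearPMap
    { carrier := {p | ∀ i, (p.1 i, p.2 i) ∈ A.graph}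
      zero_mem' := fun _ => A.graph.zero_mem
      add_mem' := fun hp hq i => A.graph.add_mem (hp i) (hq i)
      smul_mem' := fun c _ hp i => A.graph.smul_mem c (hp i) }

/-- The Pauli matrix `σ₁`, acting on `ℂ² ⊗ Fock`. -/
def sigma1 : Hilb →ₗ[ℂ] Hilb := spinOp !![0, 1; 1, 0]

/-- The boson form factor `f(k) = exp(-k²/Λ²) |k|^(-1/2 + μ)`. -/
def formFactor (Λ μ : ℝ) (k : R3) : ℝ := Real.exp (-‖k‖ ^ 2 / Λ ^ 2) * ‖k‖ ^ (-(1 / 2) + μ)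

/-- The free Hamiltonian `H₀ = K + H_f` with `K = diag(e₁, e₀)` and `e₀ = 0`. -/
def freeH (e₁ : ℝ) : Hilb →ₗ.[ℂ] Hilb :=
  (spinOp !![(e₁ : ℂ), 0; 0, 0]).toPMap ⊤ + fieldOp fieldH

/-- The interaction `V = σ₁ ⊗ (a(f) + a(f)*)`. -/
def interaction (f : R3 → ℂ) : Hilb →ₗ.[ℂ] Hilb :=
  sigma1.compPMap (fieldOp (annih f + (annih f)†))

/-- The Spin-Boson Hamiltonian `H = H₀ + g V` on the intersection of the domains of `H₀`
and `V`. -/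
def spinBosonH (e₁ Λ μ g : ℝ) : Hilb →ₗ.[ℂ] Hilb :=
  freeH e₁ + (g : ℂ) • interaction fun k => (formFactor Λ μ k : ℂ)

/-! ## Asymptotic operators and scattering coefficients -/

/-- `h ∈ C_c^∞(ℝ³ ∖ {0}, ℂ)`. -/
def IsTest (h : R3 → ℂ) : Prop :=
  ContDiff ℝ ∞ h ∧ HasCompactSupport h ∧ (0 : R3) ∉ tsupport h

/-- `h_t(k) = h(k) e^{-itω(k)}`. -/
def freeEvol (h : R3 → ℂ) (t : ℝ) (k : R3) : ℂ := h k * Complex.exp (-(Complex.I * t * ‖k‖))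

/-- `a_t(h) = e^{itH} a(h_t) e^{-itH}`, on the set of all `ψ` with `e^{-itH} ψ ∈ D(a(h_t))`. -/
def annihAt (H : Hilb →ₗ.[ℂ] Hilb) (t : ℝ) (h : R3 → ℂ) : Hilb →ₗ.[ℂ] Hilb where
  domain := (fieldOp (annih (freeEvol h t))).domain.comap (evolution H t).toLinearMap
  toFun := (evolution H (-t)).toLinearMap ∘ₗ (fieldOp (annih (freeEvol h t))).toFun ∘ₗ
    (evolution H t).toLinearMap.restrict fun _ hx => hx

/-- The asymptotic annihilation operator `a_±(h) ψ = lim a_t(h) ψ`, where `t → ∞` for `F = atTop`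
and `t → -∞` for `F = atBot`, defined on the `ψ ∈ ℂ² ⊗ D(H_f^{1/2})` for which the limit exists. -/
def annihAsymp (H : Hilb →ₗ.[ℂ] Hilb) (F : Filter ℝ) (h : R3 → ℂ) : Hilb →ₗ.[ℂ] Hilb :=
  Submodule.toLinearPMap
    { carrier := {p | p.1 ∈ (fieldOp fieldHSqrt).domain ∧
        ∃ hp : ∀ t, p.1 ∈ (annihAt H t h).domain,
          Tendsto (fun t => annihAt H t h ⟨p.1, hp t⟩) F (𝓝 p.2)}
      zero_mem' := by
        refine ⟨Submodule.zero_mem _, fun t => Submodule.zero_mem _, ?_⟩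
        have h0 : ∀ t, annihAt H t h ⟨0, Submodule.zero_mem _⟩ = 0 :=
          fun t => LinearPMap.map_zero _
        exact tendsto_const_nhds.congr fun t => (h0 t).symm
      add_mem' := by
        rintro p q ⟨hp, hp1, hp2⟩ ⟨hq, hq1, hq2⟩
        refine ⟨Submodule.add_mem _ hp hq,
          fun t => Submodule.add_mem _ (hp1 t) (hq1 t), ?_⟩
        refine (hp2.add hq2).congr fun t => ?_
        exact (LinearPMap.map_add (annihAt H t h) ⟨p.1, hp1 t⟩ ⟨q.1, hq1 t⟩).symm
      smul_mem' := by
        rintro c p ⟨hp, hp1, hp2⟩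
        refine ⟨Submodule.smul_mem _ c hp, fun t => Submodule.smul_mem _ c (hp1 t), ?_⟩
        refine (hp2.const_smul c).congr fun t => ?_
        exact (LinearPMap.map_smul (annihAt H t h) c ⟨p.1, hp1 t⟩).symm }

/-- The asymptotic creation operator `a_±(h)*`, the adjoint of `a_±(h)`. -/
def creatAsymp (H : Hilb →ₗ.[ℂ] Hilb) (F : Filter ℝ) (h : R3 → ℂ) : Hilb →ₗ.[ℂ] Hilb :=
  (annihAsymp H F h)†

/-- The two-body scattering matrix coefficient
`S(h,l) = ‖Ψ‖⁻² ⟨a_+(h)* Ψ, a_-(l)* Ψ⟩`. -/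
def scatCoeff (H : Hilb →ₗ.[ℂ] Hilb) (Ψ : Hilb) (h l : R3 → ℂ) : ℂ :=
  (‖Ψ‖ ^ 2 : ℂ)⁻¹ *
    inner ℂ (opApply (creatAsymp H atTop h) Ψ) (opApply (creatAsymp H atBot l) Ψ)

/-- The two-body transition matrix coefficient `T(h,l) = S(h,l) - ⟨h,l⟩₂`. -/
def transCoeff (H : Hilb →ₗ.[ℂ] Hilb) (Ψ : Hilb) (h l : R3 → ℂ) : ℂ :=
  scatCoeff H Ψ h l - ∫ k : R3, conj (h k) * l k

/-- The unit sphere in `ℝ³`. -/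
abbrev S2 : Type := Metric.sphere (0 : R3) 1

/-- The surface measure (solid angle) on the unit sphere. -/
def solidAngle : Measure S2 := (volume : Measure R3).toSphere

/-- `W(k) = |k|² l(k) ∫ conj(h(|k|,Σ)) f(|k|,Σ) dΣ`. -/
def shellFn (f h l : R3 → ℂ) (k : R3) : ℂ :=
  (‖k‖ ^ 2 : ℂ) * l k * ∫ s : S2, conj (h (‖k‖ • (s : R3))) * f (‖k‖ • (s : R3)) ∂solidAngle

/-- The quadratic form `⟨Φ, a(k)* Ψ⟩ = ⟨a(k) Φ, Ψ⟩` of the point-wise creation operator, where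
`(a(k) Φ)⁽ⁿ⁾(k₁,…,kₙ) = √(n+1) Φ⁽ⁿ⁺¹⁾(k,k₁,…,kₙ)`. -/
def creatForm (k : R3) (Φ Ψ : Hilb) : ℂ :=
  ∑ i : Fin 2, ∑' n : ℕ, ∫ x : Fin n → R3,
    conj ((√(n + 1 : ℝ) : ℂ) * wave (Φ i) (n + 1) (addBoson k x)) * wave (Ψ i) n x

/-- The quadratic form `⟨Φ, a_t(k)* Ψ⟩` of the point-wise operator
`a_t(k)* = e^{itH} e^{-itω(k)} a(k)* e^{-itH}`. -/
def creatFormAt (H : Hilb →ₗ.[ℂ] Hilb) (t : ℝ) (k : R3) (Φ Ψ : Hilb) : ℂ :=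
  Complex.exp (-(Complex.I * t * ‖k‖)) * creatForm k (evolution H t Φ) (evolution H t Ψ)

/-- The integral kernel `T_t(k,k') = -2πi g f(k) ‖Ψ‖⁻² ⟨σ₁ Ψ, a_t(k')* Ψ⟩`. -/
def transKernel (H : Hilb →ₗ.[ℂ] Hilb) (g : ℝ) (f : R3 → ℂ) (Ψ : Hilb) (t : ℝ) (k k' : R3) : ℂ :=
  -2 * Real.pi * Complex.I * g * f k * (‖Ψ‖ ^ 2 : ℂ)⁻¹ * creatFormAt H t k' (sigma1 Ψ) Ψ

/-- The measure `dr dΣ dΣ'` on the energy shell `{(k,k') : |k| = |k'| = r > 0}`, where `k = rΣ`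
and `k' = rΣ'`. -/
def shellMeasure : Measure (ℝ × S2 × S2) :=
  (volume.restrict (Ioi 0)).prod (solidAngle.prod solidAngle)

/-- The integrand of `∫ conj(h(k)) l(k') δ(|k| - |k'|) T(k,k') dk dk'` on the energy shell:
in polar coordinates this integral is
`∫ r⁴ conj(h(rΣ)) l(rΣ') T(rΣ,rΣ') dr dΣ dΣ'`. -/
def shellIntegrand (h l : R3 → ℂ) (T : R3 → R3 → ℂ) (p : ℝ × S2 × S2) : ℂ :=
  (p.1 ^ 4 : ℂ) * conj (h (p.1 • (p.2.1 : R3))) * l (p.1 • (p.2.2 : R3)) *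
    T (p.1 • (p.2.1 : R3)) (p.1 • (p.2.2 : R3))

end SpinBoson

end

/-!
The Hamiltonian is a small perturbation of `H₀ = 1 ⊗ H_f`: since both `f` and `|k|^{-1/2} f` are
square integrable, `K + g V` has relative `H₀`-bound zero, so by Kato–Rellich `H` is self-adjoint
on `ℂ² ⊗ D(H_f)` and generates a unitary group there (`isUnitaryGroupOf_evolution`).

Cook's method gives the asymptotic operators. The free evolution of `a(h_t)` is trivial and
`[a(h_t), V] = ⟨h_t, f⟩ σ₁`, so `a_t(h) ψ` has derivative `-i g ⟨h_t, f⟩ σ₁(t) ψ`, where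
`σ₁(t) = e^{itH} σ₁ e^{-itH}` (`hasDerivAt_inner_annH_orbit`). In polar coordinates
`c(t) = ⟨h_t, f⟩` is the Fourier transform of a smooth density with compact support in `(0, ∞)`,
hence integrable. Thus `a_t(h) ψ` is `a(h) ψ` plus a norm-convergent Duhamel integral, first on
the domain of `H` and then, because the annihilation operators are closed, on the whole domain
of the square root of the field energy (`annih_mem_graph_evolution`, `domain_annihAsymp`); the
adjoints are treated in the same way (`creH_orbit`, `opApply_creatAsymp`).

Let `Ψ` be an eigenvector. The Duhamel formula between `-∞` and `+∞` reads
`a_+(h)* Ψ = a_-(h)* Ψ + i g ∫ conj (c τ) σ₁(τ) Ψ dτ` (`outVec_eq`). Two facts turn the inner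
product with `a_-(l)* Ψ` into the formula of the theorem.

* `⟨a_-(h)* Ψ, a_-(l)* Ψ⟩ = ⟨h, l⟩ ‖Ψ‖²` (`inner_inVec_inVec`): by the canonical commutation
  relations the difference of the two sides is, before the limit, an inner product of
  annihilated vectors, and `a(h_t) Ψ → 0` by the Riemann–Lebesgue lemma.
* `⟨σ₁(τ) Ψ, a_-(l)* Ψ⟩ = ⟨σ₁ Ψ, a_-(l_τ)* Ψ⟩` (`inner_heis_inVec`): moving `τ` onto `l`, the
  eigenvalue phases cancel. By Fubini the `τ`-integral acts on the test function alone, and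
  Fourier inversion in the energy variable gives `∫ c(τ) l_τ dτ = 2π W`
  (`integral_coupling_mul`, `integral_coupling_inVec`), which is the energy shell.

The formula with the point-wise operators `a_t(k)*` is the one with `W` at finite time: in polar
coordinates the integral over the shell is `⟨σ₁ Ψ, e^{itH} a(W_t)* e^{-itH} Ψ⟩`
(`integral_shell`, `inner_sigma_creEvol`), whose limit `t → -∞` defines `a_-(W)* Ψ`.
-/

open MeasureTheory Filter Topology Set
open scoped ENNReal ContDiff ComplexConjugate InnerProductSpace LinearPMap

noncomputable section

namespace SpinBoson

/-! ### Self-adjoint operators generate unitary groups -/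

section UnitaryGroups

variable {X : Type*} [NormedAddCommGroup X] [InnerProductSpace ℂ X]

/-- The unitary group `t ↦ e^{-itB}` of a bounded operator `B`, by its exponential series. -/
def bddGroup (B : X →L[ℂ] X) (t : ℝ) : X →L[ℂ] X :=
  NormedSpace.exp (t • ((-Complex.I) • B))

theorem bddGroup_zero (B : X →L[ℂ] X) : bddGroup B 0 = ContinuousLinearMap.id ℂ X := by
  simp [bddGroup, NormedSpace.exp_zero]; rfl

theorem tendsto_of_dense {X : Type*} [NormedAddCommGroup X] {D : Set X} (hD : Dense D)
    {F : ℕ → X → X} {L : X → X}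
    (hF : ∀ j ψ φ, ‖F j ψ - F j φ‖ ≤ ‖ψ - φ‖) (hL : ∀ ψ φ, ‖L ψ - L φ‖ ≤ ‖ψ - φ‖)
    (h : ∀ ψ ∈ D, Tendsto (fun j => F j ψ) atTop (𝓝 (L ψ))) (ψ : X) :
    Tendsto (fun j => F j ψ) atTop (𝓝 (L ψ)) := by
  rw [Metric.tendsto_atTop]
  intro ε hε
  obtain ⟨φ, hφ, hd⟩ := Metric.dense_iff.1 hD ψ (ε / 3) (by positivity)
  obtain ⟨N, hN⟩ := Metric.tendsto_atTop.1 (h φ hd) (ε / 3) (by positivity)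
  refine ⟨N, fun j hj => ?_⟩
  have h1 := hN j hj
  have h2 := hF j ψ φ
  have h3 := hL φ ψ
  rw [Metric.mem_ball, dist_eq_norm] at hφ
  rw [dist_eq_norm] at h1 ⊢
  rw [norm_sub_rev ψ φ] at h2
  have : F j ψ - L ψ = (F j ψ - F j φ) + (F j φ - L φ) + (L φ - L ψ) := by abel
  rw [this]
  linarith [norm_add₃_le (a := F j ψ - F j φ) (b := F j φ - L φ) (c := L φ - L ψ)]

theorem cauchySeq_of_dense {X : Type*} [NormedAddCommGroup X] {D : Set X} (hD : Dense D)
    {F : ℕ → X → X}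
    (hF : ∀ j ψ φ, ‖F j ψ - F j φ‖ ≤ ‖ψ - φ‖)
    (h : ∀ ψ ∈ D, CauchySeq fun j => F j ψ) (ψ : X) : CauchySeq fun j => F j ψ := by
  rw [Metric.cauchySeq_iff]
  intro ε hε
  obtain ⟨φ, hφ, hd⟩ := Metric.dense_iff.1 hD ψ (ε / 3) (by positivity)
  obtain ⟨N, hN⟩ := Metric.cauchySeq_iff.1 (h φ hd) (ε / 3) (by positivity)
  refine ⟨N, fun j hj i hi => ?_⟩
  have h1 := hN j hj i hi
  have h2 := hF j ψ φ
  have h3 := hF i φ ψ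
  rw [Metric.mem_ball, dist_eq_norm] at hφ
  rw [dist_eq_norm] at h1 ⊢
  rw [norm_sub_rev ψ φ] at h2
  have : F j ψ - F i ψ = (F j ψ - F j φ) + (F j φ - F i φ) + (F i φ - F i ψ) := by abel
  rw [this]
  linarith [norm_add₃_le (a := F j ψ - F j φ) (b := F j φ - F i φ) (c := F i φ - F i ψ)]

/-- `A` is symmetric, in terms of its graph. -/
def IsSymm (A : X →ₗ.[ℂ] X) : Prop :=
  ∀ p ∈ A.graph, ∀ q ∈ A.graph, inner ℂ p.2 q.1 = inner ℂ p.1 q.2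

/-- `R` is a right inverse of `A + i n`. -/
def IsResolvent (A : X →ₗ.[ℂ] X) (n : ℝ) (R : X →L[ℂ] X) : Prop :=
  ∀ η, (R η, η - (Complex.I * n) • R η) ∈ A.graph

variable {A : X →ₗ.[ℂ] X}

theorem IsSymm.norm_sq_add (hA : IsSymm A) {p : X × X} (hp : p ∈ A.graph) (n : ℝ) :
    ‖p.2 + (Complex.I * n) • p.1‖ ^ 2 = ‖p.2‖ ^ 2 + n ^ 2 * ‖p.1‖ ^ 2 := by
  have h := hA p hp p hp
  rw [norm_add_sq (𝕜 := ℂ), inner_smul_right, h, norm_smul]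
  have h2 : (inner ℂ p.1 p.2).im = 0 := by
    rw [← Complex.conj_eq_iff_im, inner_conj_symm, h]
  simp [h2, mul_pow]

theorem IsSymm.norm_le (hA : IsSymm A) {p : X × X} (hp : p ∈ A.graph) {n : ℝ} (hn : n ≠ 0) :
    ‖p.1‖ ≤ |n|⁻¹ * ‖p.2 + (Complex.I * n) • p.1‖ := by
  have h := hA.norm_sq_add hp n
  have hn' : 0 < |n| := abs_pos.2 hn
  rw [inv_mul_eq_div, le_div_iff₀ hn']
  apply le_of_sq_le_sq _ (norm_nonneg _)
  rw [h, mul_pow, sq_abs]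
  nlinarith [sq_nonneg ‖p.2‖]

/-- A symmetric operator has a bounded `(A + in)⁻¹` as soon as `A + in` is onto. -/
theorem IsSymm.exists_resolvent (hA : IsSymm A) {n : ℝ} (hn : n ≠ 0)
    (hs : ∀ η, ∃ p ∈ A.graph, p.2 + (Complex.I * n) • p.1 = η) : ∃ R, IsResolvent A n R := by
  choose p hp hpe using hs
  have huniq : ∀ q ∈ A.graph, ∀ η, q.2 + (Complex.I * n) • q.1 = η → q.1 = (p η).1 := by
    intro q hq η h
    have := hA.norm_le (A.graph.sub_mem hq (hp η)) hn
    rw [← sub_eq_zero, ← norm_le_zero_iff]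
    refine this.trans (le_of_eq ?_)
    simp only [Prod.snd_sub, Prod.fst_sub, smul_sub]
    rw [sub_add_sub_comm, h, hpe, sub_self, norm_zero, mul_zero]
  let L : X →ₗ[ℂ] X :=
    { toFun := fun η => (p η).1
      map_add' := fun x y => (huniq _ (A.graph.add_mem (hp x) (hp y)) _ (by
        simp only [Prod.snd_add, Prod.fst_add, smul_add]
        rw [add_add_add_comm, hpe, hpe])).symm
      map_smul' := fun c x => (huniq _ (A.graph.smul_mem c (hp x)) _ (by
        simp only [Prod.smul_snd, Prod.smul_fst]
        rw [smul_comm, ← smul_add, hpe])).symm }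
  refine ⟨L.mkContinuous |n|⁻¹ fun η => ?_, fun η => ?_⟩
  · have := hA.norm_le (hp η) hn
    rwa [hpe] at this
  · have : (p η).2 = η - (Complex.I * n) • (p η).1 := eq_sub_of_add_eq (hpe η)
    change ((p η).1, η - (Complex.I * n) • (p η).1) ∈ A.graph
    rw [← this]
    exact hp η

section Resolvents

variable {n m : ℝ} {R S : X →L[ℂ] X}

theorem IsResolvent.norm_le (hR : IsResolvent A n R) (hA : IsSymm A) (hn : n ≠ 0) (η : X) :
    ‖R η‖ ≤ |n|⁻¹ * ‖η‖ := by
  simpa using hA.norm_le (hR η) hn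

theorem IsResolvent.apply (hR : IsResolvent A n R) (hA : IsSymm A) (hn : n ≠ 0) {ψ χ : X}
    (h : (ψ, χ) ∈ A.graph) : R (χ + (Complex.I * n) • ψ) = ψ := by
  have := hA.norm_le (A.graph.sub_mem (hR (χ + (Complex.I * n) • ψ)) h) hn
  rw [← sub_eq_zero, ← norm_le_zero_iff]
  refine this.trans (le_of_eq ?_)
  simp only [Prod.mk_sub_mk, smul_sub]
  convert mul_zero _
  rw [norm_eq_zero]
  abel

/-- The adjoint of `(A + in)⁻¹` is `(A - in)⁻¹`. -/
theorem IsResolvent.inner (hR : IsResolvent A n R) (hS : IsResolvent A (-n) S) (hA : IsSymm A)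
    (η ζ : X) : inner ℂ (R η) ζ = inner ℂ η (S ζ) := by
  have h := hA _ (hR η) _ (hS ζ)
  simp only [inner_sub_left, inner_sub_right, inner_smul_left, inner_smul_right] at h
  simp at h
  exact h.symm

/-- The resolvent identity. -/
theorem IsResolvent.sub_comm (hR : IsResolvent A n R) (hS : IsResolvent A m S) (hA : IsSymm A)
    (hn : n ≠ 0) (η : X) : S η - R η = (Complex.I * (n - m)) • R (S η) := by
  have h := hR.apply hA hn (hS η)
  have h2 : η - (Complex.I * m) • S η + (Complex.I * n) • S η =
      η + (Complex.I * (n - m)) • S η := by module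
  rw [h2, map_add, map_smul] at h
  rw [sub_eq_iff_eq_add', h]

theorem IsResolvent.commute (hR : IsResolvent A n R) (hS : IsResolvent A m S) (hA : IsSymm A)
    (hn : n ≠ 0) (hm : m ≠ 0) : Commute R S := by
  ext η
  simp only [ContinuousLinearMap.mul_def, ContinuousLinearMap.comp_apply]
  have h1 := hR.sub_comm hS hA hn η
  have h2 := hS.sub_comm hR hA hm η
  rcases eq_or_ne n m with rfl | hnm
  · have h3 : R = S := by
      ext η
      have := hR.sub_comm hS hA hn η
      rw [sub_self, mul_zero, zero_smul, sub_eq_zero] at this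
      exact this.symm
    rw [h3]
  · have h3 : (Complex.I * (n - m)) • R (S η) = (Complex.I * (n - m)) • S (R η) := by
      rw [← h1, ← neg_sub, h2, ← neg_smul]
      congr 1
      ring
    refine smul_right_injective X ?_ h3
    simp [sub_eq_zero, hnm]

end Resolvents

variable [CompleteSpace X]

theorem bddGroup_add (B : X →L[ℂ] X) (s t : ℝ) :
    bddGroup B (s + t) = (bddGroup B s).comp (bddGroup B t) := by
  let _ := NormedAlgebra.restrictScalars ℚ ℂ (X →L[ℂ] X)
  unfold bddGroup
  rw [add_smul, NormedSpace.exp_add_of_commute]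
  · rfl
  · exact ((Commute.refl _).smul_left s).smul_right t

theorem norm_bddGroup {B : X →L[ℂ] X} (hB : IsSelfAdjoint B) (t : ℝ) (ψ : X) :
    ‖bddGroup B t ψ‖ = ‖ψ‖ := by
  have hs : IsSelfAdjoint ((-t : ℝ) • B) := IsSelfAdjoint.smul (by simp [IsSelfAdjoint]) hB
  have h := (selfAdjoint.expUnitary ⟨_, hs⟩).2
  have h2 : ((selfAdjoint.expUnitary ⟨_, hs⟩ : unitary (X →L[ℂ] X)) : X →L[ℂ] X)
      = bddGroup B t := by
    rw [selfAdjoint.expUnitary_coe, bddGroup]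
    congr 1
    simp only [neg_smul, smul_neg, smul_comm t]
  rw [h2] at h
  exact ContinuousLinearMap.norm_map_of_mem_unitary h ψ

theorem hasDerivAt_bddGroup (B : X →L[ℂ] X) (ψ : X) (t : ℝ) :
    HasDerivAt (fun t => bddGroup B t ψ) (bddGroup B t (-Complex.I • B ψ)) t := by
  have h := hasDerivAt_exp_smul_const (𝕂 := ℝ) ((-Complex.I) • B) t
  have h2 : HasDerivAt (fun t => bddGroup B t)
    (bddGroup B t * ((-Complex.I) • B)) t := h
  exact ((ContinuousLinearMap.apply ℂ X ψ).restrictScalars ℝ).hasFDerivAt.comp_hasDerivAt t h2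

theorem norm_bddGroup_sub_self_le {B : X →L[ℂ] X} (hB : IsSelfAdjoint B) (t : ℝ) (ψ : X) :
    ‖bddGroup B t ψ - ψ‖ ≤ ‖B ψ‖ * |t| := by
  have := Convex.norm_image_sub_le_of_norm_hasDerivWithin_le (s := univ) (x := (0 : ℝ)) (y := t)
    (C := ‖B ψ‖) (fun s _ => (hasDerivAt_bddGroup B ψ s).hasDerivWithinAt)
    (fun s _ => by rw [norm_bddGroup hB, norm_smul]; simp) convex_univ (mem_univ _) (mem_univ _)
  simpa [bddGroup_zero] using this

/-- For commuting generators, `e^{-itB} = e^{-itC} e^{-it(B-C)}` compares the groups on each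
vector. -/
theorem norm_bddGroup_sub_bddGroup_le {B C : X →L[ℂ] X} (hB : IsSelfAdjoint B)
    (hC : IsSelfAdjoint C) (hBC : Commute B C) (t : ℝ) (ψ : X) :
    ‖bddGroup B t ψ - bddGroup C t ψ‖ ≤ ‖B ψ - C ψ‖ * |t| := by
  have h : bddGroup B t = (bddGroup C t).comp (bddGroup (B - C) t) := by
    let _ := NormedAlgebra.restrictScalars ℚ ℂ (X →L[ℂ] X)
    unfold bddGroup
    rw [← ContinuousLinearMap.mul_def, ← NormedSpace.exp_add_of_commute, ← smul_add, ← smul_add,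
      add_sub_cancel]
    exact ((((hBC.symm.sub_right (Commute.refl C)).smul_left _).smul_right _).smul_left
      _).smul_right _
  rw [h, ContinuousLinearMap.comp_apply, ← map_sub, norm_bddGroup hC, ← sub_apply]
  exact norm_bddGroup_sub_self_le (hB.sub hC) t ψ

/-- A vector `η` orthogonal to the domain is orthogonal to `ψ = (A + in)⁻¹ η`; symmetry of `A`
forces `ψ = 0` and hence `η = 0`. -/
theorem IsSymm.dense_domain (hA : IsSymm A) {n : ℝ} {R : X →L[ℂ] X} (hR : IsResolvent A n R)
    (hn : n ≠ 0) :
    Dense (A.domain : Set X) := by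
  rw [Submodule.dense_iff_topologicalClosure_eq_top, Submodule.topologicalClosure_eq_top_iff,
    Submodule.eq_bot_iff]
  intro η hη
  have hmem := hR η
  have h0 : inner ℂ (R η) η = 0 := hη _ (LinearPMap.mem_domain_of_mem_graph hmem)
  set ψ := R η
  have h1 := hA _ hmem _ hmem
  have h2 := hA.norm_le hmem hn
  simp only [inner_sub_left, inner_sub_right, inner_smul_left, inner_smul_right, h0] at h1
  rw [← inner_conj_symm η ψ, h0] at h1
  have h3 : inner ℂ ψ ψ = 0 := by
    simp at h1
    have h1' : (2 * Complex.I * n) * inner ℂ ψ ψ = 0 := by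
      rw [inner_self_eq_norm_sq_to_K]
      linear_combination h1
    simpa [hn] using h1'
  rw [inner_self_eq_zero] at h3
  have h4 := hmem
  rw [h3, smul_zero, sub_zero] at h4
  exact (LinearPMap.graph_fst_eq_zero_snd A h4 rfl)

end UnitaryGroups

/-! ### Yosida approximation -/

section Yosida

variable {X : Type*} [NormedAddCommGroup X] [InnerProductSpace ℂ X]

/-- The Yosida approximation `A n² (A² + n²)⁻¹` of `A`, in terms of resolvents. -/
def yosida (R : ℝ → X →L[ℂ] X) (n : ℝ) : X →L[ℂ] X := ((n ^ 2 / 2 : ℝ) : ℂ) • (R n + R (-n))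

variable {A : X →ₗ.[ℂ] X} {R : ℝ → X →L[ℂ] X}

theorem yosida_apply {n : ℝ} (hR : IsResolvent A n (R n)) (hR' : IsResolvent A (-n) (R (-n)))
    (hA : IsSymm A) (hn : n ≠ 0) {ψ χ : X} (h : (ψ, χ) ∈ A.graph) :
    yosida R n ψ = (1 / 2 : ℂ) • ((Complex.I * n) • R n χ + (Complex.I * (-n : ℝ)) • R (-n) χ) := by
  have h1 := hR.apply hA hn h
  have h2 := hR'.apply hA (neg_ne_zero.2 hn) h
  rw [map_add, map_smul] at h1 h2
  have h3 : R n χ = ψ - (Complex.I * n) • R n ψ := eq_sub_of_add_eq h1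
  have h4 : R (-n) χ = ψ - (Complex.I * (-n : ℝ)) • R (-n) ψ := eq_sub_of_add_eq h2
  rw [h3, h4, yosida]
  simp only [smul_apply, add_apply, smul_sub, smul_add,
    smul_smul]
  push_cast
  have e1 : 1 / 2 * (Complex.I * n * (Complex.I * n)) = -((n : ℂ) ^ 2 / 2) := by
    linear_combination (n ^ 2 / 2 : ℂ) * Complex.I_mul_I
  have e2 : 1 / 2 * (Complex.I * -n * (Complex.I * -n)) = -((n : ℂ) ^ 2 / 2) := by
    linear_combination (n ^ 2 / 2 : ℂ) * Complex.I_mul_I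
  rw [e1, e2]
  module

theorem commute_yosida {n m : ℝ} (hR : ∀ x ∈ ({n, -n} : Set ℝ), ∀ y ∈ ({m, -m} : Set ℝ),
    Commute (R x) (R y)) : Commute (yosida R n) (yosida R m) := by
  refine Commute.smul_left (Commute.smul_right ?_ _) _
  exact ((hR _ (by simp) _ (by simp)).add_right (hR _ (by simp) _ (by simp))).add_left
    ((hR _ (by simp) _ (by simp)).add_right (hR _ (by simp) _ (by simp)))

variable [CompleteSpace X]

theorem isSelfAdjoint_yosida {n : ℝ} (hR : IsResolvent A n (R n))
    (hR' : IsResolvent A (-n) (R (-n))) (hA : IsSymm A) : IsSelfAdjoint (yosida R n) := by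
  rw [ContinuousLinearMap.isSelfAdjoint_iff_isSymmetric]
  intro η ζ
  have h1 := hR.inner hR' hA η ζ
  have h2 : inner ℂ (R (-n) η) ζ = inner ℂ η (R n ζ) := by
    rw [← inner_conj_symm, ← hR.inner hR' hA, inner_conj_symm]
  simp only [yosida, ContinuousLinearMap.coe_coe, smul_apply,
    add_apply, inner_smul_left, inner_smul_right, inner_add_left,
    inner_add_right, h1, h2, Complex.conj_ofReal]
  ring

/-- `in (A + in)⁻¹ → 1` strongly as `|n| → ∞`. -/
theorem tendsto_resolvent (hA : IsSymm A) {ν : ℕ → ℝ} (hν : Tendsto (fun j => |ν j|) atTop atTop)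
    (hν0 : ∀ j, ν j ≠ 0) (hR : ∀ j, IsResolvent A (ν j) (R (ν j))) (χ : X) :
    Tendsto (fun j => (Complex.I * ν j) • R (ν j) χ) atTop (𝓝 χ) := by
  refine tendsto_of_dense (hA.dense_domain (hR 0) (hν0 0))
    (F := fun j ψ => (Complex.I * ν j) • R (ν j) ψ) (L := id) ?_ (fun _ _ => le_rfl) ?_ χ
  · intro j ψ φ
    rw [← smul_sub, ← map_sub, norm_smul, norm_mul, Complex.norm_I, one_mul, Complex.norm_real,
      Real.norm_eq_abs]
    have := (hR j).norm_le hA (hν0 j) (ψ - φ)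
    rw [← le_inv_mul_iff₀ (abs_pos.2 (hν0 j))]
    exact this
  · intro ψ hψ
    have hg : (ψ, A ⟨ψ, hψ⟩) ∈ A.graph := A.mem_graph ⟨ψ, hψ⟩
    have h1 : ∀ j, (Complex.I * ν j) • R (ν j) ψ = ψ - R (ν j) (A ⟨ψ, hψ⟩) := fun j => by
      have := (hR j).apply hA (hν0 j) hg
      rw [map_add, map_smul] at this
      exact eq_sub_of_add_eq' this
    simp only [h1]
    have h2 : Tendsto (fun j => R (ν j) (A ⟨ψ, hψ⟩)) atTop (𝓝 0) := by
      refine squeeze_zero_norm (fun j => (hR j).norm_le hA (hν0 j) _) ?_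
      simpa using (tendsto_inv_atTop_zero.comp hν).mul_const ‖A ⟨ψ, hψ⟩‖
    simpa using (tendsto_const_nhds (x := ψ)).sub h2

/-- A symmetric operator `A` for which `A + i n` is onto for all real `n` of large modulus generates
a unitary group, the strong limit of the groups generated by its Yosida approximations. -/
theorem IsSymm.exists_isUnitaryGroupOf (hA : IsSymm A) {κ : ℝ}
    (hs : ∀ n : ℝ, κ ≤ |n| → ∀ η, ∃ p ∈ A.graph, p.2 + (Complex.I * n) • p.1 = η) :
    ∃ U, IsUnitaryGroupOf A U := by
  have hRex : ∀ n : ℝ, ∃ R : X →L[ℂ] X, κ ≤ |n| → n ≠ 0 → IsResolvent A n R := fun n => by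
    by_cases h : κ ≤ |n| ∧ n ≠ 0
    · obtain ⟨R, hR⟩ := hA.exists_resolvent h.2 (hs n h.1)
      exact ⟨R, fun _ _ => hR⟩
    · exact ⟨0, fun h1 h2 => absurd ⟨h1, h2⟩ h⟩
  choose R hR using hRex
  set ν : ℕ → ℝ := fun j => |κ| + 1 + j with hνdef
  have hνpos : ∀ j, 0 < ν j := fun j => by positivity
  have hν0 : ∀ j, ν j ≠ 0 := fun j => (hνpos j).ne'
  have hνκ : ∀ j, κ ≤ |ν j| := fun j => by
    rw [abs_of_pos (hνpos j)]
    have : (0 : ℝ) ≤ j := j.cast_nonneg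
    simp only [hνdef]
    linarith [le_abs_self κ]
  have hνtop : Tendsto (fun j => |ν j|) atTop atTop :=
    tendsto_abs_atTop_atTop.comp (tendsto_atTop_add_const_left _ _ tendsto_natCast_atTop_atTop)
  have hRp : ∀ j, IsResolvent A (ν j) (R (ν j)) := fun j => hR _ (hνκ j) (hν0 j)
  have hRm : ∀ j, IsResolvent A (-ν j) (R (-ν j)) := fun j =>
    hR _ (by rw [abs_neg]; exact hνκ j) (neg_ne_zero.2 (hν0 j))
  have hD := hA.dense_domain (hRp 0) (hν0 0)
  set B : ℕ → X →L[ℂ] X := fun j => yosida R (ν j) with hB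
  have hBs : ∀ j, IsSelfAdjoint (B j) := fun j => isSelfAdjoint_yosida (hRp j) (hRm j) hA
  have hBc : ∀ i j, Commute (B i) (B j) := fun i j => by
    apply commute_yosida
    rintro x (rfl | rfl) y (rfl | rfl)
    · exact (hRp i).commute (hRp j) hA (hν0 i) (hν0 j)
    · exact (hRp i).commute (hRm j) hA (hν0 i) (neg_ne_zero.2 (hν0 j))
    · exact (hRm i).commute (hRp j) hA (neg_ne_zero.2 (hν0 i)) (hν0 j)
    · exact (hRm i).commute (hRm j) hA (neg_ne_zero.2 (hν0 i)) (neg_ne_zero.2 (hν0 j))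
  have hBlim : ∀ ψ χ, (ψ, χ) ∈ A.graph → Tendsto (fun j => B j ψ) atTop (𝓝 χ) := by
    intro ψ χ h
    have e : ∀ j, B j ψ = _ := fun j => yosida_apply (hRp j) (hRm j) hA (hν0 j) h
    simp only [e]
    have h1 := tendsto_resolvent hA hνtop hν0 hRp χ
    have h2 := tendsto_resolvent hA (ν := fun j => -ν j) (by simpa using hνtop)
      (fun j => neg_ne_zero.2 (hν0 j)) hRm χ
    have h3 := (h1.add h2).const_smul (1 / 2 : ℂ)
    have e2 : (1 / 2 : ℂ) • (χ + χ) = χ := by rw [← two_smul ℂ, smul_smul]; norm_num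
    rwa [e2] at h3
  have hiso : ∀ t j ψ φ, ‖bddGroup (B j) t ψ - bddGroup (B j) t φ‖ ≤ ‖ψ - φ‖ := fun t j ψ φ => by
    rw [← map_sub, norm_bddGroup (hBs j)]
  have hcau : ∀ t ψ, CauchySeq fun j => bddGroup (B j) t ψ := fun t => by
    refine cauchySeq_of_dense hD (hiso t) fun ψ hψ => ?_
    have hc := (hBlim _ _ (A.mem_graph ⟨ψ, hψ⟩)).cauchySeq
    rw [Metric.cauchySeq_iff] at hc ⊢
    intro ε hε
    obtain ⟨N, hN⟩ := hc (ε / (|t| + 1)) (by positivity)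
    refine ⟨N, fun m hm n hn => ?_⟩
    have h1 := hN m hm n hn
    rw [dist_eq_norm, lt_div_iff₀ (by positivity)] at h1
    rw [dist_eq_norm]
    have h2 := norm_bddGroup_sub_bddGroup_le (hBs m) (hBs n) (hBc m n) t ψ
    simp only at h1
    nlinarith [norm_nonneg (B m ψ - B n ψ)]
  have hlim : ∀ t ψ, ∃ φ, Tendsto (fun j => bddGroup (B j) t ψ) atTop (𝓝 φ) := fun t ψ =>
    cauchySeq_tendsto_of_complete (hcau t ψ)
  choose U₀ hU₀ using hlim
  have hUnorm : ∀ t ψ, ‖U₀ t ψ‖ = ‖ψ‖ := fun t ψ =>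
    tendsto_nhds_unique (hU₀ t ψ).norm
      (tendsto_const_nhds.congr fun j => (norm_bddGroup (hBs j) t ψ).symm)
  let L : ℝ → X →ₗ[ℂ] X := fun t =>
    { toFun := U₀ t
      map_add' := fun x y => tendsto_nhds_unique (hU₀ t (x + y))
        (((hU₀ t x).add (hU₀ t y)).congr fun j => (map_add _ _ _).symm)
      map_smul' := fun c x => tendsto_nhds_unique (hU₀ t (c • x))
        (((hU₀ t x).const_smul c).congr fun j => (map_smul _ _ _).symm) }
  let U : ℝ → X →L[ℂ] X := fun t => (L t).mkContinuous 1 fun ψ => by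
    rw [one_mul]; exact (hUnorm t ψ).le
  have hU : ∀ t ψ, Tendsto (fun j => bddGroup (B j) t ψ) atTop (𝓝 (U t ψ)) := hU₀
  have hUn : ∀ t ψ, ‖U t ψ‖ = ‖ψ‖ := hUnorm
  have hU0 : U 0 = ContinuousLinearMap.id ℂ X := by
    ext ψ
    refine tendsto_nhds_unique (hU 0 ψ) (tendsto_const_nhds.congr fun j => ?_)
    rw [bddGroup_zero]
  have hUadd : ∀ s t, U (s + t) = (U s).comp (U t) := fun s t => by
    ext ψ
    refine tendsto_nhds_unique (hU (s + t) ψ) ?_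
    rw [ContinuousLinearMap.comp_apply]
    have h1 : Tendsto (fun j => bddGroup (B j) s (bddGroup (B j) t ψ - U t ψ)) atTop (𝓝 0) := by
      rw [tendsto_zero_iff_norm_tendsto_zero]
      simp only [norm_bddGroup (hBs _)]
      rw [← tendsto_zero_iff_norm_tendsto_zero]
      exact tendsto_sub_nhds_zero_iff.2 (hU t ψ)
    have h2 := h1.add (hU s (U t ψ))
    rw [zero_add] at h2
    refine h2.congr fun j => ?_
    rw [← map_add, sub_add_cancel, bddGroup_add, ContinuousLinearMap.comp_apply]
  have hlip : ∀ ψ χ, (ψ, χ) ∈ A.graph → ∀ t, ‖U t ψ - ψ‖ ≤ ‖χ‖ * |t| := fun ψ χ h t => by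
    refine le_of_tendsto_of_tendsto ((hU t ψ).sub_const ψ).norm
      (((hBlim ψ χ h).norm).mul_const |t|) (Eventually.of_forall fun j => ?_)
    exact norm_bddGroup_sub_self_le (hBs j) t ψ
  have hcont0 : ∀ ψ, Tendsto (fun t => U t ψ) (𝓝 0) (𝓝 ψ) := fun ψ => by
    rw [Metric.tendsto_nhds]
    intro ε hε
    obtain ⟨φ, hφ, hd⟩ := Metric.dense_iff.1 hD ψ (ε / 3) (by positivity)
    have hl := hlip φ _ (A.mem_graph ⟨φ, hd⟩)
    have : Tendsto (fun t : ℝ => ‖A ⟨φ, hd⟩‖ * |t|) (𝓝 0) (𝓝 0) := by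
      have : Continuous fun t : ℝ => ‖A ⟨φ, hd⟩‖ * |t| := by fun_prop
      simpa using this.tendsto 0
    filter_upwards [this.eventually_lt_const (show 0 < ε / 3 by positivity)] with t ht
    rw [Metric.mem_ball, dist_eq_norm] at hφ
    rw [dist_eq_norm]
    have e : U t ψ - ψ = U t (ψ - φ) + (U t φ - φ) + (φ - ψ) := by rw [map_sub]; abel
    rw [e]
    have h1 := norm_add₃_le (a := U t (ψ - φ)) (b := U t φ - φ) (c := φ - ψ)
    rw [hUn, norm_sub_rev ψ φ] at h1
    linarith [hl t]
  have hcont : ∀ ψ, Continuous fun t => U t ψ := fun ψ => by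
    rw [continuous_iff_continuousAt]
    intro t
    have h1 : Tendsto (fun s => s - t) (𝓝 t) (𝓝 0) := by
      simpa using (continuous_id.sub continuous_const).tendsto (x := t) (f := fun s : ℝ => s - t)
    have h2 := ((U t).continuous.tendsto ψ).comp ((hcont0 ψ).comp h1)
    refine h2.congr fun s => ?_
    simp only [Function.comp]
    rw [← ContinuousLinearMap.comp_apply, ← hUadd, add_sub_cancel]
  have hgen : ∀ ψ χ, (ψ, χ) ∈ A.graph → HasDerivAt (fun t => U t ψ) (-Complex.I • χ) 0 := by
    intro ψ χ h
    have hint : ∀ t, U t ψ = ψ + ∫ s in (0 : ℝ)..t, U s (-Complex.I • χ) := fun t => by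
      have h1 : ∀ j, bddGroup (B j) t ψ = ψ +
          ∫ s in (0 : ℝ)..t, bddGroup (B j) s (-Complex.I • B j ψ) := fun j => by
        have hc : Continuous fun s => bddGroup (B j) s (-Complex.I • B j ψ) :=
          continuous_iff_continuousAt.2 fun s => (hasDerivAt_bddGroup (B j) _ s).continuousAt
        rw [intervalIntegral.integral_eq_sub_of_hasDerivAt
          (fun s _ => hasDerivAt_bddGroup (B j) ψ s) (hc.intervalIntegrable _ _), bddGroup_zero]
        simp
      refine tendsto_nhds_unique (hU t ψ) ?_
      simp only [h1]
      refine tendsto_const_nhds.add ?_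
      have hBl := (hBlim ψ χ h).const_smul (-Complex.I)
      obtain ⟨M, hM⟩ := hBl.norm.bddAbove_range
      refine intervalIntegral.tendsto_integral_filter_of_dominated_convergence (fun _ => M)
        (Eventually.of_forall fun j => ?_) (Eventually.of_forall fun j => ?_) (by simp)
        (Eventually.of_forall fun s _ => ?_)
      · exact (continuous_iff_continuousAt.2 fun s =>
          (hasDerivAt_bddGroup (B j) _ s).continuousAt).aestronglyMeasurable
      · refine Eventually.of_forall fun s _ => ?_
        rw [norm_bddGroup (hBs j)]
        exact hM (mem_range_self j)
      · have h2 : Tendsto (fun j => bddGroup (B j) s (-Complex.I • B j ψ - -Complex.I • χ)) atTop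
            (𝓝 0) := by
          rw [tendsto_zero_iff_norm_tendsto_zero]
          simp only [norm_bddGroup (hBs _)]
          rw [← tendsto_zero_iff_norm_tendsto_zero]
          exact tendsto_sub_nhds_zero_iff.2 hBl
        have h3 := h2.add (hU s (-Complex.I • χ))
        rw [zero_add] at h3
        refine h3.congr fun j => ?_
        rw [← map_add, sub_add_cancel]
    have h4 := (hcont (-Complex.I • χ)).integral_hasStrictDerivAt 0 0
    have h5 := h4.hasDerivAt.const_add ψ
    simp only [← hint, hU0, ContinuousLinearMap.id_apply] at h5
    exact h5
  refine ⟨U, hU0, hUadd, hUn, hcont, fun ψ φ => ⟨hgen ψ φ, fun hd => ?_⟩⟩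
  -- The generator of `U` extends `A`, and surjectivity of `A + iν` leaves no room for a proper
  -- extension: the difference `ψ - p.1` satisfies `(d/dt) U t (ψ - p.1) = -ν (ψ - p.1)` at `0`,
  -- which contradicts the constancy of the norm unless it vanishes.
  obtain ⟨p, hp, hpe⟩ := hs (ν 0) (hνκ 0) (φ + (Complex.I * ν 0) • ψ)
  have hd2 := hd.sub (hgen p.1 p.2 hp)
  have e1 : -Complex.I • φ - -Complex.I • p.2 = (-(ν 0 : ℂ)) • (ψ - p.1) := by
    have : p.2 = φ + (Complex.I * ν 0) • ψ - (Complex.I * ν 0) • p.1 := eq_sub_of_add_eq hpe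
    rw [this]
    simp only [smul_sub, smul_add, smul_smul]
    have : -Complex.I * (Complex.I * (ν 0)) = ν 0 := by
      linear_combination (-(ν 0 : ℂ)) * Complex.I_mul_I
    rw [this]
    module
  rw [e1] at hd2
  have h6 : HasDerivAt (fun t => ‖U t (ψ - p.1)‖ ^ 2) (-(2 * ν 0 * ‖ψ - p.1‖ ^ 2)) 0 := by
    have hd3 : HasDerivAt (fun t => U t (ψ - p.1)) ((-(ν 0 : ℂ)) • (ψ - p.1)) 0 := by
      refine hd2.congr_of_eventuallyEq (Eventually.of_forall fun t => ?_)
      simp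
    have h7 := Complex.reCLM.hasFDerivAt.comp_hasDerivAt (0 : ℝ) (hd3.inner ℂ hd3)
    have e2 : Complex.reCLM (inner ℂ (U 0 (ψ - p.1)) ((-(ν 0 : ℂ)) • (ψ - p.1)) +
        inner ℂ ((-(ν 0 : ℂ)) • (ψ - p.1)) (U 0 (ψ - p.1))) = -(2 * ν 0 * ‖ψ - p.1‖ ^ 2) := by
      rw [hU0, ContinuousLinearMap.id_apply, inner_smul_left, inner_smul_right,
        inner_self_eq_norm_sq_to_K, map_neg, Complex.conj_ofReal, ← mul_add, Complex.reCLM_apply]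
      change (-(ν 0 : ℂ) * (((‖ψ - p.1‖ : ℝ) : ℂ) ^ 2 + ((‖ψ - p.1‖ : ℝ) : ℂ) ^ 2)).re = _
      rw [← Complex.ofReal_pow, ← Complex.ofReal_add, ← Complex.ofReal_neg, ← Complex.ofReal_mul,
        Complex.ofReal_re]
      ring
    rw [e2] at h7
    refine h7.congr_of_eventuallyEq (Eventually.of_forall fun t => ?_)
    exact (inner_self_eq_norm_sq (𝕜 := ℂ) (U t (ψ - p.1))).symm
  have h8 : HasDerivAt (fun t => ‖U t (ψ - p.1)‖ ^ 2) 0 0 := by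
    simp only [hUn]
    exact hasDerivAt_const _ _
  have h9 := h6.unique h8
  have h10 : ψ - p.1 = 0 := by
    have : ‖ψ - p.1‖ ^ 2 = 0 := by
      have := hνpos 0
      have h11 : ν 0 * ‖ψ - p.1‖ ^ 2 = 0 := by linarith
      exact (mul_eq_zero.1 h11).resolve_left this.ne'
    simpa using this
  have h11 : ψ = p.1 := sub_eq_zero.1 h10
  have h12 : φ = p.2 := by
    rw [h11] at hpe
    exact (add_right_cancel hpe).symm
  rw [h11, h12]
  exact hp

end Yosida

namespace IsUnitaryGroupOf

variable {X : Type*} [NormedAddCommGroup X] [InnerProductSpace ℂ X] {A : X →ₗ.[ℂ] X}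
  {U : ℝ → X →L[ℂ] X}

theorem evolution (h : ∃ U, IsUnitaryGroupOf A U) : IsUnitaryGroupOf A (evolution A) := by
  unfold SpinBoson.evolution
  rw [dif_pos h]
  exact h.choose_spec

theorem apply_add (hU : IsUnitaryGroupOf A U) (s t : ℝ) (ψ : X) : U (s + t) ψ = U s (U t ψ) := by
  rw [hU.add]; rfl

theorem apply_zero (hU : IsUnitaryGroupOf A U) (ψ : X) : U 0 ψ = ψ := by
  rw [hU.zero]; rfl

theorem neg_apply (hU : IsUnitaryGroupOf A U) (t : ℝ) (ψ : X) : U (-t) (U t ψ) = ψ := by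
  rw [← hU.apply_add, neg_add_cancel, hU.apply_zero]

theorem apply_neg (hU : IsUnitaryGroupOf A U) (t : ℝ) (ψ : X) : U t (U (-t) ψ) = ψ := by
  rw [← hU.apply_add, add_neg_cancel, hU.apply_zero]

theorem inner_map_map (hU : IsUnitaryGroupOf A U) (t : ℝ) (ψ φ : X) :
    inner ℂ (U t ψ) (U t φ) = inner ℂ ψ φ :=
  (LinearMap.norm_map_iff_inner_map_map (U t)).1 (hU.norm_map t) ψ φ

theorem inner_neg_left (hU : IsUnitaryGroupOf A U) (t : ℝ) (ψ φ : X) :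
    inner ℂ (U (-t) ψ) φ = inner ℂ ψ (U t φ) := by
  rw [← hU.inner_map_map t, hU.apply_neg]

theorem inner_neg_right (hU : IsUnitaryGroupOf A U) (t : ℝ) (ψ φ : X) :
    inner ℂ ψ (U (-t) φ) = inner ℂ (U t ψ) φ := by
  rw [← hU.inner_map_map t ψ, hU.apply_neg]

theorem mem_graph (hU : IsUnitaryGroupOf A U) {ψ χ : X} (h : (ψ, χ) ∈ A.graph) (t : ℝ) :
    (U t ψ, U t χ) ∈ A.graph := by
  rw [hU.generator] at h ⊢
  have h2 := ((U t).restrictScalars ℝ).hasFDerivAt.comp_hasDerivAt (0 : ℝ) h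
  have e : (fun s => U s (U t ψ)) = ⇑((U t).restrictScalars ℝ) ∘ fun s => U s ψ := by
    ext s
    simp only [Function.comp, ContinuousLinearMap.coe_restrictScalars']
    rw [← hU.apply_add, ← hU.apply_add, add_comm]
  rw [e, ← map_smul]
  exact h2

theorem hasDerivAt (hU : IsUnitaryGroupOf A U) {ψ χ : X} (h : (ψ, χ) ∈ A.graph) (t : ℝ) :
    HasDerivAt (fun s => U s ψ) (-Complex.I • U t χ) t := by
  have h1 := (hU.generator _ _).1 (hU.mem_graph h t)
  have h2 := HasDerivAt.comp_sub_const (f := fun s => U s (U t ψ)) t t (by rwa [sub_self])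
  refine h2.congr_of_eventuallyEq (Eventually.of_forall fun s => ?_)
  simp only
  rw [← hU.apply_add, sub_add_cancel]

theorem eigenvector (hU : IsUnitaryGroupOf A U) {ψ : X} {E : ℝ} (h : (ψ, (E : ℂ) • ψ) ∈ A.graph)
    (t : ℝ) : U t ψ = Complex.exp (-(Complex.I * t * E)) • ψ := by
  have h1 : ∀ s, HasDerivAt (fun s : ℝ => Complex.exp (Complex.I * s * E) • U s ψ) 0 s :=
      fun s => by
    have h2 := hU.hasDerivAt h s
    have h3 : HasDerivAt (fun s : ℝ => Complex.exp (Complex.I * s * E))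
        (Complex.exp (Complex.I * s * E) * (Complex.I * E)) s := by
      have h4 : HasDerivAt (fun s : ℝ => Complex.I * (s : ℂ) * E) (Complex.I * E) s := by
        simpa using ((Complex.ofRealCLM.hasDerivAt (x := s)).const_mul Complex.I).mul_const (E : ℂ)
      exact h4.cexp
    have h5 := h3.smul h2
    convert h5 using 1
    · rfl
    · rw [map_smul]
      module
  have h6 := is_const_of_deriv_eq_zero (fun s => (h1 s).differentiableAt)
    (fun s => (h1 s).deriv) t 0
  simp only [Complex.ofReal_zero, mul_zero, zero_mul, Complex.exp_zero, one_smul,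
    hU.apply_zero] at h6
  conv_rhs => rw [← h6]
  rw [smul_smul, ← Complex.exp_add, neg_add_cancel, Complex.exp_zero, one_smul]

end IsUnitaryGroupOf

/-! ### Tensoring with and contracting against a one-boson function -/

section OneBoson

variable {n : ℕ}

/-- The measurable equivalence `(x, k) ↦ (k, x)` that adds a boson in front. -/
def consEquiv (n : ℕ) : (Fin n → R3) × R3 ≃ᵐ (Fin (n + 1) → R3) :=
  MeasurableEquiv.prodComm.trans (MeasurableEquiv.piFinSuccAbove (fun _ : Fin (n + 1) => R3) 0).symm

theorem consEquiv_apply (p : (Fin n → R3) × R3) : consEquiv n p = addBoson p.2 p.1 := by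
  simp only [consEquiv, MeasurableEquiv.trans_apply, MeasurableEquiv.piFinSuccAbove_symm_apply,
    Fin.insertNthEquiv, Equiv.coe_fn_mk, Fin.insertNth_zero]
  rfl

theorem coe_consEquiv : ⇑(consEquiv n) = fun p => addBoson p.2 p.1 := funext consEquiv_apply

theorem measurePreserving_consEquiv :
    MeasurePreserving (consEquiv n) (volume.prod volume) volume := by
  rw [coe_consEquiv]; exact measurePreserving_addBoson n

theorem consEquiv_symm_apply (y : Fin (n + 1) → R3) : (consEquiv n).symm y = (Fin.tail y, y 0) := by
  rw [MeasurableEquiv.symm_apply_eq, consEquiv_apply]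
  exact (Fin.cons_self_tail y).symm

theorem integrable_addBoson_iff {E : Type*} [NormedAddCommGroup E] {F : (Fin (n + 1) → R3) → E} :
    Integrable (fun p : (Fin n → R3) × R3 => F (addBoson p.2 p.1)) (volume.prod volume) ↔
      Integrable F := by
  rw [← measurePreserving_consEquiv.integrable_comp_emb (consEquiv n).measurableEmbedding,
    coe_consEquiv]
  rfl

theorem integral_addBoson {E : Type*} [NormedAddCommGroup E] [NormedSpace ℝ E]
    {F : (Fin (n + 1) → R3) → E} (hF : Integrable F) :
    ∫ y, F y = ∫ x : Fin n → R3, ∫ k : R3, F (addBoson k x) := by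
  rw [← measurePreserving_consEquiv.integral_comp (consEquiv n).measurableEmbedding, coe_consEquiv,
    integral_prod _ (integrable_addBoson_iff.2 hF)]

theorem ae_of_ae_prod {p : (Fin (n + 1) → R3) → Prop}
    (h : ∀ᵐ q : (Fin n → R3) × R3 ∂(volume.prod volume), p (addBoson q.2 q.1)) : ∀ᵐ y, p y := by
  have := measurePreserving_consEquiv.symm (consEquiv n) |>.quasiMeasurePreserving.ae h
  filter_upwards [this] with y hy
  rw [consEquiv_symm_apply] at hy
  simpa [addBoson] using hy

theorem ae_tail {p : (Fin n → R3) → Prop} (h : ∀ᵐ x, p x) :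
    ∀ᵐ y : Fin (n + 1) → R3, p (Fin.tail y) :=
  ae_of_ae_prod (by simpa [addBoson] using Measure.quasiMeasurePreserving_fst.ae h)

theorem ae_head {p : R3 → Prop} (h : ∀ᵐ k, p k) : ∀ᵐ y : Fin (n + 1) → R3, p (y 0) :=
  ae_of_ae_prod (by simpa [addBoson] using Measure.quasiMeasurePreserving_snd.ae h)

theorem memLp_tensor {u : R3 → ℂ} {v : (Fin n → R3) → ℂ} (hu : MemLp u 2) (hv : MemLp v 2) :
    MemLp (fun y : Fin (n + 1) → R3 => u (y 0) * v (Fin.tail y)) 2 := by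
  have h1 : AEStronglyMeasurable (fun y : Fin (n + 1) → R3 => u (y 0) * v (Fin.tail y)) := by
    have hm : AEStronglyMeasurable (fun p : (Fin n → R3) × R3 => u p.2 * v p.1)
      (volume.prod volume) := hu.1.comp_snd.mul hv.1.comp_fst
    have := hm.comp_quasiMeasurePreserving
      (measurePreserving_consEquiv.symm (consEquiv n)).quasiMeasurePreserving
    refine this.congr (Eventually.of_forall fun y => ?_)
    simp [consEquiv_symm_apply]
  rw [memLp_two_iff_integrable_sq_norm h1, ← integrable_addBoson_iff]
  have hu' := (memLp_two_iff_integrable_sq_norm hu.1).1 hu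
  have hv' := (memLp_two_iff_integrable_sq_norm hv.1).1 hv
  refine (hv'.mul_prod hu').congr (Eventually.of_forall fun p => ?_)
  simp [addBoson, mul_pow, mul_comm]

/-- The square integrable functions of one momentum. -/
abbrev L2R3 : Type := Lp ℂ 2 (volume : Measure R3)

/-- `h ⊗ ψ`, that is `(k₀, …, kₙ) ↦ h(k₀) ψ(k₁, …, kₙ)`. -/
def tens (h : L2R3) (ψ : L2n n) : L2n (n + 1) := (memLp_tensor (Lp.memLp h) (Lp.memLp ψ)).toLp _

theorem coe_tens (h : L2R3) (ψ : L2n n) : tens h ψ =ᵐ[volume] fun y => h (y 0) * ψ (Fin.tail y) :=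
  MemLp.coeFn_toLp _

theorem inner_tens (h f : L2R3) (φ ψ : L2n n) :
    inner ℂ (tens h φ) (tens f ψ) = inner ℂ h f * inner ℂ φ ψ := by
  rw [L2.inner_def, integral_addBoson (L2.integrable_inner _ _), L2.inner_def, L2.inner_def,
    mul_comm, ← integral_mul_const]
  refine integral_congr_ae ?_
  filter_upwards [ae_addBoson (coe_tens h φ), ae_addBoson (coe_tens f ψ)] with x h1 h2
  rw [← integral_const_mul]
  refine integral_congr_ae ?_
  filter_upwards [h1, h2] with k h3 h4
  rw [h3, h4]
  simp [addBoson]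
  ring

theorem norm_tens (h : L2R3) (ψ : L2n n) : ‖tens h ψ‖ = ‖h‖ * ‖ψ‖ := by
  have h1 := inner_tens h h ψ ψ
  rw [inner_self_eq_norm_sq_to_K, inner_self_eq_norm_sq_to_K, inner_self_eq_norm_sq_to_K] at h1
  have h2 : ‖tens h ψ‖ ^ 2 = (‖h‖ * ‖ψ‖) ^ 2 := by
    rw [mul_pow]; exact_mod_cast h1
  exact (sq_eq_sq₀ (norm_nonneg _) (by positivity)).1 h2

/-- `ψ ↦ h ⊗ ψ` as a bounded operator. -/
def tensL (h : L2R3) : L2n n →L[ℂ] L2n (n + 1) :=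
  LinearMap.mkContinuous
    { toFun := tens h
      map_add' := fun φ ψ => by
        refine Lp.ext ?_
        filter_upwards [coe_tens h (φ + ψ), coe_tens h φ, coe_tens h ψ,
          Lp.coeFn_add (tens h φ) (tens h ψ), ae_tail (Lp.coeFn_add φ ψ)] with y h1 h2 h3 h4 h5
        rw [h1, h4, Pi.add_apply, h2, h3, h5, Pi.add_apply, mul_add]
      map_smul' := fun c ψ => by
        refine Lp.ext ?_
        filter_upwards [coe_tens h (c • ψ), coe_tens h ψ, Lp.coeFn_smul c (tens h ψ),
          ae_tail (Lp.coeFn_smul c ψ)] with y h1 h2 h3 h4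
        rw [h1, RingHom.id_apply, h3, Pi.smul_apply, h2, h4, Pi.smul_apply, smul_eq_mul,
          smul_eq_mul]
        ring } ‖h‖ fun ψ => (norm_tens h ψ).le

/-- Contraction of the first momentum against `h`: the adjoint of `ψ ↦ h ⊗ ψ`. -/
def contr (h : L2R3) : L2n (n + 1) →L[ℂ] L2n n := ContinuousLinearMap.adjoint (tensL h)

theorem inner_contr_right (h : L2R3) (φ : L2n n) (ψ : L2n (n + 1)) :
    inner ℂ φ (contr h ψ) = inner ℂ (tens h φ) ψ :=
  ContinuousLinearMap.adjoint_inner_right _ _ _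

theorem inner_contr_left (h : L2R3) (φ : L2n n) (ψ : L2n (n + 1)) :
    inner ℂ (contr h ψ) φ = inner ℂ ψ (tens h φ) :=
  ContinuousLinearMap.adjoint_inner_left _ _ _

theorem norm_contr_le (h : L2R3) (ψ : L2n (n + 1)) : ‖contr h ψ‖ ≤ ‖h‖ * ‖ψ‖ := by
  refine (ContinuousLinearMap.le_opNorm _ _).trans ?_
  rw [contr, LinearIsometryEquiv.norm_map]
  exact mul_le_mul_of_nonneg_right (LinearMap.mkContinuous_norm_le _ (norm_nonneg _) _)
    (norm_nonneg _)

theorem inner_tens_left (h : L2R3) (φ : L2n n) (ψ : L2n (n + 1)) :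
    Integrable (fun p : (Fin n → R3) × R3 => conj (φ p.1) * (conj (h p.2) * ψ (addBoson p.2 p.1)))
      (volume.prod volume) ∧
    inner ℂ (tens h φ) ψ =
      ∫ x : Fin n → R3, conj (φ x) * ∫ k : R3, conj (h k) * ψ (addBoson k x) := by
  have h1 := L2.integrable_inner (𝕜 := ℂ) (tens h φ) ψ
  constructor
  · rw [← integrable_addBoson_iff] at h1
    refine h1.congr ?_
    filter_upwards [(measurePreserving_addBoson n).quasiMeasurePreserving.ae (coe_tens h φ)]
      with p hp
    rw [hp]
    simp [addBoson]
    ring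
  · rw [L2.inner_def, integral_addBoson h1]
    refine integral_congr_ae ?_
    filter_upwards [ae_addBoson (coe_tens h φ)] with x h1
    rw [← integral_const_mul]
    refine integral_congr_ae ?_
    filter_upwards [h1] with k h3
    rw [h3]
    simp [addBoson]
    ring

theorem memLp_slice (ψ : L2n (n + 1)) :
    ∀ᵐ x : Fin n → R3, MemLp (fun k : R3 => ψ (addBoson k x)) 2 := by
  have hm : AEStronglyMeasurable (fun p : (Fin n → R3) × R3 => ψ (addBoson p.2 p.1))
      (volume.prod volume) :=
    (Lp.aestronglyMeasurable ψ).comp_quasiMeasurePreserving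
      (measurePreserving_addBoson n).quasiMeasurePreserving
  have hi : Integrable (fun p : (Fin n → R3) × R3 => ‖ψ (addBoson p.2 p.1)‖ ^ 2)
      (volume.prod volume) :=
    (integrable_addBoson_iff (F := fun y => ‖ψ y‖ ^ 2)).2
      ((memLp_two_iff_integrable_sq_norm (Lp.aestronglyMeasurable ψ)).1 (Lp.memLp ψ))
  filter_upwards [hm.prodMk_left, hi.prod_right_ae] with x h1 h2
  exact (memLp_two_iff_integrable_sq_norm h1).2 h2

theorem integrable_contr (h : L2R3) (ψ : L2n (n + 1)) :
    ∀ᵐ x : Fin n → R3, Integrable fun k : R3 => conj (h k) * ψ (addBoson k x) := by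
  filter_upwards [memLp_slice ψ] with x hx
  exact (Lp.memLp h).star.integrable_mul hx

theorem coe_contr (h : L2R3) (ψ : L2n (n + 1)) :
    contr h ψ =ᵐ[volume] fun x => ∫ k : R3, conj (h k) * ψ (addBoson k x) := by
  have hfin : ∀ s : Set (Fin n → R3), MeasurableSet s → volume s < ⊤ →
      IntegrableOn (contr h ψ) s := fun s hs hμ =>
    integrableOn_Lp_of_measure_ne_top _ (by norm_num) hμ.ne
  have hind : ∀ (s : Set (Fin n → R3)) (hs : MeasurableSet s) (hμ : volume s ≠ ⊤),
      ∀ᵐ x, conj (indicatorConstLp 2 hs hμ (1 : ℂ) x) *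
        (∫ k : R3, conj (h k) * ψ (addBoson k x)) =
        s.indicator (fun x => ∫ k : R3, conj (h k) * ψ (addBoson k x)) x := fun s hs hμ => by
    filter_upwards [indicatorConstLp_coeFn (p := 2) (hs := hs) (hμs := hμ) (c := (1 : ℂ))]
      with x hx
    rw [hx]
    by_cases hxs : x ∈ s <;> simp [hxs]
  refine ae_eq_of_forall_setIntegral_eq_of_sigmaFinite hfin ?_ ?_
  · intro s hs hμ
    have h1 := (inner_tens_left h (indicatorConstLp 2 hs hμ.ne (1 : ℂ)) ψ).1.integral_prod_left
    simp only [integral_const_mul] at h1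
    rw [← integrable_indicator_iff hs]
    exact h1.congr (hind s hs hμ.ne)
  · intro s hs hμ
    have h1 := inner_contr_right h (indicatorConstLp 2 hs hμ.ne (1 : ℂ)) ψ
    rw [L2.inner_indicatorConstLp_one, (inner_tens_left _ _ _).2] at h1
    rw [h1, ← integral_indicator hs]
    exact integral_congr_ae (hind s hs hμ.ne)

theorem tens_add (h f : L2R3) (φ : L2n n) : tens (h + f) φ = tens h φ + tens f φ := by
  refine Lp.ext ?_
  filter_upwards [coe_tens (h + f) φ, coe_tens h φ, coe_tens f φ,
    Lp.coeFn_add (tens h φ) (tens f φ), ae_head (Lp.coeFn_add h f)] with y h1 h2 h3 h4 h5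
  rw [h1, h4, Pi.add_apply, h2, h3, h5, Pi.add_apply, add_mul]

theorem tens_smul (c : ℂ) (h : L2R3) (φ : L2n n) : tens (c • h) φ = c • tens h φ := by
  refine Lp.ext ?_
  filter_upwards [coe_tens (c • h) φ, coe_tens h φ, Lp.coeFn_smul c (tens h φ),
    ae_head (Lp.coeFn_smul c h)] with y h1 h2 h3 h4
  rw [h1, h3, Pi.smul_apply, h2, h4, Pi.smul_apply, smul_eq_mul, smul_eq_mul, mul_assoc]

theorem contr_add (h f : L2R3) (ψ : L2n (n + 1)) : contr (h + f) ψ = contr h ψ + contr f ψ := by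
  refine ext_inner_left ℂ fun φ => ?_
  rw [inner_add_right, inner_contr_right, inner_contr_right, inner_contr_right, ← inner_add_left,
    tens_add]

theorem contr_smul (c : ℂ) (h : L2R3) (ψ : L2n (n + 1)) : contr (c • h) ψ = conj c • contr h ψ := by
  refine ext_inner_left ℂ fun φ => ?_
  rw [inner_smul_right, inner_contr_right, inner_contr_right, ← inner_smul_left, tens_smul]

end OneBoson

/-! ### Permutations of the bosons -/

section Permutations

variable {n : ℕ}

/-- The action of a permutation of the bosons on wave functions. -/
def permL (σ : Equiv.Perm (Fin n)) : L2n n →ₗᵢ[ℂ] L2n n :=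
  Lp.compMeasurePreservingₗᵢ ℂ _ (measurePreserving_perm n σ)

theorem coe_permL (σ : Equiv.Perm (Fin n)) (ψ : L2n n) :
    permL σ ψ =ᵐ[volume] fun x => ψ (x ∘ σ) :=
  Lp.coeFn_compMeasurePreserving ψ (measurePreserving_perm n σ)

theorem ae_perm (σ : Equiv.Perm (Fin n)) {p : (Fin n → R3) → Prop} (h : ∀ᵐ x, p x) :
    ∀ᵐ x : Fin n → R3, p (x ∘ σ) :=
  (measurePreserving_perm n σ).quasiMeasurePreserving.ae h

theorem mem_symL2_iff {ψ : L2n n} : ψ ∈ symL2 n ↔ ∀ σ, permL σ ψ = ψ := by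
  refine forall_congr' fun σ => ⟨fun h => Lp.ext ((coe_permL σ ψ).trans h), fun h => ?_⟩
  have := coe_permL σ ψ
  rw [h] at this
  exact this.symm

theorem permL_mul (σ τ : Equiv.Perm (Fin n)) (ψ : L2n n) :
    permL (σ * τ) ψ = permL σ (permL τ ψ) := by
  refine Lp.ext ?_
  filter_upwards [coe_permL (σ * τ) ψ, coe_permL σ (permL τ ψ), ae_perm σ (coe_permL τ ψ)]
    with x h1 h2 h3
  rw [h1, h2, h3]
  rfl

theorem permL_one (ψ : L2n n) : permL 1 ψ = ψ := by
  refine Lp.ext ?_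
  filter_upwards [coe_permL 1 ψ] with x h1
  rw [h1]
  rfl

theorem inner_permL_left (σ : Equiv.Perm (Fin n)) (φ ψ : L2n n) :
    inner ℂ (permL σ φ) ψ = inner ℂ φ (permL σ⁻¹ ψ) := by
  rw [← (permL σ).inner_map_map φ, ← permL_mul, mul_inv_cancel, permL_one]

/-- The permutation of `{0, …, n}` that fixes `0` and acts by `e` on the rest. -/
def extPerm (e : Equiv.Perm (Fin n)) : Equiv.Perm (Fin (n + 1)) :=
  Equiv.Perm.decomposeFin.symm (0, e)

theorem extPerm_zero (e : Equiv.Perm (Fin n)) : extPerm e 0 = 0 := by simp [extPerm]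

theorem extPerm_succ (e : Equiv.Perm (Fin n)) (i : Fin n) : extPerm e i.succ = (e i).succ := by
  simp [extPerm]

theorem extPerm_inv (e : Equiv.Perm (Fin n)) : (extPerm e)⁻¹ = extPerm e⁻¹ := by
  rw [inv_eq_iff_mul_eq_one]
  ext i
  refine Fin.cases ?_ (fun i => ?_) i <;> simp [extPerm_zero, extPerm_succ]

theorem decomposeFin_symm_eq (p : Fin (n + 1)) (e : Equiv.Perm (Fin n)) :
    Equiv.Perm.decomposeFin.symm (p, e) = Equiv.swap 0 p * extPerm e := by
  ext i
  refine Fin.cases ?_ (fun i => ?_) i <;> simp [extPerm_zero, extPerm_succ]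

theorem permL_extPerm_tens (e : Equiv.Perm (Fin n)) (h : L2R3) (ψ : L2n n) :
    permL (extPerm e) (tens h ψ) = tens h (permL e ψ) := by
  refine Lp.ext ?_
  filter_upwards [coe_permL (extPerm e) (tens h ψ), ae_perm (extPerm e) (coe_tens h ψ),
    coe_tens h (permL e ψ), ae_tail (coe_permL e ψ)] with y h1 h2 h3 h4
  rw [h1, h2, h3, h4]
  simp only [Function.comp_apply, extPerm_zero]
  congr 2

theorem permL_contr (e : Equiv.Perm (Fin n)) (h : L2R3) (ψ : L2n (n + 1)) :
    permL e (contr h ψ) = contr h (permL (extPerm e) ψ) := by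
  refine ext_inner_left ℂ fun φ => ?_
  have h1 := inner_permL_left e⁻¹ φ (contr h ψ)
  rw [inv_inv] at h1
  have h2 := inner_permL_left (extPerm e⁻¹) (tens h φ) ψ
  rw [extPerm_inv, inv_inv] at h2
  rw [← h1, inner_contr_right, inner_contr_right, ← permL_extPerm_tens, h2]

theorem permL_swap_tens_tens (h f : L2R3) (φ : L2n n) :
    permL (Equiv.swap 0 1) (tens h (tens f φ)) = tens f (tens h φ) := by
  refine Lp.ext ?_
  filter_upwards [coe_permL (Equiv.swap 0 1) (tens h (tens f φ)),
    ae_perm (Equiv.swap 0 1) (coe_tens h (tens f φ)),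
    ae_perm (Equiv.swap 0 1) (ae_tail (coe_tens f φ)), coe_tens f (tens h φ),
    ae_tail (coe_tens h φ)] with y h1 h2 h3 h4 h5
  rw [h1, h2, h3, h4, h5]
  have e1 : Fin.tail (Fin.tail (y ∘ Equiv.swap (0 : Fin (n + 2)) 1)) = Fin.tail (Fin.tail y) := by
    ext1 i
    simp only [Fin.tail, Function.comp_apply]
    rw [Equiv.swap_apply_of_ne_of_ne]
    · exact Fin.succ_ne_zero _
    · exact fun h => Fin.succ_ne_zero _ (Fin.succ_injective _ h)
  have e2 : (Fin.tail (y ∘ Equiv.swap (0 : Fin (n + 2)) 1)) 0 = y 0 := by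
    simp [Fin.tail]
  have e3 : (Fin.tail y) 0 = y 1 := by simp [Fin.tail]
  rw [e1, e2, e3]
  simp only [Function.comp_apply, Equiv.swap_apply_left]
  ring

/-- `(k, p, x) ↦ h(p) φ(k, x)` contracted in its first variable. -/
theorem contr_permL_swap_tens (h f : L2R3) (φ : L2n (n + 1)) :
    contr f (permL (Equiv.swap 0 1) (tens h φ)) = tens h (contr f φ) := by
  refine Lp.ext ?_
  filter_upwards [coe_contr f (permL (Equiv.swap 0 1) (tens h φ)), coe_tens h (contr f φ),
    ae_tail (coe_contr f φ), ae_addBoson (coe_permL (Equiv.swap 0 1) (tens h φ)),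
    ae_addBoson (ae_perm (Equiv.swap 0 1) (coe_tens h φ))] with y h1 h2 h3 h4 h5
  rw [h1, h2, h3, ← integral_const_mul]
  refine integral_congr_ae ?_
  filter_upwards [h4, h5] with k h6 h7
  rw [h6, h7]
  have e1 : Fin.tail (addBoson k y ∘ Equiv.swap (0 : Fin (n + 2)) 1) = addBoson k (Fin.tail y) := by
    ext1 i
    refine Fin.cases ?_ (fun i => ?_) i
    · simp [Fin.tail, addBoson]
    · simp only [Fin.tail, Function.comp_apply]
      rw [Equiv.swap_apply_of_ne_of_ne]
      · simp [addBoson, Fin.tail]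
      · exact Fin.succ_ne_zero _
      · exact fun h => Fin.succ_ne_zero _ (Fin.succ_injective _ h)
  rw [e1]
  have e2 : (addBoson k y ∘ Equiv.swap (0 : Fin (n + 2)) 1) 0 = y 0 := by
    simp only [Function.comp_apply, Equiv.swap_apply_left, addBoson]
    rw [← Fin.succ_zero_eq_one, Fin.cons_succ]
  rw [e2]
  ring

end Permutations

/-! ### Annihilation and creation between the `n`-boson spaces -/

section NBoson

variable {n : ℕ}

theorem contr_mem_symL2 (h : L2R3) {ψ : L2n (n + 1)} (hψ : ψ ∈ symL2 (n + 1)) :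
    contr h ψ ∈ symL2 n := by
  rw [mem_symL2_iff] at hψ ⊢
  intro σ
  rw [permL_contr, hψ]

/-- The annihilation operator from `n + 1` to `n` bosons. -/
def annN (h : L2R3) : symL2 (n + 1) →L[ℂ] symL2 n :=
  (√(n + 1 : ℝ) : ℂ) • ((contr h).comp (symL2 (n + 1)).subtypeL).codRestrict (symL2 n)
    fun ψ => contr_mem_symL2 h ψ.2

theorem coe_annN (h : L2R3) (ψ : symL2 (n + 1)) :
    (annN h ψ : L2n n) = (√(n + 1 : ℝ) : ℂ) • contr h (ψ : L2n (n + 1)) := rfl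

/-- The creation operator from `n` to `n + 1` bosons, the adjoint of `annN`. -/
def creN (h : L2R3) : symL2 n →L[ℂ] symL2 (n + 1) := ContinuousLinearMap.adjoint (annN h)

theorem inner_creN_left (h : L2R3) (φ : symL2 n) (ψ : symL2 (n + 1)) :
    inner ℂ (creN h φ) ψ = inner ℂ φ (annN h ψ) :=
  ContinuousLinearMap.adjoint_inner_left _ _ _

theorem sqrt_natCast_mul_self (n : ℕ) : (√(n + 1 : ℝ) : ℂ) * (√(n + 1 : ℝ) : ℂ) = n + 1 := by
  rw [← Complex.ofReal_mul, Real.mul_self_sqrt (by positivity)]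
  push_cast
  rfl

theorem sqrt_natCast_ne_zero (n : ℕ) : (√(n + 1 : ℝ) : ℂ) ≠ 0 := by
  rw [Complex.ofReal_ne_zero]
  positivity

theorem permL_tens_of_mem (e : Equiv.Perm (Fin n)) (h : L2R3) {ψ : L2n n} (hψ : ψ ∈ symL2 n) :
    permL (extPerm e) (tens h ψ) = tens h ψ := by
  rw [permL_extPerm_tens, mem_symL2_iff.1 hψ]

/-- Summing `h ⊗ ψ` over the transpositions `(0 p)` gives a symmetric function. -/
theorem sum_swap_mem_symL2 (h : L2R3) {ψ : L2n n} (hψ : ψ ∈ symL2 n) :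
    ∑ p : Fin (n + 1), permL (Equiv.swap 0 p) (tens h ψ) ∈ symL2 (n + 1) := by
  have h1 : ∑ σ : Equiv.Perm (Fin (n + 1)), permL σ (tens h ψ) =
      (Fintype.card (Equiv.Perm (Fin n)) : ℂ) •
        ∑ p : Fin (n + 1), permL (Equiv.swap 0 p) (tens h ψ) := by
    rw [← Equiv.sum_comp Equiv.Perm.decomposeFin.symm, Fintype.sum_prod_type, Finset.smul_sum]
    refine Finset.sum_congr rfl fun p _ => ?_
    simp only [decomposeFin_symm_eq, permL_mul, permL_tens_of_mem _ h hψ]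
    rw [Finset.sum_const, Finset.card_univ, Nat.cast_smul_eq_nsmul]
  have h2 : ∑ σ : Equiv.Perm (Fin (n + 1)), permL σ (tens h ψ) ∈ symL2 (n + 1) := by
    rw [mem_symL2_iff]
    intro τ
    rw [map_sum]
    simp only [← permL_mul]
    exact Equiv.sum_comp (Equiv.mulLeft τ) fun σ => permL σ (tens h ψ)
  rw [h1] at h2
  have h3 := (symL2 (n + 1)).smul_mem ((Fintype.card (Equiv.Perm (Fin n)) : ℂ)⁻¹) h2
  rwa [inv_smul_smul₀] at h3
  exact Nat.cast_ne_zero.2 Fintype.card_ne_zero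

theorem coe_creN (h : L2R3) (φ : symL2 n) : (creN h φ : L2n (n + 1)) =
    (√(n + 1 : ℝ) : ℂ)⁻¹ • ∑ p : Fin (n + 1), permL (Equiv.swap 0 p) (tens h (φ : L2n n)) := by
  set w : symL2 (n + 1) := ⟨(√(n + 1 : ℝ) : ℂ)⁻¹ • ∑ p : Fin (n + 1),
    permL (Equiv.swap 0 p) (tens h (φ : L2n n)),
    (symL2 (n + 1)).smul_mem _ (sum_swap_mem_symL2 h φ.2)⟩ with hw
  suffices creN h φ = w by rw [this]
  refine ext_inner_right ℂ fun ψ => ?_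
  rw [inner_creN_left, Submodule.coe_inner, Submodule.coe_inner, coe_annN, hw, inner_smul_right,
    inner_smul_left, inner_contr_right, sum_inner]
  have h1 : ∀ p : Fin (n + 1), inner ℂ (permL (Equiv.swap 0 p) (tens h (φ : L2n n)))
      (ψ : L2n (n + 1)) = inner ℂ (tens h (φ : L2n n)) (ψ : L2n (n + 1)) := fun p => by
    rw [inner_permL_left, mem_symL2_iff.1 ψ.2]
  simp only [h1]
  rw [Finset.sum_const, Finset.card_univ, Fintype.card_fin, nsmul_eq_mul, map_inv₀,
    Complex.conj_ofReal]
  have h2 := sqrt_natCast_mul_self n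
  have h3 := sqrt_natCast_ne_zero n
  field_simp
  rw [pow_two, h2]
  push_cast
  ring

/-- The creation operator is `(n+1)^{-1/2}` times the sum of `h ⊗ φ` over the transpositions
`(0 p)`; against the symmetric left factor one of the two sums collapses. -/
theorem inner_creN_creN_eq_sum (h f : L2R3) (φ ψ : symL2 n) :
    inner ℂ (creN h φ) (creN f ψ) = ∑ p : Fin (n + 1),
      inner ℂ (tens h (φ : L2n n)) (permL (Equiv.swap 0 p) (tens f (ψ : L2n n))) := by
  rw [inner_creN_left, Submodule.coe_inner, coe_annN, inner_smul_right, inner_contr_right,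
    coe_creN, inner_smul_right, inner_sum, mul_inv_cancel_left₀ (sqrt_natCast_ne_zero n)]

theorem inner_creN_creN_zero (h f : L2R3) (φ ψ : symL2 0) :
    inner ℂ (creN h φ) (creN f ψ) = inner ℂ h f * inner ℂ φ ψ := by
  rw [inner_creN_creN_eq_sum]
  simp only [Nat.reduceAdd, Finset.univ_unique, Fin.default_eq_zero, Fin.isValue,
    Equiv.swap_self, Finset.sum_singleton]
  rw [← Equiv.Perm.one_def, permL_one, inner_tens]
  rfl

/-- The canonical commutation relations, in the form
`⟨a*(h)φ, a*(f)ψ⟩ = ⟨a(f)φ, a(h)ψ⟩ + ⟨h,f⟩⟨φ,ψ⟩`. -/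
theorem inner_creN_creN_succ (h f : L2R3) (φ ψ : symL2 (n + 1)) :
    inner ℂ (creN h φ) (creN f ψ) =
      inner ℂ (annN f φ) (annN h ψ) + inner ℂ h f * inner ℂ φ ψ := by
  rw [inner_creN_creN_eq_sum, Fin.sum_univ_succ, Equiv.swap_self, ← Equiv.Perm.one_def, permL_one,
    inner_tens, add_comm]
  congr 1
  -- every transposition `(0 p)`, `p ≠ 0`, is conjugate to `(0 1)` by a permutation that fixes `0`
  have h1 : ∀ j : Fin (n + 1), inner ℂ (tens h (φ : L2n (n + 1)))
      (permL (Equiv.swap 0 j.succ) (tens f (ψ : L2n (n + 1)))) =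
      inner ℂ (contr f (φ : L2n (n + 1))) (contr h (ψ : L2n (n + 1))) := fun j => by
    have e1 : Equiv.swap (0 : Fin (n + 2)) j.succ =
        extPerm (Equiv.swap 0 j) * (Equiv.swap 0 1 * (extPerm (Equiv.swap 0 j))⁻¹) := by
      have := Equiv.swap_apply_apply (extPerm (Equiv.swap 0 j)) (0 : Fin (n + 2)) 1
      rw [extPerm_zero, ← Fin.succ_zero_eq_one, extPerm_succ, Equiv.swap_apply_left] at this
      rw [this, ← Fin.succ_zero_eq_one, mul_assoc]
    rw [e1, permL_mul, permL_mul, extPerm_inv, permL_tens_of_mem _ f ψ.2]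
    have h2 := inner_permL_left (extPerm (Equiv.swap 0 j))⁻¹ (tens h (φ : L2n (n + 1)))
      (permL (Equiv.swap 0 1) (tens f (ψ : L2n (n + 1))))
    rw [inv_inv, extPerm_inv, permL_tens_of_mem _ h φ.2] at h2
    rw [← h2]
    have h3 := inner_permL_left (Equiv.swap 0 1) (tens h (φ : L2n (n + 1)))
      (tens f (ψ : L2n (n + 1)))
    rw [Equiv.swap_inv] at h3
    rw [← h3, ← inner_contr_left, contr_permL_swap_tens, ← inner_contr_right]
  simp only [h1]
  rw [Finset.sum_const, Finset.card_univ, Fintype.card_fin, nsmul_eq_mul, Submodule.coe_inner,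
    coe_annN, coe_annN, inner_smul_left, inner_smul_right, ← mul_assoc, Complex.conj_ofReal,
    sqrt_natCast_mul_self]
  push_cast
  ring

theorem annN_comm (h f : L2R3) (ψ : symL2 (n + 2)) :
    annN f (annN h ψ) = annN h (annN f ψ) := by
  have key : contr f (contr h (ψ : L2n (n + 2))) = contr h (contr f (ψ : L2n (n + 2))) := by
    refine ext_inner_left ℂ fun φ => ?_
    simp only [inner_contr_right]
    rw [← permL_swap_tens_tens, inner_permL_left, mem_symL2_iff.1 ψ.2]
  apply Subtype.ext
  simp only [coe_annN, map_smul, key]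

theorem annN_add (h f : L2R3) (ψ : symL2 (n + 1)) : annN (h + f) ψ = annN h ψ + annN f ψ := by
  apply Subtype.ext
  simp only [coe_annN, contr_add, smul_add, Submodule.coe_add]

theorem annN_smul (c : ℂ) (h : L2R3) (ψ : symL2 (n + 1)) : annN (c • h) ψ = conj c • annN h ψ := by
  apply Subtype.ext
  simp only [coe_annN, contr_smul, Submodule.coe_smul]
  rw [smul_comm]

theorem creN_add (h f : L2R3) (ψ : symL2 n) : creN (h + f) ψ = creN h ψ + creN f ψ := by
  refine ext_inner_right ℂ fun φ => ?_
  rw [inner_add_left, inner_creN_left, inner_creN_left, inner_creN_left, annN_add, inner_add_right]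

theorem creN_smul (c : ℂ) (h : L2R3) (ψ : symL2 n) : creN (c • h) ψ = c • creN h ψ := by
  apply Subtype.ext
  rw [Submodule.coe_smul, coe_creN, coe_creN]
  simp only [tens_smul, map_smul]
  rw [← Finset.smul_sum, smul_comm]

theorem coe_annN_ae (h : L2R3) (ψ : symL2 (n + 1)) : (annN h ψ : L2n n) =ᵐ[volume] fun x =>
    (√(n + 1 : ℝ) : ℂ) * ∫ k : R3, conj (h k) * (ψ : L2n (n + 1)) (addBoson k x) := by
  rw [coe_annN]
  filter_upwards [Lp.coeFn_smul (√(n + 1 : ℝ) : ℂ) (contr h (ψ : L2n (n + 1))),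
    coe_contr h (ψ : L2n (n + 1))] with x h1 h2
  rw [h1, Pi.smul_apply, h2, smul_eq_mul]

theorem ae_ne_zero : ∀ᵐ k : R3, k ≠ 0 := by
  rw [ae_iff]; simp

/-- For symmetric `ψ`, the energy of the first boson is the mean energy per boson. -/
theorem sum_norm_weight {ψ : symL2 (n + 1)} {ρ : L2n (n + 1)}
    (hρ : ρ =ᵐ[volume] fun y => ((√(∑ i, ‖y i‖) : ℝ) : ℂ) * (ψ : L2n (n + 1)) y) :
    ∃ χ : L2n (n + 1), (χ =ᵐ[volume] fun y => ((√‖y 0‖ : ℝ) : ℂ) * (ψ : L2n (n + 1)) y) ∧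
      (n + 1) * ‖χ‖ ^ 2 = ‖ρ‖ ^ 2 := by
  set u : (Fin (n + 1) → R3) → ℂ := ⇑(ψ : L2n (n + 1)) with hu
  have hum : AEStronglyMeasurable u := Lp.aestronglyMeasurable _
  have hρi : Integrable fun y => (∑ i, ‖y i‖) * ‖u y‖ ^ 2 := by
    refine ((memLp_two_iff_integrable_sq_norm (Lp.aestronglyMeasurable ρ)).1 (Lp.memLp ρ)).congr ?_
    filter_upwards [hρ] with y hy
    rw [hy, norm_mul, mul_pow, Complex.norm_real, Real.norm_of_nonneg (Real.sqrt_nonneg _),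
      Real.sq_sqrt (Finset.sum_nonneg fun i _ => norm_nonneg _)]
  have hi : ∀ i, Integrable fun y : Fin (n + 1) → R3 => ‖y i‖ * ‖u y‖ ^ 2 := fun i => by
    refine hρi.mono ?_ (Eventually.of_forall fun y => ?_)
    · exact ((by fun_prop : Continuous fun y : Fin (n + 1) → R3 =>
        ‖y i‖).aestronglyMeasurable).mul (hum.norm.pow 2)
    · rw [Real.norm_of_nonneg (by positivity), Real.norm_of_nonneg (by positivity)]
      gcongr
      exact Finset.single_le_sum (f := fun i => ‖y i‖) (fun i _ => norm_nonneg _)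
        (Finset.mem_univ i)
  -- exchanging the bosons `0` and `i` leaves `|ψ|` invariant
  have heq : ∀ i, ∫ y : Fin (n + 1) → R3, ‖y i‖ * ‖u y‖ ^ 2 =
      ∫ y : Fin (n + 1) → R3, ‖y 0‖ * ‖u y‖ ^ 2 := fun i => by
    have hmp := measurePreserving_perm (n + 1) (Equiv.swap 0 i)
    have h1 := integral_map (f := fun y : Fin (n + 1) → R3 => ‖y i‖ * ‖u y‖ ^ 2)
      hmp.measurable.aemeasurable (by rw [hmp.map_eq]; exact (hi i).1)
    rw [hmp.map_eq] at h1
    rw [h1]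
    refine integral_congr_ae ?_
    filter_upwards [ψ.2 (Equiv.swap 0 i)] with y hy
    rw [← hu] at hy
    simp only [hy, Function.comp_apply, Equiv.swap_apply_right]
  have hχm : MemLp (fun y : Fin (n + 1) → R3 => ((√‖y 0‖ : ℝ) : ℂ) * u y) 2 := by
    have hm : AEStronglyMeasurable fun y : Fin (n + 1) → R3 => ((√‖y 0‖ : ℝ) : ℂ) * u y :=
      ((by fun_prop : Continuous fun y : Fin (n + 1) → R3 =>
        ((√‖y 0‖ : ℝ) : ℂ)).aestronglyMeasurable).mul hum
    rw [memLp_two_iff_integrable_sq_norm hm]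
    refine (hi 0).congr (Eventually.of_forall fun y => ?_)
    simp only
    rw [norm_mul, mul_pow, Complex.norm_real, Real.norm_of_nonneg (Real.sqrt_nonneg _),
      Real.sq_sqrt (norm_nonneg _)]
  refine ⟨hχm.toLp _, hχm.coeFn_toLp, ?_⟩
  have hn : ∀ v : L2n (n + 1), ‖v‖ ^ 2 = ∫ y, ‖v y‖ ^ 2 := fun v => by
    have := inner_self_eq_norm_sq_to_K (𝕜 := ℂ) v
    rw [L2.inner_def] at this
    simp only [inner_self_eq_norm_sq_to_K] at this
    have h2 := integral_ofReal (𝕜 := ℂ) (μ := volume) (f := fun y => ‖v y‖ ^ 2)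
    push_cast at h2
    rw [h2] at this
    exact_mod_cast this.symm
  rw [hn, hn]
  have h1 : ∫ y, ‖hχm.toLp _ y‖ ^ 2 = ∫ y : Fin (n + 1) → R3, ‖y 0‖ * ‖u y‖ ^ 2 := by
    refine integral_congr_ae ?_
    filter_upwards [hχm.coeFn_toLp] with y hy
    rw [hy, norm_mul, mul_pow, Complex.norm_real, Real.norm_of_nonneg (Real.sqrt_nonneg _),
      Real.sq_sqrt (norm_nonneg _)]
  have h2 : ∫ y, ‖ρ y‖ ^ 2 = ∫ y : Fin (n + 1) → R3, ∑ i, ‖y i‖ * ‖u y‖ ^ 2 := by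
    refine integral_congr_ae ?_
    filter_upwards [hρ] with y hy
    rw [hy, norm_mul, mul_pow, Complex.norm_real, Real.norm_of_nonneg (Real.sqrt_nonneg _),
      Real.sq_sqrt (Finset.sum_nonneg fun i _ => norm_nonneg _), Finset.sum_mul]
  rw [h1, h2, integral_finsetSum _ fun i _ => hi i]
  simp only [heq]
  simp

/-- The annihilation operator is controlled by the square root of the energy: here `h'` stands for
`|k|^{-1/2} h` and `ρ` for the square root of the energy applied to `ψ`. -/
theorem norm_annN_le {h h' : L2R3} (hh : h' =ᵐ[volume] fun k => h k / (√‖k‖ : ℝ))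
    {ψ : symL2 (n + 1)} {ρ : L2n (n + 1)}
    (hρ : ρ =ᵐ[volume] fun y => ((√(∑ i, ‖y i‖) : ℝ) : ℂ) * (ψ : L2n (n + 1)) y) :
    ‖annN h ψ‖ ≤ ‖h'‖ * ‖ρ‖ := by
  obtain ⟨χ, hχ, hn⟩ := sum_norm_weight hρ
  -- move the weight `|k|^{1/2}` from `h` to `ψ`
  have h1 : contr h (ψ : L2n (n + 1)) = contr h' χ := by
    refine Lp.ext ?_
    filter_upwards [coe_contr h (ψ : L2n (n + 1)), coe_contr h' χ, ae_addBoson hχ] with x h1 h2 h3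
    rw [h1, h2]
    refine integral_congr_ae ?_
    filter_upwards [h3, hh, ae_ne_zero] with k h4 h5 h6
    rw [h4, h5]
    have : ((√‖k‖ : ℝ) : ℂ) ≠ 0 := by
      rw [Complex.ofReal_ne_zero, Real.sqrt_ne_zero']
      exact norm_pos_iff.2 h6
    simp only [addBoson, Fin.cons_zero, map_div₀, Complex.conj_ofReal]
    field_simp
  have h2 : ‖annN h ψ‖ = √(n + 1 : ℝ) * ‖contr h' χ‖ := by
    change ‖(annN h ψ : L2n n)‖ = _
    rw [← h1, coe_annN, norm_smul, Complex.norm_real,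
      Real.norm_of_nonneg (Real.sqrt_nonneg _)]
  rw [h2]
  have h3 : √(n + 1 : ℝ) * ‖χ‖ = ‖ρ‖ := by
    rw [← sq_eq_sq₀ (by positivity) (norm_nonneg _), mul_pow, Real.sq_sqrt (by positivity), hn]
  calc √(n + 1 : ℝ) * ‖contr h' χ‖ ≤ √(n + 1 : ℝ) * (‖h'‖ * ‖χ‖) := by
        gcongr; exact norm_contr_le _ _
    _ = ‖h'‖ * ‖ρ‖ := by rw [← h3]; ring

end NBoson

/-! ### Functions of the field energy on Fock space -/

section FockBasics

theorem Fock.summable_norm_sq (ψ : Fock) : Summable fun n => ‖ψ n‖ ^ 2 := by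
  have := (lp.memℓp ψ).summable (by norm_num)
  simpa using this

theorem Fock.norm_sq (ψ : Fock) : ‖ψ‖ ^ 2 = ∑' n, ‖ψ n‖ ^ 2 := by
  have := lp.norm_rpow_eq_tsum (p := 2) (by norm_num) ψ
  simpa using this

/-- The Fock vector with given `n`-boson components. -/
def mkFock (φ : ∀ n, symL2 n) (h : Summable fun n => ‖φ n‖ ^ 2) : Fock :=
  ⟨φ, memℓp_gen (by simpa using h)⟩

theorem Fock.norm_le_of_forall {ψ φ : Fock} {C : ℝ} (hC : 0 ≤ C) (h : ∀ n, ‖ψ n‖ ≤ C * ‖φ n‖) :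
    ‖ψ‖ ≤ C * ‖φ‖ := by
  rw [← sq_le_sq₀ (norm_nonneg _) (by positivity), mul_pow, Fock.norm_sq, Fock.norm_sq,
    ← tsum_mul_left]
  refine Summable.tsum_le_tsum (fun n => ?_) ψ.summable_norm_sq (φ.summable_norm_sq.mul_left _)
  rw [← mul_pow]
  exact pow_le_pow_left₀ (norm_nonneg _) (h n) 2

theorem Fock.ext_wave {ψ φ : Fock} (h : ∀ n, wave ψ n =ᵐ[volume] wave φ n) : ψ = φ :=
  lp.ext (funext fun n => Subtype.ext (Lp.ext (h n)))

theorem Fock.inner_eq_of_wave {ψ φ ψ' φ' : Fock}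
    (h : ∀ n, (fun x => conj (wave ψ n x) * wave φ n x) =ᵐ[volume]
      fun x => conj (wave ψ' n x) * wave φ' n x) : inner ℂ ψ φ = inner ℂ ψ' φ' := by
  rw [lp.inner_eq_tsum, lp.inner_eq_tsum]
  refine tsum_congr fun n => ?_
  rw [Submodule.coe_inner, Submodule.coe_inner, L2.inner_def, L2.inner_def]
  refine integral_congr_ae ?_
  filter_upwards [h n] with x hx
  simp only [RCLike.inner_apply]
  rw [mul_comm, hx, mul_comm]

theorem mem_graph_multOp {m : ∀ n : ℕ, (Fin n → R3) → ℝ} {ψ χ : Fock} :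
    (ψ, χ) ∈ (multOp m).graph ↔ ∀ n, wave χ n =ᵐ[volume] fun x => (m n x : ℂ) * wave ψ n x := by
  unfold multOp
  rw [Submodule.toLinearPMap_graph_eq]
  · rfl
  · rintro ⟨ψ, χ⟩ h h0
    refine Fock.ext_wave fun n => ?_
    change ψ = 0 at h0
    subst h0
    filter_upwards [h n, wave_zero n] with x h1 h2
    change wave χ n x = _ at h1
    rw [h1, h2, Pi.zero_apply, mul_zero]

theorem energy_comp {n : ℕ} (x : Fin n → R3) (σ : Equiv.Perm (Fin n)) :
    ∑ i, ‖(x ∘ σ) i‖ = ∑ i, ‖x i‖ := Equiv.sum_comp σ fun i => ‖x i‖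

theorem energy_nonneg {n : ℕ} (x : Fin n → R3) : 0 ≤ ∑ i, ‖x i‖ :=
  Finset.sum_nonneg fun _ _ => norm_nonneg _

/-- A measurable function on the line that is bounded by `C` on `[0, ∞)`. -/
structure BddFun where
  /-- The function. -/
  toFun : ℝ → ℂ
  /-- The bound. -/
  C : ℝ
  measurable : Measurable toFun
  le : ∀ E, 0 ≤ E → ‖toFun E‖ ≤ C

variable (F G : BddFun)

theorem BddFun.C_nonneg : 0 ≤ F.C := (norm_nonneg _).trans (F.le 0 le_rfl)

theorem BddFun.memLp {n : ℕ} (ψ : L2n n) : MemLp (fun x => F.toFun (∑ i, ‖x i‖) * ψ x) 2 := by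
  refine (Lp.memLp ψ).of_le_mul (c := F.C) ?_ (Eventually.of_forall fun x => ?_)
  · refine (F.measurable.comp ?_).aestronglyMeasurable.mul (Lp.aestronglyMeasurable ψ)
    fun_prop
  · rw [norm_mul]
    gcongr
    exact F.le _ (energy_nonneg x)

/-- `F(H_f)` on `n` bosons. -/
def fcN {n : ℕ} (ψ : symL2 n) : symL2 n := ⟨(F.memLp (ψ : L2n n)).toLp _, fun σ => by
  have h1 := (F.memLp (ψ : L2n n)).coeFn_toLp
  filter_upwards [h1, ae_perm σ h1, ψ.2 σ] with x h2 h3 h4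
  rw [h2, h3, h4, energy_comp]⟩

theorem coe_fcN {n : ℕ} (ψ : symL2 n) : (fcN F ψ : L2n n) =ᵐ[volume]
    fun x => F.toFun (∑ i, ‖x i‖) * (ψ : L2n n) x := (F.memLp (ψ : L2n n)).coeFn_toLp

theorem norm_fcN_le {n : ℕ} (ψ : symL2 n) : ‖fcN F ψ‖ ≤ F.C * ‖ψ‖ := by
  change ‖(fcN F ψ : L2n n)‖ ≤ F.C * ‖(ψ : L2n n)‖
  refine Lp.norm_le_mul_norm_of_ae_le_mul ?_
  filter_upwards [coe_fcN F ψ] with x hx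
  rw [hx, norm_mul]
  gcongr
  exact F.le _ (energy_nonneg x)

theorem fcN_add {n : ℕ} (ψ φ : symL2 n) : fcN F (ψ + φ) = fcN F ψ + fcN F φ := by
  refine Subtype.ext (Lp.ext ?_)
  filter_upwards [coe_fcN F (ψ + φ), coe_fcN F ψ, coe_fcN F φ,
    Lp.coeFn_add (fcN F ψ : L2n n) (fcN F φ : L2n n), Lp.coeFn_add (ψ : L2n n) (φ : L2n n)]
    with x h1 h2 h3 h4 h5
  rw [h1, Submodule.coe_add, Submodule.coe_add, h4, h5, Pi.add_apply, Pi.add_apply, h2, h3, mul_add]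

theorem fcN_smul {n : ℕ} (c : ℂ) (ψ : symL2 n) : fcN F (c • ψ) = c • fcN F ψ := by
  refine Subtype.ext (Lp.ext ?_)
  filter_upwards [coe_fcN F (c • ψ), coe_fcN F ψ, Lp.coeFn_smul c (fcN F ψ : L2n n),
    Lp.coeFn_smul c (ψ : L2n n)] with x h1 h2 h3 h4
  rw [h1, Submodule.coe_smul, Submodule.coe_smul, h3, h4, Pi.smul_apply, Pi.smul_apply, h2,
    smul_eq_mul, smul_eq_mul]
  ring

/-- The bounded operator `F(H_f)`. -/
def fc : Fock →L[ℂ] Fock :=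
  LinearMap.mkContinuous
    { toFun := fun ψ => mkFock (fun n => fcN F (ψ n)) <| by
        refine Summable.of_nonneg_of_le (fun n => by positivity)
          (fun n => pow_le_pow_left₀ (norm_nonneg _) (norm_fcN_le F (ψ n)) 2) ?_
        simp only [mul_pow]
        exact ψ.summable_norm_sq.mul_left _
      map_add' := fun ψ φ => lp.ext (funext fun n => fcN_add F (ψ n) (φ n))
      map_smul' := fun c ψ => lp.ext (funext fun n => fcN_smul F c (ψ n)) } F.C
    fun ψ => Fock.norm_le_of_forall F.C_nonneg fun n => norm_fcN_le F (ψ n)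

theorem norm_fc_le (ψ : Fock) : ‖fc F ψ‖ ≤ F.C * ‖ψ‖ :=
  Fock.norm_le_of_forall F.C_nonneg fun n => norm_fcN_le F (ψ n)

theorem wave_fc (ψ : Fock) (n : ℕ) : wave (fc F ψ) n =ᵐ[volume]
    fun x => F.toFun (∑ i, ‖x i‖) * wave ψ n x := coe_fcN F (ψ n)

theorem mem_graph_fieldH {ψ χ : Fock} : (ψ, χ) ∈ fieldH.graph ↔
    ∀ n, wave χ n =ᵐ[volume] fun x => ((∑ i, ‖x i‖ : ℝ) : ℂ) * wave ψ n x := mem_graph_multOp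

theorem mem_graph_fieldHSqrt {ψ χ : Fock} : (ψ, χ) ∈ fieldHSqrt.graph ↔
    ∀ n, wave χ n =ᵐ[volume] fun x => ((√(∑ i, ‖x i‖) : ℝ) : ℂ) * wave ψ n x := mem_graph_multOp

/-- `E ↦ (E + iκ)⁻¹`. -/
def resolventFun (κ : ℝ) (hκ : κ ≠ 0) : BddFun where
  toFun E := ((E : ℂ) + Complex.I * κ)⁻¹
  C := |κ|⁻¹
  measurable := by fun_prop
  le E _ := by
    rw [norm_inv]
    refine inv_anti₀ (abs_pos.2 hκ) ?_
    simpa using Complex.abs_im_le_norm ((E : ℂ) + Complex.I * κ)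

/-- `E ↦ E (E + iκ)⁻¹`. -/
def mulResolventFun (κ : ℝ) (hκ : κ ≠ 0) : BddFun where
  toFun E := (E : ℂ) * ((E : ℂ) + Complex.I * κ)⁻¹
  C := 1
  measurable := by fun_prop
  le E _ := by
    have h1 : |E| ≤ ‖(E : ℂ) + Complex.I * κ‖ := by
      simpa using Complex.abs_re_le_norm ((E : ℂ) + Complex.I * κ)
    have h2 : 0 < ‖(E : ℂ) + Complex.I * κ‖ :=
      (abs_pos.2 hκ).trans_le (by simpa using Complex.abs_im_le_norm ((E : ℂ) + Complex.I * κ))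
    rw [norm_mul, norm_inv, Complex.norm_real, Real.norm_eq_abs, ← div_eq_mul_inv,
      div_le_one h2]
    exact h1

/-- `E ↦ (√E)^j / (1 + E)`, `j ≤ 2`; the denominator `1 + (√E)²` agrees with `1 + E` on
`[0, ∞)`. -/
def sqrtPowFun (j : ℕ) (hj : j ≤ 2) : BddFun where
  toFun E := ((√E ^ j / (1 + √E ^ 2) : ℝ) : ℂ)
  C := 1
  measurable := by fun_prop
  le E _ := by
    have h0 := Real.sqrt_nonneg E
    rw [Complex.norm_real, Real.norm_of_nonneg (by positivity), div_le_one (by positivity)]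
    interval_cases j <;> nlinarith [sq_nonneg (√E - 1)]

/-- `E ↦ (j + 1) / (j + 1 + E)`, which increases to `1` with `j`. -/
def cutoffFun (j : ℕ) : BddFun where
  toFun E := (((j + 1 : ℝ) / ((j + 1) + √E ^ 2) : ℝ) : ℂ)
  C := 1
  measurable := by fun_prop
  le E _ := by
    have h0 := Real.sqrt_nonneg E
    rw [Complex.norm_real, Real.norm_of_nonneg (by positivity), div_le_one (by positivity)]
    nlinarith

/-- `E ↦ (j + 1) E / (j + 1 + E)`. -/
def mulCutoffFun (j : ℕ) : BddFun where
  toFun E := ((√E ^ 2 * ((j + 1 : ℝ) / ((j + 1) + √E ^ 2)) : ℝ) : ℂ)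
  C := j + 1
  measurable := by fun_prop
  le E _ := by
    have h0 := Real.sqrt_nonneg E
    rw [Complex.norm_real, Real.norm_of_nonneg (by positivity), ← mul_div_assoc,
      div_le_iff₀ (by positivity)]
    nlinarith [sq_nonneg (√E), mul_nonneg (sq_nonneg (√E)) (by positivity : (0 : ℝ) ≤ j + 1),
      mul_nonneg (by positivity : (0 : ℝ) ≤ j + 1) (by positivity : (0 : ℝ) ≤ j + 1)]

theorem fc_mem_graph_fieldH {F G : BddFun} (h : ∀ E, 0 ≤ E → G.toFun E = E * F.toFun E) (ψ : Fock) :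
    (fc F ψ, fc G ψ) ∈ fieldH.graph := by
  rw [mem_graph_fieldH]
  intro n
  filter_upwards [wave_fc F ψ n, wave_fc G ψ n] with x h1 h2
  rw [h1, h2, h _ (energy_nonneg x), mul_assoc]

theorem exists_fieldH_add {κ : ℝ} (hκ : κ ≠ 0) (η : Fock) :
    (fc (resolventFun κ hκ) η, fc (mulResolventFun κ hκ) η) ∈ fieldH.graph ∧
      fc (mulResolventFun κ hκ) η + (Complex.I * κ) • fc (resolventFun κ hκ) η = η := by
  refine ⟨fc_mem_graph_fieldH (fun E _ => rfl) η, Fock.ext_wave fun n => ?_⟩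
  filter_upwards [wave_fc (mulResolventFun κ hκ) η n, wave_fc (resolventFun κ hκ) η n,
    wave_add (fc (mulResolventFun κ hκ) η) ((Complex.I * κ) • fc (resolventFun κ hκ) η) n,
    wave_smul (Complex.I * κ) (fc (resolventFun κ hκ) η) n] with x h1 h2 h3 h4
  rw [h3, Pi.add_apply, h4, Pi.smul_apply, h1, h2, smul_eq_mul]
  simp only [mulResolventFun, resolventFun]
  have h5 : (((∑ i, ‖x i‖ : ℝ) : ℂ) + Complex.I * κ) ≠ 0 := fun h => by
    have := congrArg Complex.im h
    simp at this
    exact hκ this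
  field_simp

/-- `D(H_f) ⊆ D(H_f^{1/2})`. -/
theorem exists_mem_graph_fieldHSqrt {ψ η : Fock} (h : (ψ, η) ∈ fieldH.graph) :
    ∃ ρ, (ψ, ρ) ∈ fieldHSqrt.graph := by
  refine ⟨fc (sqrtPowFun 1 (by norm_num)) (ψ + η), ?_⟩
  rw [mem_graph_fieldH] at h
  rw [mem_graph_fieldHSqrt]
  intro n
  filter_upwards [wave_fc (sqrtPowFun 1 (by norm_num)) (ψ + η) n, h n, wave_add ψ η n]
    with x h1 h2 h3
  rw [h1, h3, Pi.add_apply, h2]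
  simp only [sqrtPowFun, Real.sq_sqrt (energy_nonneg x), pow_one]
  have h4 : (1 + ((∑ i, ‖x i‖ : ℝ) : ℂ)) ≠ 0 := by
    have := energy_nonneg x
    exact_mod_cast (by positivity : (1 + ∑ i, ‖x i‖ : ℝ) ≠ 0)
  rw [Complex.ofReal_div, Complex.ofReal_add, Complex.ofReal_one]
  field_simp

theorem inner_sqrt_sqrt {ψ ρ ψ' ρ' η' : Fock} (h : (ψ, ρ) ∈ fieldHSqrt.graph)
    (h' : (ψ', ρ') ∈ fieldHSqrt.graph) (hη : (ψ', η') ∈ fieldH.graph) :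
    inner ℂ ρ ρ' = inner ℂ ψ η' := by
  rw [mem_graph_fieldHSqrt] at h h'
  rw [mem_graph_fieldH] at hη
  refine Fock.inner_eq_of_wave fun n => ?_
  filter_upwards [h n, h' n, hη n] with x h1 h2 h3
  rw [h1, h2, h3, map_mul, Complex.conj_ofReal]
  have : ((∑ i, ‖x i‖ : ℝ) : ℂ) = ((√(∑ i, ‖x i‖) : ℝ) : ℂ) * ((√(∑ i, ‖x i‖) : ℝ) : ℂ) := by
    rw [← Complex.ofReal_mul, Real.mul_self_sqrt (energy_nonneg x)]
  rw [this]
  ring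

theorem isSymm_fieldH : IsSymm fieldH := by
  rintro ⟨ψ, η⟩ h ⟨ψ', η'⟩ h'
  rw [mem_graph_fieldH] at h h'
  refine Fock.inner_eq_of_wave fun n => ?_
  filter_upwards [h n, h' n] with x h1 h2
  rw [h1, h2, map_mul, Complex.conj_ofReal]
  ring

theorem dense_domain_fieldH : Dense (fieldH.domain : Set Fock) := by
  have hs : ∀ η, ∃ p ∈ fieldH.graph, p.2 + (Complex.I * (1 : ℝ)) • p.1 = η := fun η =>
    ⟨_, (exists_fieldH_add one_ne_zero η).1, (exists_fieldH_add one_ne_zero η).2⟩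
  obtain ⟨R, hR⟩ := isSymm_fieldH.exists_resolvent one_ne_zero hs
  exact isSymm_fieldH.dense_domain hR one_ne_zero

theorem fc_cutoff_mem (j : ℕ) (ψ : Fock) : fc (cutoffFun j) ψ ∈ fieldH.domain := by
  refine LinearPMap.mem_domain_of_mem_graph (fc_mem_graph_fieldH (F := cutoffFun j)
    (G := mulCutoffFun j) (fun E hE => ?_) ψ)
  simp only [cutoffFun, mulCutoffFun]
  rw [Complex.ofReal_mul, Real.sq_sqrt hE]

theorem tendsto_fc_cutoff (ψ : Fock) : Tendsto (fun j => fc (cutoffFun j) ψ) atTop (𝓝 ψ) := by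
  refine tendsto_of_dense dense_domain_fieldH (F := fun j ψ => fc (cutoffFun j) ψ) (L := id)
    (fun j ψ φ => ?_) (fun _ _ => le_rfl) (fun ψ hψ => ?_) ψ
  · rw [← map_sub]
    simpa [cutoffFun] using norm_fc_le (cutoffFun j) (ψ - φ)
  · have hg := mem_graph_fieldH.1 (fieldH.mem_graph ⟨ψ, hψ⟩)
    set η := fieldH ⟨ψ, hψ⟩
    have h1 : ∀ j, ‖fc (cutoffFun j) ψ - ψ‖ ≤ (1 / (j + 1 : ℝ)) * ‖η‖ := fun j => by
      have h2 : fc (cutoffFun j) ψ - ψ = -((1 / (j + 1 : ℝ) : ℝ) : ℂ) • fc (cutoffFun j) η := by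
        refine Fock.ext_wave fun n => ?_
        filter_upwards [wave_fc (cutoffFun j) ψ n, wave_fc (cutoffFun j) η n, hg n,
          wave_smul (-((1 / (j + 1 : ℝ) : ℝ) : ℂ)) (fc (cutoffFun j) η) n,
          Lp.coeFn_sub (fc (cutoffFun j) ψ n : L2n n) (ψ n : L2n n)] with x h1 h2 h3 h4 h5
        refine h5.trans ?_
        rw [h4, Pi.sub_apply, Pi.smul_apply, h2, h3, smul_eq_mul]
        refine (congrArg (· - _) h1).trans ?_
        simp only [cutoffFun, Real.sq_sqrt (energy_nonneg x)]
        have h6 := energy_nonneg x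
        have h7 : ((j : ℂ) + 1 + ((∑ i, ‖x i‖ : ℝ) : ℂ)) ≠ 0 := by
          exact_mod_cast (by positivity : (j + 1 + ∑ i, ‖x i‖ : ℝ) ≠ 0)
        have h8 : (j : ℂ) + 1 ≠ 0 := by exact_mod_cast Nat.succ_ne_zero j
        simp only [Complex.ofReal_div, Complex.ofReal_add, Complex.ofReal_one,
          Complex.ofReal_natCast]
        field_simp
        ring
      rw [h2, norm_smul, norm_neg, Complex.norm_real, Real.norm_of_nonneg (by positivity)]
      gcongr
      simpa [cutoffFun] using norm_fc_le (cutoffFun j) η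
    rw [tendsto_iff_norm_sub_tendsto_zero]
    refine squeeze_zero (fun _ => norm_nonneg _) h1 ?_
    simpa using tendsto_one_div_add_atTop_nhds_zero_nat.mul_const ‖η‖

theorem fc_mem_graph_fieldHSqrt {ψ ρ : Fock} (h : (ψ, ρ) ∈ fieldHSqrt.graph) :
    (fc F ψ, fc F ρ) ∈ fieldHSqrt.graph := by
  rw [mem_graph_fieldHSqrt] at h ⊢
  intro n
  filter_upwards [wave_fc F ψ n, wave_fc F ρ n, h n] with x h1 h2 h3
  rw [h1, h2, h3]
  ring

end FockBasics

/-! ### Polar coordinates and radial Fourier transforms -/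

section Polar

instance : IsFiniteMeasure solidAngle := by unfold solidAngle; infer_instance

/-- The measure `r² dr` on the half line. -/
def radialMeasure : Measure ℝ := (volume.restrict (Ioi 0)).withDensity fun r => .ofReal (r ^ 2)

theorem measurePreserving_coe_volumeIoiPow :
    MeasurePreserving ((↑) : Ioi (0 : ℝ) → ℝ) (Measure.volumeIoiPow 2) radialMeasure := by
  refine ⟨measurable_subtype_coe, ?_⟩
  ext s hs
  rw [Measure.map_apply measurable_subtype_coe hs, Measure.volumeIoiPow,
    withDensity_apply _ (measurable_subtype_coe hs), radialMeasure, withDensity_apply _ hs,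
    ← lintegral_indicator (measurable_subtype_coe hs), ← lintegral_indicator hs]
  have h1 := lintegral_subtype_comap (μ := (volume : Measure ℝ)) (measurableSet_Ioi (a := (0 : ℝ)))
    (s.indicator fun r => ENNReal.ofReal (r ^ 2))
  rw [← h1]
  rfl

/-- Polar coordinates on `ℝ³`. -/
theorem measurePreserving_polar :
    MeasurePreserving (fun p : ℝ × S2 => p.1 • (p.2 : R3)) (radialMeasure.prod solidAngle)
      volume := by
  have h1 : MeasurePreserving (fun p : S2 × Ioi (0 : ℝ) => ((p.2 : ℝ), p.1))
      (solidAngle.prod (Measure.volumeIoiPow 2)) (radialMeasure.prod solidAngle) :=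
    (measurePreserving_coe_volumeIoiPow.prod (MeasurePreserving.id solidAngle)).comp
      Measure.measurePreserving_swap
  have h2 := Measure.measurePreserving_homeomorphUnitSphereProd (volume : Measure R3)
  have hdim : Module.finrank ℝ R3 - 1 = 2 := by simp
  rw [hdim] at h2
  have h3 := h2.symm (homeomorphUnitSphereProd R3).toMeasurableEquiv
  have h4 : MeasurePreserving (Subtype.val : ({0}ᶜ : Set R3) → R3) (volume.comap Subtype.val)
      volume := by
    refine ⟨measurable_subtype_coe, ?_⟩
    rw [map_comap_subtype_coe (measurableSet_singleton _).compl]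
    exact Measure.restrict_eq_self_of_ae_mem ae_ne_zero
  have h5 := h4.comp h3
  have h6 : (fun p : ℝ × S2 => p.1 • (p.2 : R3)) ∘ (fun p : S2 × Ioi (0 : ℝ) => ((p.2 : ℝ), p.1)) =
      Subtype.val ∘ (homeomorphUnitSphereProd R3).toMeasurableEquiv.symm := by
    ext1 p
    simp [homeomorphUnitSphereProd]
  refine ⟨by fun_prop, ?_⟩
  rw [← h1.map_eq, Measure.map_map (by fun_prop) h1.measurable, h6]
  exact h5.map_eq

theorem radialMeasure_prod : radialMeasure.prod solidAngle =
    ((volume.restrict (Ioi 0)).prod solidAngle).withDensity fun p => .ofReal (p.1 ^ 2) :=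
  prod_withDensity_left (by fun_prop)

variable {E : Type*} [NormedAddCommGroup E] [NormedSpace ℝ E]

theorem integrable_polar {u : R3 → E} (hu : Integrable u) :
    Integrable (fun p : ℝ × S2 => p.1 ^ 2 • u (p.1 • (p.2 : R3)))
      ((volume.restrict (Ioi 0)).prod solidAngle) := by
  have h1 := measurePreserving_polar.integrable_comp_of_integrable hu
  rw [radialMeasure_prod, integrable_withDensity_iff_integrable_smul' (by fun_prop) (by simp)] at h1
  refine h1.congr (Eventually.of_forall fun p => ?_)
  simp only [Function.comp]
  rw [ENNReal.toReal_ofReal (sq_nonneg _)]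

theorem integral_polar {u : R3 → E} (hu : AEStronglyMeasurable u) :
    ∫ k, u k = ∫ p : ℝ × S2, p.1 ^ 2 • u (p.1 • (p.2 : R3))
      ∂((volume.restrict (Ioi 0)).prod solidAngle) := by
  have h0 := measurePreserving_polar.map_eq
  have h1 := integral_map (f := u) measurePreserving_polar.measurable.aemeasurable (by rwa [h0])
  rw [h0] at h1
  rw [h1, radialMeasure_prod, integral_withDensity_eq_integral_toReal_smul₀ (by fun_prop) (by simp)]
  refine integral_congr_ae (Eventually.of_forall fun p => ?_)
  simp only
  rw [ENNReal.toReal_ofReal (sq_nonneg _)]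

theorem integral_polar_iterated {u : R3 → E} (hu : Integrable u) :
    ∫ k, u k = ∫ r in Ioi (0 : ℝ), r ^ 2 • ∫ s : S2, u (r • (s : R3)) ∂solidAngle := by
  rw [integral_polar hu.1, integral_prod _ (integrable_polar hu)]
  simp only [integral_smul]

/-- The Riemann–Lebesgue lemma for the phases `e^{it|k|}`. -/
theorem tendsto_integral_phase {u : R3 → ℂ} (hu : Integrable u) :
    Tendsto (fun t : ℝ => ∫ k : R3, Complex.exp (Complex.I * t * ‖k‖) * u k) (cocompact ℝ)
      (𝓝 0) := by
  set v : ℝ → ℂ := (Ioi (0 : ℝ)).indicator fun r =>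
    r ^ 2 • ∫ s : S2, u (r • (s : R3)) ∂solidAngle with hv
  have h1 := Real.tendsto_integral_exp_smul_cocompact v
  have h2 : Tendsto (fun t : ℝ => -t / (2 * Real.pi)) (cocompact ℝ) (cocompact ℝ) := by
    have h3 : (-(2 * Real.pi)⁻¹ : ℝ) ≠ 0 := by
      simp [Real.pi_ne_zero]
    have := (Homeomorph.mulLeft₀ _ h3).isClosedEmbedding.tendsto_cocompact
    refine this.congr fun t => ?_
    simp only [Homeomorph.coe_mulLeft₀]
    ring
  refine (h1.comp h2).congr fun t => ?_
  have hexp : ∀ k : R3, ‖Complex.exp (Complex.I * t * ‖k‖)‖ = 1 := fun k => by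
    rw [Complex.norm_exp]; simp
  have h4 : Integrable fun k : R3 => Complex.exp (Complex.I * t * ‖k‖) * u k :=
    hu.bdd_mul (c := 1) (by fun_prop) (Eventually.of_forall fun k => (hexp k).le)
  rw [integral_polar_iterated h4, ← integral_indicator measurableSet_Ioi]
  refine integral_congr_ae (Eventually.of_forall fun r => ?_)
  simp only [hv]
  by_cases hr : r ∈ Ioi (0 : ℝ)
  · rw [indicator_of_mem hr, indicator_of_mem hr, Real.fourierChar_apply', Circle.smul_def,
      smul_comm]
    congr 1
    rw [smul_eq_mul, ← integral_const_mul]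
    refine integral_congr_ae (Eventually.of_forall fun s => ?_)
    simp only [norm_smul, Real.norm_of_nonneg (le_of_lt hr), norm_eq_of_mem_sphere, mul_one,
      Circle.coe_exp]
    congr 2
    push_cast
    have : (Real.pi : ℂ) ≠ 0 := Complex.ofReal_ne_zero.2 Real.pi_ne_zero
    field_simp
  · rw [indicator_of_notMem hr, indicator_of_notMem hr, smul_zero]

end Polar

section Angular

/-- Angular integrals of a smooth function depend smoothly on the radius. The weight `w` makes the
statement stable under differentiation: the radial derivative is a sum of angular integrals of the
partial derivatives, with weights `w s * s i`. -/
theorem contDiff_angular (n : ℕ) : ∀ {u : R3 → ℂ}, ContDiff ℝ ∞ u → ∀ {w : S2 → ℝ}, Continuous w →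
    ContDiff ℝ n fun r : ℝ => ∫ s : S2, w s • u (r • (s : R3)) ∂solidAngle := by
  induction n with
  | zero =>
    intro u hu w hw
    have hu' := hu.continuous
    rw [Nat.cast_zero, contDiff_zero]
    have := continuous_parametric_integral_of_continuous (μ := solidAngle)
      (f := fun (r : ℝ) (s : S2) => w s • u (r • (s : R3))) (s := univ)
      (by unfold Function.uncurry; fun_prop) isCompact_univ
    simpa using this
  | succ n ih =>
    intro u hu w hw
    have hu' := hu.continuous
    have hdu : Continuous (fderiv ℝ u) := hu.continuous_fderiv (by simp)
    set e : Fin 3 → R3 := fun i => EuclideanSpace.single i 1 with he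
    have hder : ∀ r : ℝ, HasDerivAt (fun r : ℝ => ∫ s : S2, w s • u (r • (s : R3)) ∂solidAngle)
        (∫ s : S2, w s • fderiv ℝ u (r • (s : R3)) (s : R3) ∂solidAngle) r := by
      intro r
      have hc : Continuous fun p : ℝ × S2 => w p.2 • fderiv ℝ u (p.1 • (p.2 : R3)) (p.2 : R3) := by
        fun_prop
      obtain ⟨C, hC⟩ := ((isCompact_closedBall r 1).prod
        (isCompact_univ (X := S2))).exists_bound_of_continuousOn hc.continuousOn
      refine (hasDerivAt_integral_of_dominated_loc_of_deriv_le (μ := solidAngle)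
        (F := fun (r : ℝ) (s : S2) => w s • u (r • (s : R3)))
        (F' := fun (r : ℝ) (s : S2) => w s • fderiv ℝ u (r • (s : R3)) (s : R3))
        (bound := fun _ => C) (Metric.ball_mem_nhds r one_pos)
        (Eventually.of_forall fun r => ?_) ?_ ?_ ?_ (integrable_const _) ?_).2
      · exact (by fun_prop : Continuous fun s : S2 => w s • u (r • (s : R3))).aestronglyMeasurable
      · exact (by fun_prop : Continuous fun s : S2 =>
          w s • u (r • (s : R3))).integrable_of_hasCompactSupport
            (HasCompactSupport.of_compactSpace _)
      · exact (by fun_prop : Continuous fun s : S2 =>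
          w s • fderiv ℝ u (r • (s : R3)) (s : R3)).aestronglyMeasurable
      · exact Eventually.of_forall fun s ρ hρ =>
          hC (ρ, s) ⟨Metric.ball_subset_closedBall hρ, mem_univ _⟩
      · refine Eventually.of_forall fun s ρ _ => ?_
        have h1 : HasFDerivAt u (fderiv ℝ u (ρ • (s : R3))) (ρ • (s : R3)) :=
          (hu.differentiable (by simp) _).hasFDerivAt
        have h2 : HasDerivAt (fun ρ : ℝ => ρ • (s : R3)) (s : R3) ρ := by
          simpa using (hasDerivAt_id ρ).smul_const (s : R3)
        exact (h1.comp_hasDerivAt ρ h2).const_smul (w s)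
    rw [Nat.cast_add, Nat.cast_one, contDiff_succ_iff_deriv]
    refine ⟨fun r => (hder r).differentiableAt, by simp, ?_⟩
    have h3 : deriv (fun r : ℝ => ∫ s : S2, w s • u (r • (s : R3)) ∂solidAngle) = fun r =>
        ∑ i : Fin 3,
          ∫ s : S2, (w s * (s : R3) i) • fderiv ℝ u (r • (s : R3)) (e i) ∂solidAngle := by
      ext r
      rw [(hder r).deriv, ← integral_finsetSum]
      · refine integral_congr_ae (Eventually.of_forall fun s => ?_)
        have h4 : (s : R3) = ∑ i, (s : R3) i • e i := by
          ext j
          simp [he, Finset.sum_apply, Pi.single_apply]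
        simp only
        conv_lhs => rw [h4]
        rw [map_sum, Finset.smul_sum]
        refine Finset.sum_congr rfl fun i _ => ?_
        rw [map_smul, smul_smul, ← h4]
      · intro i _
        exact (by fun_prop : Continuous fun s : S2 =>
          (w s * (s : R3) i) • fderiv ℝ u (r • (s : R3)) (e i)).integrable_of_hasCompactSupport
            (HasCompactSupport.of_compactSpace _)
    rw [h3]
    refine ContDiff.sum fun i _ => ih (u := fun x => fderiv ℝ u x (e i)) ?_ (by fun_prop)
    exact (hu.fderiv_right (m := ∞) (by simp)).clm_apply contDiff_const

/-- The radial density `r² ∫ u(rΣ) dΣ` of `u`, extended by `0` to `r ≤ 0`. -/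
def radialDensity (u : R3 → ℂ) (r : ℝ) : ℂ :=
  if 0 < r then (r : ℂ) ^ 2 * ∫ s : S2, u (r • (s : R3)) ∂solidAngle else 0

theorem IsTest.exists_ball {u : R3 → ℂ} (hu : IsTest u) :
    ∃ δ > 0, ∀ k : R3, ‖k‖ < δ → u k = 0 := by
  have : (tsupport u)ᶜ ∈ 𝓝 (0 : R3) := (isClosed_tsupport u).isOpen_compl.mem_nhds hu.2.2
  obtain ⟨δ, hδ, h⟩ := Metric.mem_nhds_iff.1 this
  exact ⟨δ, hδ, fun k hk => image_eq_zero_of_notMem_tsupport (h (by simpa using hk))⟩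

theorem IsTest.exists_bound {u : R3 → ℂ} (hu : IsTest u) :
    ∃ M, ∀ k : R3, M < ‖k‖ → u k = 0 := by
  obtain ⟨M, hM⟩ := hu.2.1.isCompact.isBounded.exists_norm_le
  exact ⟨M, fun k hk => image_eq_zero_of_notMem_tsupport fun h => not_le.2 hk (hM k h)⟩

theorem radialDensity_eq_zero {u : R3 → ℂ} {δ : ℝ} (h : ∀ k : R3, ‖k‖ < δ → u k = 0) {r : ℝ}
    (hr : r < δ) : radialDensity u r = 0 := by
  unfold radialDensity
  split_ifs with h0
  · rw [integral_eq_zero_of_ae, mul_zero]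
    refine Eventually.of_forall fun s => h _ ?_
    rwa [norm_smul, norm_eq_of_mem_sphere, mul_one, Real.norm_of_nonneg h0.le]
  · rfl

/-- The radial density is smooth across `0` because a test function vanishes near the origin. -/
theorem contDiff_radialDensity {u : R3 → ℂ} (hu : IsTest u) : ContDiff ℝ ∞ (radialDensity u) := by
  obtain ⟨δ, hδ, h⟩ := hu.exists_ball
  rw [contDiff_iff_contDiffAt]
  intro r
  rcases lt_or_ge r δ with hr | hr
  · refine (contDiffAt_const (c := (0 : ℂ))).congr_of_eventuallyEq ?_
    filter_upwards [Iio_mem_nhds hr] with x hx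
    exact radialDensity_eq_zero h hx
  · have h1 : ContDiff ℝ ∞ fun r : ℝ => (r : ℂ) ^ 2 * ∫ s : S2, u (r • (s : R3)) ∂solidAngle := by
      refine (Complex.ofRealCLM.contDiff.pow 2).mul ?_
      rw [contDiff_infty]
      intro n
      simpa using contDiff_angular n hu.1 (w := fun _ => 1) continuous_const
    refine h1.contDiffAt.congr_of_eventuallyEq ?_
    filter_upwards [Ioi_mem_nhds (hδ.trans_le hr)] with x hx
    rw [radialDensity, if_pos (mem_Ioi.1 hx)]

theorem hasCompactSupport_radialDensity {u : R3 → ℂ} (hu : IsTest u) :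
    HasCompactSupport (radialDensity u) := by
  obtain ⟨M, hM⟩ := hu.exists_bound
  refine HasCompactSupport.intro (isCompact_Icc (a := 0) (b := M)) fun r hr => ?_
  unfold radialDensity
  split_ifs with h0
  · rw [integral_eq_zero_of_ae, mul_zero]
    refine Eventually.of_forall fun s => hM _ ?_
    rw [norm_smul, norm_eq_of_mem_sphere, mul_one, Real.norm_of_nonneg h0.le]
    by_contra! h1
    exact hr ⟨h0.le, h1⟩
  · rfl

theorem IsTest.integrable {u : R3 → ℂ} (hu : IsTest u) : Integrable u :=
  hu.1.continuous.integrable_of_hasCompactSupport hu.2.1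

/-- `∫ e^{it|k|} u(k) dk`. -/
def radialFourier (u : R3 → ℂ) (t : ℝ) : ℂ := ∫ k : R3, Complex.exp (Complex.I * t * ‖k‖) * u k

theorem norm_exp_phase (t r : ℝ) : ‖Complex.exp (Complex.I * t * r)‖ = 1 := by
  rw [Complex.norm_exp]; simp

theorem radialFourier_eq {u : R3 → ℂ} (hu : Integrable u) (t : ℝ) :
    radialFourier u t = ∫ r : ℝ, Complex.exp (Complex.I * t * r) * radialDensity u r := by
  have h4 : Integrable fun k : R3 => Complex.exp (Complex.I * t * ‖k‖) * u k :=
    hu.bdd_mul (c := 1) (by fun_prop) (Eventually.of_forall fun k => (norm_exp_phase _ _).le)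
  rw [radialFourier, integral_polar_iterated h4, ← integral_indicator measurableSet_Ioi]
  refine integral_congr_ae (Eventually.of_forall fun r => ?_)
  by_cases hr : r ∈ Ioi (0 : ℝ)
  · simp only [indicator_of_mem hr, radialDensity, if_pos (mem_Ioi.1 hr)]
    rw [mul_left_comm, ← integral_const_mul, Complex.real_smul, Complex.ofReal_pow]
    congr 1
    refine integral_congr_ae (Eventually.of_forall fun s => ?_)
    simp only [norm_smul, Real.norm_of_nonneg (le_of_lt (mem_Ioi.1 hr)), norm_eq_of_mem_sphere,
      mul_one]
  · simp only [indicator_of_notMem hr, radialDensity, if_neg (mt mem_Ioi.2 hr), mul_zero]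

open FourierTransform in
theorem radialFourier_eq_fourier {u : R3 → ℂ} (hu : IsTest u) (t : ℝ) :
    radialFourier u t = 𝓕 (radialDensity u) (-t / (2 * Real.pi)) := by
  rw [radialFourier_eq hu.integrable, Real.fourier_eq']
  refine integral_congr_ae (Eventually.of_forall fun r => ?_)
  simp only [smul_eq_mul]
  congr 2
  have : (Real.pi : ℂ) ≠ 0 := Complex.ofReal_ne_zero.2 Real.pi_ne_zero
  simp only [RCLike.inner_apply, conj_trivial]
  push_cast
  field_simp

open FourierTransform in
theorem integrable_fourier_radialDensity {u : R3 → ℂ} (hu : IsTest u) :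
    Integrable (𝓕 (radialDensity u)) := by
  have := (𝓕 ((hasCompactSupport_radialDensity hu).toSchwartzMap
    (contDiff_radialDensity hu))).integrable (μ := volume)
  rwa [SchwartzMap.fourier_coe] at this

theorem integrable_radialFourier {u : R3 → ℂ} (hu : IsTest u) : Integrable (radialFourier u) := by
  have h1 := (integrable_fourier_radialDensity hu).comp_mul_left'
    (R := -(2 * Real.pi)⁻¹) (by simp [Real.pi_ne_zero])
  refine h1.congr (Eventually.of_forall fun t => ?_)
  simp only
  rw [radialFourier_eq_fourier hu, show -(2 * Real.pi)⁻¹ * t = -t / (2 * Real.pi) by ring]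

/-- Fourier inversion for the radial variable. -/
theorem integral_radialFourier_mul_exp {u : R3 → ℂ} (hu : IsTest u) (r : ℝ) :
    ∫ t : ℝ, radialFourier u t * Complex.exp (-(Complex.I * t * r)) =
      2 * Real.pi * radialDensity u r := by
  have h0 := (contDiff_radialDensity hu).continuous
  have h1 := h0.fourierInv_fourier_eq
    (h0.integrable_of_hasCompactSupport (hasCompactSupport_radialDensity hu))
    (integrable_fourier_radialDensity hu)
  have h2 := congrFun h1 r
  rw [Real.fourierInv_eq'] at h2
  have h3 := Measure.integral_comp_mul_left (fun v : ℝ =>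
    Complex.exp (((2 * Real.pi * inner ℝ v r : ℝ) : ℂ) * Complex.I) •
      FourierTransform.fourier (radialDensity u) v) (-(2 * Real.pi)⁻¹)
  rw [h2] at h3
  have h4 : |(-(2 * Real.pi)⁻¹)⁻¹| = 2 * Real.pi := by
    rw [inv_neg, inv_inv, abs_neg, abs_of_pos (by positivity)]
  rw [h4, Complex.real_smul] at h3
  push_cast at h3
  rw [← h3]
  refine integral_congr_ae (Eventually.of_forall fun t => ?_)
  simp only
  rw [radialFourier_eq_fourier hu, smul_eq_mul, mul_comm]
  have : (Real.pi : ℂ) ≠ 0 := Complex.ofReal_ne_zero.2 Real.pi_ne_zero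
  congr 1
  · congr 1
    simp only [RCLike.inner_apply, conj_trivial]
    push_cast
    field_simp
  · rw [show -(2 * Real.pi)⁻¹ * t = -t / (2 * Real.pi) by ring]

end Angular

/-! ### Annihilation and creation operators on Fock space -/

section FockOps

/-- The functions `h` for which the annihilation and creation operators are controlled by
`H_f^{1/2}`: both `h` and `|k|^{-1/2} h` are square integrable. -/
structure Good (h : R3 → ℂ) : Prop where
  mem : MemLp h 2 volume
  memW : MemLp (fun k => h k / (√‖k‖ : ℝ)) 2 volume

namespace Good

variable {h f : R3 → ℂ}

/-- `h` as an element of `L²`. -/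
def L (hh : Good h) : L2R3 := hh.mem.toLp h

/-- `|k|^{-1/2} h` as an element of `L²`. -/
def W (hh : Good h) : L2R3 := hh.memW.toLp _

theorem coe_L (hh : Good h) : hh.L =ᵐ[volume] h := hh.mem.coeFn_toLp

theorem coe_W (hh : Good h) : hh.W =ᵐ[volume] fun k => hh.L k / (√‖k‖ : ℝ) := by
  filter_upwards [hh.memW.coeFn_toLp, hh.coe_L] with k h1 h2
  rw [h2]
  exact h1

theorem add (hh : Good h) (hf : Good f) : Good (fun k => h k + f k) :=
  ⟨hh.mem.add hf.mem, (memLp_congr_ae (Eventually.of_forall fun k => by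
    simp only [Pi.add_apply, add_div])).1 (hh.memW.add hf.memW)⟩

theorem smul (hh : Good h) (c : ℂ) : Good (fun k => c * h k) :=
  ⟨hh.mem.const_mul c, by simpa only [mul_div_assoc] using hh.memW.const_mul c⟩

/-- Multiplication by a bounded measurable function. -/
theorem bdd_mul (hh : Good h) {m : R3 → ℂ} (hm : Measurable m) {C : ℝ} (hC : ∀ k, ‖m k‖ ≤ C) :
    Good (fun k => h k * m k) := by
  refine ⟨hh.mem.of_le_mul (c := C) (hh.mem.1.mul hm.aestronglyMeasurable)
    (Eventually.of_forall fun k => ?_), hh.memW.of_le_mul (c := C) ?_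
    (Eventually.of_forall fun k => ?_)⟩
  · rw [norm_mul, mul_comm]
    gcongr
    exact hC k
  · have : (fun k => h k * m k / (√‖k‖ : ℝ)) = fun k => (h k / (√‖k‖ : ℝ)) * m k := by
      ext k; ring
    rw [this]
    exact hh.memW.1.mul hm.aestronglyMeasurable
  · rw [mul_div_right_comm, norm_mul, mul_comm]
    gcongr
    exact hC k

theorem freeEvol (hh : Good h) (t : ℝ) : Good (freeEvol h t) :=
  hh.bdd_mul (by fun_prop) (C := 1) fun k => by rw [Complex.norm_exp]; simp

theorem norm_L_freeEvol_le (hh : Good h) (t : ℝ) : ‖(hh.freeEvol t).L‖ ≤ ‖hh.L‖ := by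
  refine Lp.norm_le_norm_of_ae_le ?_
  filter_upwards [(hh.freeEvol t).coe_L, hh.coe_L] with k h1 h2
  rw [h1, h2, SpinBoson.freeEvol, norm_mul, Complex.norm_exp]
  simp

theorem norm_W_freeEvol_le (hh : Good h) (t : ℝ) : ‖(hh.freeEvol t).W‖ ≤ ‖hh.W‖ := by
  refine Lp.norm_le_norm_of_ae_le ?_
  filter_upwards [(hh.freeEvol t).coe_L, hh.coe_L, (hh.freeEvol t).coe_W, hh.coe_W]
    with k h1 h2 h3 h4
  rw [h3, h4, h1, h2, SpinBoson.freeEvol, mul_div_right_comm, norm_mul, Complex.norm_exp]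
  simp

end Good

/-- `D(H_f^{1/2})` in Fock space. -/
abbrev Q : Submodule ℂ Fock := fieldHSqrt.domain

/-- `H_f^{1/2}` as a linear map on its domain. -/
abbrev sqQ : Q →ₗ[ℂ] Fock := fieldHSqrt.toFun

theorem sqQ_mem (ψ : Q) : ((ψ : Fock), sqQ ψ) ∈ fieldHSqrt.graph := fieldHSqrt.mem_graph ψ

theorem wave_sqQ (ψ : Q) (n : ℕ) : wave (sqQ ψ) n =ᵐ[volume]
    fun x => ((√(∑ i, ‖x i‖) : ℝ) : ℂ) * wave (ψ : Fock) n x := mem_graph_fieldHSqrt.1 (sqQ_mem ψ) n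

variable {h f : R3 → ℂ} (hh : Good h) (hf : Good f)

theorem norm_annN_Q_le (ψ : Q) (n : ℕ) :
    ‖annN hh.L ((ψ : Fock) (n + 1))‖ ≤ ‖hh.W‖ * ‖sqQ ψ (n + 1)‖ :=
  norm_annN_le hh.coe_W (wave_sqQ ψ (n + 1))

theorem summable_annN (ψ : Q) : Summable fun n => ‖annN hh.L ((ψ : Fock) (n + 1))‖ ^ 2 := by
  refine Summable.of_nonneg_of_le (fun n => by positivity)
    (fun n => pow_le_pow_left₀ (norm_nonneg _) (norm_annN_Q_le hh ψ n) 2) ?_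
  simp only [mul_pow]
  exact ((summable_nat_add_iff 1).2 (sqQ ψ).summable_norm_sq).mul_left _

/-- `a(h)` on `D(H_f^{1/2})`. -/
def annQ : Q →ₗ[ℂ] Fock where
  toFun ψ := mkFock (fun n => annN hh.L ((ψ : Fock) (n + 1))) (summable_annN hh ψ)
  map_add' ψ _ := lp.ext (funext fun n => map_add (annN hh.L) ((ψ : Fock) (n + 1)) _)
  map_smul' c ψ := lp.ext (funext fun n => map_smul (annN hh.L) c ((ψ : Fock) (n + 1)))

theorem annQ_apply (ψ : Q) (n : ℕ) : annQ hh ψ n = annN hh.L ((ψ : Fock) (n + 1)) := rfl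

theorem norm_annQ_le (ψ : Q) : ‖annQ hh ψ‖ ≤ ‖hh.W‖ * ‖sqQ ψ‖ := by
  rw [← sq_le_sq₀ (norm_nonneg _) (by positivity), mul_pow, Fock.norm_sq, Fock.norm_sq (sqQ ψ),
    (sqQ ψ).summable_norm_sq.tsum_eq_zero_add, mul_add, ← tsum_mul_left]
  refine le_add_of_nonneg_of_le (by positivity) ?_
  refine Summable.tsum_le_tsum (fun n => ?_) (summable_annN hh ψ)
    (((summable_nat_add_iff 1).2 (sqQ ψ).summable_norm_sq).mul_left _)
  rw [← mul_pow]
  exact pow_le_pow_left₀ (norm_nonneg _) (norm_annN_Q_le hh ψ n) 2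

theorem norm_creN_sq_succ (h : L2R3) {n : ℕ} (φ : symL2 (n + 1)) :
    ‖creN h φ‖ ^ 2 = ‖annN h φ‖ ^ 2 + ‖h‖ ^ 2 * ‖φ‖ ^ 2 := by
  have h1 := inner_self_eq_norm_sq_to_K (𝕜 := ℂ) (creN h φ)
  have h2 := inner_self_eq_norm_sq_to_K (𝕜 := ℂ) φ
  have h3 := inner_self_eq_norm_sq_to_K (𝕜 := ℂ) h
  have h4 := inner_self_eq_norm_sq_to_K (𝕜 := ℂ) (annN h φ)
  have h5 := h1.symm.trans ((inner_creN_creN_succ h h φ φ).trans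
    (congrArg₂ (· + ·) h4 (congrArg₂ (· * ·) h3 h2)))
  exact_mod_cast h5

/-- The components of `a*(h)ψ`. -/
def creFam (h : L2R3) (ψ : Fock) : ∀ n, symL2 n
  | 0 => 0
  | n + 1 => creN h (ψ n)

theorem summable_creN (ψ : Q) : Summable fun n => ‖creN hh.L ((ψ : Fock) n)‖ ^ 2 := by
  rw [← summable_nat_add_iff 1]
  simp only [norm_creN_sq_succ]
  exact (summable_annN hh ψ).add
    (((summable_nat_add_iff 1).2 (ψ : Fock).summable_norm_sq).mul_left _)

theorem summable_creFam (ψ : Q) : Summable fun n => ‖creFam hh.L ψ n‖ ^ 2 := by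
  rw [← summable_nat_add_iff 1]
  exact summable_creN hh ψ

/-- `a*(h)` on `D(H_f^{1/2})`. -/
def creQ : Q →ₗ[ℂ] Fock where
  toFun ψ := mkFock (creFam hh.L ψ) (summable_creFam hh ψ)
  map_add' ψ φ := by
    refine lp.ext (funext fun n => ?_)
    cases n with
    | zero => exact (add_zero (0 : symL2 0)).symm
    | succ n => exact map_add (creN hh.L) ((ψ : Fock) n) _
  map_smul' c ψ := by
    refine lp.ext (funext fun n => ?_)
    cases n with
    | zero => exact (smul_zero c : c • (0 : symL2 0) = 0).symm
    | succ n => exact map_smul (creN hh.L) c ((ψ : Fock) n)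

theorem creQ_zero (ψ : Q) : creQ hh ψ 0 = 0 := rfl

theorem creQ_succ (ψ : Q) (n : ℕ) : creQ hh ψ (n + 1) = creN hh.L ((ψ : Fock) n) := rfl

theorem Fock.summable_inner (ψ φ : Fock) : Summable fun n => (inner ℂ (ψ n) (φ n) : ℂ) :=
  lp.summable_inner ψ φ

theorem Fock.summable_inner_succ (ψ φ : Fock) :
    Summable fun n => (inner ℂ (ψ (n + 1)) (φ (n + 1)) : ℂ) :=
  (summable_nat_add_iff (f := fun n => (inner ℂ (ψ n) (φ n) : ℂ)) 1).2 (Fock.summable_inner ψ φ)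

theorem Fock.inner_eq_zero_add (ψ φ : Fock) :
    inner ℂ ψ φ = inner ℂ (ψ 0) (φ 0) + ∑' n, inner ℂ (ψ (n + 1)) (φ (n + 1)) := by
  exact (lp.inner_eq_tsum ψ φ).trans (Fock.summable_inner ψ φ).tsum_eq_zero_add

/-- The canonical commutation relations. -/
theorem inner_creQ_creQ (φ ψ : Q) : inner ℂ (creQ hh φ) (creQ hf ψ) =
    inner ℂ (annQ hf φ) (annQ hh ψ) + inner ℂ hh.L hf.L * inner ℂ (φ : Fock) (ψ : Fock) := by
  have hs : Summable fun n => (inner ℂ (creQ hh φ (n + 1)) (creQ hf ψ (n + 1)) : ℂ) :=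
    Fock.summable_inner_succ (creQ hh φ) (creQ hf ψ)
  have hs2 : Summable fun n => (inner ℂ ((φ : Fock) (n + 1)) ((ψ : Fock) (n + 1)) : ℂ) :=
    Fock.summable_inner_succ (φ : Fock) (ψ : Fock)
  have hs3 : Summable fun n => (inner ℂ (annQ hf φ n) (annQ hh ψ n) : ℂ) :=
    Fock.summable_inner (annQ hf φ) (annQ hh ψ)
  have h0 : (inner ℂ (creQ hh φ (0 + 1)) (creQ hf ψ (0 + 1)) : ℂ) =
      inner ℂ hh.L hf.L * inner ℂ ((φ : Fock) 0) ((ψ : Fock) 0) :=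
    inner_creN_creN_zero hh.L hf.L ((φ : Fock) 0) ((ψ : Fock) 0)
  have h1 : ∀ n, (inner ℂ (creQ hh φ (n + 1 + 1)) (creQ hf ψ (n + 1 + 1)) : ℂ) =
      inner ℂ (annQ hf φ n) (annQ hh ψ n) +
        inner ℂ hh.L hf.L * inner ℂ ((φ : Fock) (n + 1)) ((ψ : Fock) (n + 1)) :=
    fun n => inner_creN_creN_succ hh.L hf.L ((φ : Fock) (n + 1)) ((ψ : Fock) (n + 1))
  have h2 : (inner ℂ (annQ hf φ) (annQ hh ψ) : ℂ) =
      ∑' n, (inner ℂ (annQ hf φ n) (annQ hh ψ n) : ℂ) := lp.inner_eq_tsum _ _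
  rw [Fock.inner_eq_zero_add, creQ_zero, inner_zero_left, zero_add, hs.tsum_eq_zero_add, h0,
    tsum_congr h1, hs3.tsum_add (hs2.mul_left _), tsum_mul_left, h2,
    Fock.inner_eq_zero_add (φ : Fock) (ψ : Fock)]
  ring

theorem norm_creQ_sq (ψ : Q) :
    ‖creQ hh ψ‖ ^ 2 = ‖annQ hh ψ‖ ^ 2 + ‖hh.L‖ ^ 2 * ‖(ψ : Fock)‖ ^ 2 := by
  have := inner_creQ_creQ hh hh ψ ψ
  simp only [inner_self_eq_norm_sq_to_K] at this
  exact_mod_cast this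

/-- A vector `χ` of components `a(h)x` pairs with `φ` as `a*(h)φ` does with `x`. -/
theorem inner_creQ_of_forall (φ : Q) {x χ : Fock} (hx : ∀ n, χ n = annN hh.L (x (n + 1))) :
    inner ℂ (creQ hh φ) x = inner ℂ (φ : Fock) χ := by
  rw [Fock.inner_eq_zero_add, creQ_zero, inner_zero_left, zero_add, lp.inner_eq_tsum (φ : Fock)]
  simp only [creQ_succ, inner_creN_left, hx]

theorem inner_creQ_left (φ ψ : Q) :
    inner ℂ (creQ hh φ) (ψ : Fock) = inner ℂ (φ : Fock) (annQ hh ψ) :=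
  inner_creQ_of_forall hh φ fun _ => rfl

theorem inner_creQ_annQ (φ ψ : Q) :
    inner ℂ (creQ hf φ) (annQ hh ψ) = inner ℂ (creQ hh φ) (annQ hf ψ) := by
  rw [Fock.inner_eq_zero_add, Fock.inner_eq_zero_add, creQ_zero, creQ_zero, inner_zero_left,
    inner_zero_left]
  congr 1
  refine tsum_congr fun n => ?_
  rw [creQ_succ, creQ_succ, annQ_apply, annQ_apply, inner_creN_left, inner_creN_left, annN_comm]

theorem mem_graph_annih {ψ χ : Fock} :
    (ψ, χ) ∈ (annih h).graph ↔ ∀ n, χ n = annN hh.L (ψ (n + 1)) := by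
  have hconj : ∀ n, ∀ x : Fin n → R3,
      (fun k => conj (hh.L k) * wave ψ (n + 1) (addBoson k x)) =ᵐ[volume]
        fun k => conj (h k) * wave ψ (n + 1) (addBoson k x) := fun n x => by
    filter_upwards [hh.coe_L] with k hk
    rw [hk]
  unfold annih
  rw [Submodule.toLinearPMap_graph_eq]
  · refine forall_congr' fun n => ?_
    have h1 := coe_annN_ae hh.L (ψ (n + 1))
    constructor
    · rintro ⟨-, h2⟩
      refine Subtype.ext (Lp.ext (h2.trans ?_))
      filter_upwards [h1] with x h3
      rw [h3]
      congr 1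
      exact integral_congr_ae (hconj n x).symm
    · intro h2
      constructor
      · filter_upwards [integrable_contr hh.L (ψ (n + 1) : L2n (n + 1))] with x hx
        exact hx.congr (hconj n x)
      · have h4 : wave χ n = ((annN hh.L (ψ (n + 1)) : symL2 n) : L2n n) := by rw [← h2]
        change wave χ n =ᵐ[volume] _
        rw [h4]
        filter_upwards [h1] with x h3
        rw [h3]
        congr 1
        exact integral_congr_ae (hconj n x)
  · rintro ⟨ψ, χ⟩ hg h0
    change ψ = 0 at h0
    subst h0
    refine Fock.ext_wave fun n => ?_
    filter_upwards [(hg n).2, wave_zero n, ae_addBoson (wave_zero (n + 1))] with x h1 h2 h3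
    change wave χ n x = _ at h1
    rw [h1, h2, integral_eq_zero_of_ae, mul_zero]
    · rfl
    · filter_upwards [h3] with k hk
      simp only [hk, Pi.zero_apply, mul_zero]

theorem annQ_mem_graph (ψ : Q) : ((ψ : Fock), annQ hh ψ) ∈ (annih h).graph :=
  (mem_graph_annih hh).2 fun _ => rfl

theorem fieldH_domain_le_Q : fieldH.domain ≤ Q := fun ψ hψ => by
  obtain ⟨ρ, hρ⟩ := exists_mem_graph_fieldHSqrt (fieldH.mem_graph ⟨ψ, hψ⟩)
  exact LinearPMap.mem_domain_of_mem_graph hρ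

theorem dense_Q : Dense (Q : Set Fock) := dense_domain_fieldH.mono fieldH_domain_le_Q

theorem Good.dense_domain_annih {h : R3 → ℂ} (hh : Good h) :
    Dense ((annih h).domain : Set Fock) :=
  dense_Q.mono fun ψ hψ => LinearPMap.mem_domain_of_mem_graph (annQ_mem_graph hh ⟨ψ, hψ⟩)

theorem creQ_mem_graph (ψ : Q) : ((ψ : Fock), creQ hh ψ) ∈ (annih h)†.graph := by
  have h1 : ∀ x : (annih h).domain,
      inner ℂ (creQ hh ψ) (x : Fock) = inner ℂ (ψ : Fock) (annih h x) :=
    fun x => inner_creQ_of_forall hh ψ ((mem_graph_annih hh).1 ((annih h).mem_graph x))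
  have h2 : (ψ : Fock) ∈ (annih h)†.domain := LinearPMap.mem_adjoint_domain_of_exists _ ⟨_, h1⟩
  have h3 := LinearPMap.adjoint_apply_eq hh.dense_domain_annih ⟨(ψ : Fock), h2⟩ h1
  have h4 := (annih h)†.mem_graph ⟨(ψ : Fock), h2⟩
  rw [h3] at h4
  exact h4

theorem annQ_add (ψ : Q) : annQ (hh.add hf) ψ = annQ hh ψ + annQ hf ψ :=
  lp.ext (funext fun n => annN_add hh.L hf.L ((ψ : Fock) (n + 1)))

theorem annQ_smul (c : ℂ) (ψ : Q) : annQ (hh.smul c) ψ = conj c • annQ hh ψ :=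
  lp.ext (funext fun n => annN_smul c hh.L ((ψ : Fock) (n + 1)))

theorem creQ_add (ψ : Q) : creQ (hh.add hf) ψ = creQ hh ψ + creQ hf ψ := by
  refine lp.ext (funext fun n => ?_)
  cases n with
  | zero => exact (add_zero (0 : symL2 0)).symm
  | succ n => exact creN_add hh.L hf.L ((ψ : Fock) n)

theorem creQ_smul (c : ℂ) (ψ : Q) : creQ (hh.smul c) ψ = c • creQ hh ψ := by
  refine lp.ext (funext fun n => ?_)
  cases n with
  | zero => exact (smul_zero c : c • (0 : symL2 0) = 0).symm
  | succ n => exact creN_smul c hh.L ((ψ : Fock) n)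

/-- The commutator of `H_f` with `a(h)`: `⟨a*(h)φ, H_f ψ⟩ = ⟨H_f φ, a(h)ψ⟩ + ⟨φ, a(ωh)ψ⟩`. -/
theorem inner_creQ_fieldH {hω : R3 → ℂ} (hhω : Good hω) (he : ∀ k, hω k = (‖k‖ : ℂ) * h k)
    {φ ψ : Q} {φ' ψ' : Fock} (hφ : ((φ : Fock), φ') ∈ fieldH.graph)
    (hψ : ((ψ : Fock), ψ') ∈ fieldH.graph) :
    inner ℂ (creQ hh φ) ψ' = inner ℂ φ' (annQ hh ψ) + inner ℂ (φ : Fock) (annQ hhω ψ) := by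
  rw [mem_graph_fieldH] at hφ hψ
  rw [Fock.inner_eq_zero_add, creQ_zero, inner_zero_left, zero_add, lp.inner_eq_tsum,
    lp.inner_eq_tsum, ← (lp.summable_inner _ _).tsum_add (lp.summable_inner _ _)]
  refine tsum_congr fun n => ?_
  rw [creQ_succ, inner_creN_left, annQ_apply, annQ_apply]
  simp only [Submodule.coe_inner, L2.inner_def]
  rw [← integral_add (L2.integrable_inner _ _) (L2.integrable_inner _ _)]
  refine integral_congr_ae ?_
  filter_upwards [coe_annN_ae hh.L (ψ' (n + 1)), coe_annN_ae hh.L ((ψ : Fock) (n + 1)),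
    coe_annN_ae hhω.L ((ψ : Fock) (n + 1)), hφ n, ae_addBoson (hψ (n + 1)),
    integrable_contr hh.L ((ψ : Fock) (n + 1) : L2n (n + 1)),
    integrable_contr hhω.L ((ψ : Fock) (n + 1) : L2n (n + 1))] with x h1 h2 h3 h4 h5 h6 h7
  change wave φ' n x = _ at h4
  simp only [RCLike.inner_apply]
  rw [h1, h2, h3, show ((φ' n : symL2 n) : L2n n) x = wave φ' n x from rfl, h4]
  have h8 : ∫ k : R3, conj (hh.L k) * (ψ' (n + 1) : L2n (n + 1)) (addBoson k x) =
      ((∑ i, ‖x i‖ : ℝ) : ℂ) *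
        (∫ k : R3, conj (hh.L k) * ((ψ : Fock) (n + 1) : L2n (n + 1)) (addBoson k x)) +
      ∫ k : R3, conj (hhω.L k) * ((ψ : Fock) (n + 1) : L2n (n + 1)) (addBoson k x) := by
    rw [← integral_const_mul, ← integral_add (h6.const_mul _) h7]
    refine integral_congr_ae ?_
    filter_upwards [h5, hh.coe_L, hhω.coe_L] with k h9 h10 h11
    rw [show (ψ' (n + 1) : L2n (n + 1)) (addBoson k x) = wave ψ' (n + 1) (addBoson k x) from rfl,
      h9,
      h10, h11, he, Fin.sum_univ_succ]
    simp only [addBoson, Fin.cons_zero, Fin.cons_succ, map_mul, Complex.conj_ofReal,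
      Complex.ofReal_add]
    ring
  rw [h8, map_mul, Complex.conj_ofReal]
  ring

theorem L2n.norm_sq {n : ℕ} (v : L2n n) : ‖v‖ ^ 2 = ∫ y, ‖v y‖ ^ 2 := by
  have := inner_self_eq_norm_sq_to_K (𝕜 := ℂ) v
  rw [L2.inner_def] at this
  simp only [inner_self_eq_norm_sq_to_K] at this
  have h2 := integral_ofReal (𝕜 := ℂ) (μ := volume) (f := fun y => ‖v y‖ ^ 2)
  push_cast at h2
  rw [h2] at this
  exact_mod_cast this.symm

theorem L2R3.norm_sq (v : L2R3) : ‖v‖ ^ 2 = ∫ y, ‖v y‖ ^ 2 := by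
  have := inner_self_eq_norm_sq_to_K (𝕜 := ℂ) v
  rw [L2.inner_def] at this
  simp only [inner_self_eq_norm_sq_to_K] at this
  have h2 := integral_ofReal (𝕜 := ℂ) (μ := volume) (f := fun y => ‖v y‖ ^ 2)
  push_cast at h2
  rw [h2] at this
  exact_mod_cast this.symm

end FockOps

/-! ### Weak decay of the annihilation operators and the point-wise annihilation operator -/

section Decay

variable {h : R3 → ℂ} (hh : Good h)

theorem integral_norm_sq_slice {n : ℕ} (ψ : L2n (n + 1)) :
    Integrable fun x : Fin n → R3 => ∫ k : R3, ‖ψ (addBoson k x)‖ ^ 2 := by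
  have h1 : Integrable fun y => ‖ψ y‖ ^ 2 := (Lp.memLp ψ).integrable_norm_pow two_ne_zero
  exact (integrable_addBoson_iff.2 h1).integral_prod_left

theorem norm_integral_mul_le (u : L2R3) {v : R3 → ℂ} (hv : MemLp v 2) :
    ‖∫ k, conj (u k) * v k‖ ^ 2 ≤ ‖u‖ ^ 2 * ∫ k, ‖v k‖ ^ 2 := by
  have h1 : ∫ k, conj (u k) * v k = inner ℂ u (hv.toLp v) := by
    rw [L2.inner_def]
    refine integral_congr_ae ?_
    filter_upwards [hv.coeFn_toLp] with k hk
    rw [hk, RCLike.inner_apply, mul_comm]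
  have h2 : ∫ k, ‖v k‖ ^ 2 = ‖hv.toLp v‖ ^ 2 := by
    rw [L2R3.norm_sq]
    refine integral_congr_ae ?_
    filter_upwards [hv.coeFn_toLp] with k hk
    rw [hk]
  rw [h1, h2, ← mul_pow]
  exact pow_le_pow_left₀ (norm_nonneg _) (norm_inner_le_norm _ _) 2

/-- By the Riemann–Lebesgue lemma in the radial variable, the contraction against `h_t` tends
to `0` strongly. -/
theorem tendsto_contr_freeEvol {F : Filter ℝ} [F.IsCountablyGenerated] (hF : F ≤ cocompact ℝ)
    {n : ℕ} (ψ : L2n (n + 1)) :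
    Tendsto (fun t => ‖contr (hh.freeEvol t).L ψ‖ ^ 2) F (𝓝 0) := by
  have h0 : ∀ t, ‖contr (hh.freeEvol t).L ψ‖ ^ 2 =
      ∫ x : Fin n → R3, ‖∫ k : R3, conj ((hh.freeEvol t).L k) * ψ (addBoson k x)‖ ^ 2 := by
    intro t
    rw [L2n.norm_sq]
    refine integral_congr_ae ?_
    filter_upwards [coe_contr (hh.freeEvol t).L ψ] with x hx
    rw [hx]
  simp only [h0]
  rw [← integral_zero (Fin n → R3) ℝ]
  refine tendsto_integral_filter_of_dominated_convergence
    (fun x => ‖hh.L‖ ^ 2 * ∫ k : R3, ‖ψ (addBoson k x)‖ ^ 2) ?_ ?_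
    ((integral_norm_sq_slice ψ).const_mul _) ?_
  · refine Eventually.of_forall fun t => ?_
    exact (((Lp.aestronglyMeasurable _).congr (coe_contr (hh.freeEvol t).L ψ)).norm.pow 2)
  · refine Eventually.of_forall fun t => ?_
    filter_upwards [memLp_slice ψ] with x hx
    rw [Real.norm_of_nonneg (by positivity)]
    refine (norm_integral_mul_le _ hx).trans ?_
    gcongr
    exact hh.norm_L_freeEvol_le t
  · filter_upwards [integrable_contr hh.L ψ] with x hx
    have h1 : ∀ t, ∫ k : R3, conj ((hh.freeEvol t).L k) * ψ (addBoson k x) =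
        ∫ k : R3, Complex.exp (Complex.I * t * ‖k‖) * (conj (hh.L k) * ψ (addBoson k x)) := by
      intro t
      refine integral_congr_ae ?_
      filter_upwards [hh.coe_L, (hh.freeEvol t).coe_L] with k h2 h3
      rw [h2, h3, SpinBoson.freeEvol, map_mul, ← Complex.exp_conj]
      simp only [map_neg, map_mul, Complex.conj_I, Complex.conj_ofReal, neg_mul, neg_neg]
      ring
    simp only [h1]
    simpa using ((tendsto_integral_phase hx).mono_left hF).norm.pow 2

theorem norm_annN_sq (u : L2R3) {n : ℕ} (φ : symL2 (n + 1)) :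
    ‖annN u φ‖ ^ 2 = ((n : ℝ) + 1) * ‖contr u (φ : L2n (n + 1))‖ ^ 2 := by
  have h1 : ‖annN u φ‖ = ‖(√(n + 1 : ℝ) : ℂ) • contr u (φ : L2n (n + 1))‖ := rfl
  rw [h1, norm_smul, mul_pow, Complex.norm_real,
    Real.norm_of_nonneg (Real.sqrt_nonneg _), Real.sq_sqrt (by positivity)]

/-- The annihilation operators `a(h_t)` tend to `0` strongly on `D(H_f^{1/2})`. -/
theorem tendsto_annQ_freeEvol {F : Filter ℝ} [F.IsCountablyGenerated] (hF : F ≤ cocompact ℝ)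
    (ψ : Q) : Tendsto (fun t => annQ (hh.freeEvol t) ψ) F (𝓝 0) := by
  have h1 : Tendsto (fun t => ‖annQ (hh.freeEvol t) ψ‖ ^ 2) F (𝓝 0) := by
    have h2 : ∀ t, ‖annQ (hh.freeEvol t) ψ‖ ^ 2 =
        ∑' n, ‖annN (hh.freeEvol t).L ((ψ : Fock) (n + 1))‖ ^ 2 := fun t => Fock.norm_sq _
    simp only [h2]
    rw [← tsum_zero (α := ℝ) (β := ℕ)]
    refine tendsto_tsum_of_dominated_convergence
      (bound := fun n => ‖hh.W‖ ^ 2 * ‖sqQ ψ (n + 1)‖ ^ 2)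
      (((summable_nat_add_iff (f := fun n => ‖sqQ ψ n‖ ^ 2) 1).2
        (sqQ ψ).summable_norm_sq).mul_left _) (fun n => ?_)
      (Eventually.of_forall fun t n => ?_)
    · have h3 : ∀ t, ‖annN (hh.freeEvol t).L ((ψ : Fock) (n + 1))‖ ^ 2 =
          ((n : ℝ) + 1) * ‖contr (hh.freeEvol t).L ((ψ : Fock) (n + 1) : L2n (n + 1))‖ ^ 2 := by
        intro t
        exact norm_annN_sq _ _
      simp only [h3]
      simpa using (tendsto_contr_freeEvol hh hF ((ψ : Fock) (n + 1) : L2n (n + 1))).const_mul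
        ((n : ℝ) + 1)
    · rw [Real.norm_of_nonneg (by positivity), ← mul_pow]
      refine pow_le_pow_left₀ (norm_nonneg _)
        ((norm_annN_Q_le (hh.freeEvol t) ψ n).trans ?_) 2
      gcongr
      exact hh.norm_W_freeEvol_le t
  rw [tendsto_zero_iff_norm_tendsto_zero]
  have h2 := h1.sqrt
  simpa only [Real.sqrt_sq (norm_nonneg _), Real.sqrt_zero] using h2

theorem integrable_tsum {α : Type*} [MeasurableSpace α] {μ : Measure α} {F : ℕ → α → ℂ}
    (hF : ∀ n, Integrable (F n) μ) (hs : Summable fun n => ∫ a, ‖F n a‖ ∂μ) :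
    Integrable (fun a => ∑' n, F n a) μ := by
  have h1 : ∑' n, ∫⁻ a, ‖F n a‖ₑ ∂μ ≠ ⊤ := by
    have h2 : ∀ n, ∫⁻ a, ‖F n a‖ₑ ∂μ = ENNReal.ofReal (∫ a, ‖F n a‖ ∂μ) := fun n => by
      rw [ofReal_integral_norm_eq_lintegral_enorm (hF n)]
    simp only [h2]
    exact hs.tsum_ofReal_ne_top
  have h3 : ∫⁻ a, ∑' n, ‖F n a‖ₑ ∂μ ≠ ⊤ := by
    rwa [lintegral_tsum fun n => (hF n).1.enorm]
  have h4 : ∀ᵐ a ∂μ, Summable fun n => F n a := by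
    filter_upwards [ae_lt_top' (AEMeasurable.tsum fun n => (hF n).1.enorm) h3] with a ha
    refine Summable.of_norm ?_
    have h5 : ∑' n, ((‖F n a‖₊ : NNReal) : ℝ≥0∞) ≠ ⊤ := ha.ne
    exact NNReal.summable_coe.2 (ENNReal.tsum_coe_ne_top_iff_summable.1 h5)
  refine ⟨aestronglyMeasurable_of_tendsto_ae atTop
    (f := fun N a => ∑ n ∈ Finset.range N, F n a) (fun N => ?_) ?_, ?_⟩
  · exact Finset.aestronglyMeasurable_fun_sum _ fun n _ => (hF n).1
  · filter_upwards [h4] with a ha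
    exact ha.hasSum.tendsto_sum_nat
  · refine lt_of_le_of_lt (lintegral_mono fun a => ?_) h3.lt_top
    exact enorm_tsum_le_tsum_enorm

theorem integral_norm_mul_le {α : Type*} [MeasurableSpace α] {μ : Measure α}
    {u v : α → ℂ} (hu : MemLp u 2 μ) (hv : MemLp v 2 μ) :
    ∫ a, ‖u a‖ * ‖v a‖ ∂μ ≤ ‖hu.toLp u‖ * ‖hv.toLp v‖ := by
  have h1 : ∫ a, ‖u a‖ * ‖v a‖ ∂μ = inner ℝ (hv.norm.toLp _) (hu.norm.toLp _) := by
    rw [L2.inner_def]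
    refine integral_congr_ae ?_
    filter_upwards [hu.norm.coeFn_toLp, hv.norm.coeFn_toLp] with a h2 h3
    rw [h2, h3]
    simp
  rw [h1, mul_comm]
  refine (real_inner_le_norm _ _).trans (le_of_eq ?_)
  simp only [Lp.norm_toLp, eLpNorm_norm]

/-- The quadratic form of the point-wise creation operator on Fock space. -/
def pointForm (k : R3) (Φ Ψ : Fock) : ℂ :=
  ∑' n : ℕ, ∫ x : Fin n → R3,
    conj ((√(n + 1 : ℝ) : ℂ) * wave Φ (n + 1) (addBoson k x)) * wave Ψ n x

theorem integrable_pointForm_term {h : R3 → ℂ} (hh : Good h) (n : ℕ) (φ : symL2 (n + 1))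
    (ψ : L2n n) :
    Integrable (fun p : (Fin n → R3) × R3 => h p.2 *
      (conj ((√(n + 1 : ℝ) : ℂ) * (φ : L2n (n + 1)) (addBoson p.2 p.1)) * ψ p.1))
      (volume.prod volume) := by
  have h1 := ((inner_tens_left hh.L ψ (φ : L2n (n + 1))).1.const_mul (√(n + 1 : ℝ) : ℂ))
  have h2 := Complex.conjLIE.toContinuousLinearEquiv.toContinuousLinearMap.integrable_comp h1
  refine h2.congr ?_
  have h3 : ∀ᵐ p : (Fin n → R3) × R3 ∂(volume.prod volume), hh.L p.2 = h p.2 :=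
    Measure.quasiMeasurePreserving_snd.ae hh.coe_L
  filter_upwards [h3] with p hp
  simp [hp]
  ring

/-- `‖h |k|^{-1/2}‖ ‖H_f^{1/2} Φ‖ ‖Ψ‖` controls each term of the form
`∫ h(k) ⟨a(k) Φ, Ψ⟩ dk`. -/
theorem integral_norm_pointForm_term_le (n : ℕ) (φ : symL2 (n + 1)) (ψ : L2n n)
    {ρ : L2n (n + 1)}
    (hρ : ρ =ᵐ[volume] fun y => ((√(∑ i, ‖y i‖) : ℝ) : ℂ) * (φ : L2n (n + 1)) y) :
    ∫ p : (Fin n → R3) × R3, ‖h p.2 *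
      (conj ((√(n + 1 : ℝ) : ℂ) * (φ : L2n (n + 1)) (addBoson p.2 p.1)) * ψ p.1)‖
        ∂(volume.prod volume) ≤ ‖hh.W‖ * ‖ρ‖ * ‖ψ‖ := by
  obtain ⟨χ, hχ, hn⟩ := sum_norm_weight hρ
  have h1 := integral_norm_mul_le (Lp.memLp (tens hh.W ψ)) (Lp.memLp χ)
  have hi : Integrable fun y => ‖tens hh.W ψ y‖ * ‖χ y‖ :=
    (Lp.memLp (tens hh.W ψ)).norm.integrable_mul (Lp.memLp χ).norm
  rw [Lp.toLp_coeFn, Lp.toLp_coeFn, norm_tens,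
    ← (measurePreserving_consEquiv (n := n)).integral_comp' , coe_consEquiv] at h1
  have h2 : √((n : ℝ) + 1) * ‖χ‖ = ‖ρ‖ := by
    rw [← Real.sqrt_sq (norm_nonneg ρ), ← hn, Real.sqrt_mul (by positivity),
      Real.sqrt_sq (norm_nonneg χ)]
  calc _ = ∫ p : (Fin n → R3) × R3, √((n : ℝ) + 1) *
        (‖tens hh.W ψ (addBoson p.2 p.1)‖ * ‖χ (addBoson p.2 p.1)‖) ∂(volume.prod volume) := by
        refine integral_congr_ae ?_
        have q := (measurePreserving_addBoson n).quasiMeasurePreserving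
        have h3 : ∀ᵐ p : (Fin n → R3) × R3 ∂(volume.prod volume),
          hh.L p.2 = h p.2 ∧ hh.W p.2 = hh.L p.2 / (√‖p.2‖ : ℝ) ∧ p.2 ≠ 0 :=
          Measure.quasiMeasurePreserving_snd.ae
            (hh.coe_L.and (hh.coe_W.and ae_ne_zero))
        filter_upwards [q.ae (coe_tens hh.W ψ), q.ae hχ, h3] with p h4 h5 h6
        obtain ⟨h6, h7, h8⟩ := h6
        have h9 : √‖p.2‖ ≠ 0 := (Real.sqrt_pos.2 (norm_pos_iff.2 h8)).ne'
        rw [h4, h5]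
        simp only [addBoson, Fin.cons_zero, Fin.tail_cons, norm_mul, Complex.norm_real,
          RCLike.norm_conj,
          Real.norm_of_nonneg (Real.sqrt_nonneg _), h7, h6, norm_div]
        field_simp
    _ = √((n : ℝ) + 1) * ∫ p : (Fin n → R3) × R3,
        (‖tens hh.W ψ (addBoson p.2 p.1)‖ * ‖χ (addBoson p.2 p.1)‖) ∂(volume.prod volume) :=
        integral_const_mul _ _
    _ ≤ √((n : ℝ) + 1) * (‖hh.W‖ * ‖ψ‖ * ‖χ‖) := by gcongr
    _ = _ := by rw [← h2]; ring

theorem norm_mul_conj_summable (Φ : Q) (Ψ : Fock) :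
    Summable fun n => ‖hh.W‖ * ‖sqQ Φ (n + 1)‖ * ‖Ψ n‖ := by
  have h1 := (summable_nat_add_iff (f := fun n => ‖sqQ Φ n‖ ^ 2) 1).2 (sqQ Φ).summable_norm_sq
  refine Summable.of_nonneg_of_le (fun n => by positivity) (fun n => ?_)
    ((h1.add Ψ.summable_norm_sq).mul_left ‖hh.W‖)
  rw [mul_assoc]
  refine mul_le_mul_of_nonneg_left ?_ (norm_nonneg _)
  nlinarith [sq_nonneg (‖sqQ Φ (n + 1)‖ - ‖Ψ n‖), sq_nonneg ‖sqQ Φ (n + 1)‖, sq_nonneg ‖Ψ n‖]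

/-- `a*(h) = ∫ h(k) a(k)* dk` in the sense of forms. -/
theorem integral_mul_pointForm (Φ : Q) (Ψ : Fock) :
    Integrable (fun k => h k * pointForm k Φ Ψ) ∧
      ∫ k, h k * pointForm k Φ Ψ = inner ℂ (annQ hh Φ) Ψ := by
  set F : ℕ → R3 → ℂ := fun n k => ∫ x : Fin n → R3, h k *
    (conj ((√(n + 1 : ℝ) : ℂ) * wave (Φ : Fock) (n + 1) (addBoson k x)) * wave Ψ n x) with hF
  have hint := fun n => integrable_pointForm_term hh n ((Φ : Fock) (n + 1)) (Ψ n : L2n n)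
  have h1 : ∀ n, Integrable (F n) := fun n => (hint n).integral_prod_right
  have h2 : ∀ n, ∫ k, ‖F n k‖ ≤ ‖hh.W‖ * ‖sqQ Φ (n + 1)‖ * ‖Ψ n‖ := fun n => by
    refine le_trans ?_
      (integral_norm_pointForm_term_le hh n ((Φ : Fock) (n + 1)) (Ψ n : L2n n) (wave_sqQ Φ (n + 1)))
    rw [integral_prod_symm _ (hint n).norm]
    exact integral_mono (h1 n).norm (hint n).norm.integral_prod_right
      fun k => norm_integral_le_integral_norm _
  have h3 : Summable fun n => ∫ k, ‖F n k‖ :=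
    Summable.of_nonneg_of_le (fun n => integral_nonneg fun k => norm_nonneg _) h2
      (norm_mul_conj_summable hh Φ Ψ)
  have h4 : (fun k => h k * pointForm k Φ Ψ) = fun k => ∑' n, F n k := by
    funext k
    rw [pointForm, ← tsum_mul_left]
    refine tsum_congr fun n => ?_
    exact (integral_const_mul _ _).symm
  rw [h4]
  refine ⟨integrable_tsum h1 h3, ?_⟩
  rw [← integral_tsum_of_summable_integral_norm h1 h3]
  refine Eq.trans (tsum_congr fun n => ?_) (lp.inner_eq_tsum (annQ hh Φ) Ψ).symm
  have h5 : ∫ k, F n k = inner ℂ ((annN hh.L ((Φ : Fock) (n + 1)) : symL2 n) : L2n n)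
      (Ψ n : L2n n) := by
    rw [hF, ← integral_prod_symm _ (hint n), integral_prod _ (hint n), L2.inner_def]
    refine integral_congr_ae ?_
    filter_upwards [coe_annN_ae hh.L ((Φ : Fock) (n + 1))] with x hx
    rw [RCLike.inner_apply, hx, ← integral_const_mul, ← integral_conj, ← integral_const_mul]
    refine integral_congr_ae ?_
    filter_upwards [hh.coe_L] with k hk
    simp only [hk, map_mul, Complex.conj_conj, Complex.conj_ofReal]
    ring
  exact h5

end Decay

/-! ### Test functions and the form factor -/

section TestFunctions

variable {h f l : R3 → ℂ}

/-- Multiplication by a function that is smooth off the origin preserves test functions. -/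
theorem IsTest.mul (hh : IsTest h) {m : R3 → ℂ} (hm : ∀ k ≠ 0, ContDiffAt ℝ ∞ m k) :
    IsTest fun k => h k * m k := by
  refine ⟨contDiff_iff_contDiffAt.2 fun k => ?_, hh.2.1.mul_right, fun h0 => hh.2.2 ?_⟩
  · by_cases hk : k = 0
    · subst hk
      refine (contDiffAt_const (c := (0 : ℂ))).congr_of_eventuallyEq ?_
      filter_upwards [notMem_tsupport_iff_eventuallyEq.1 hh.2.2] with k hk
      rw [hk, Pi.zero_apply, zero_mul]
    · exact hh.1.contDiffAt.mul (hm k hk)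
  · exact tsupport_mul_subset_left h0

theorem contDiffAt_ofReal_norm {k : R3} (hk : k ≠ 0) :
    ContDiffAt ℝ ∞ (fun k : R3 => ((‖k‖ : ℝ) : ℂ)) k :=
  Complex.ofRealCLM.contDiff.contDiffAt.comp k (contDiffAt_norm ℝ hk)

theorem IsTest.freeEvol (hh : IsTest h) (t : ℝ) : IsTest (freeEvol h t) :=
  hh.mul fun k hk => by
    have := (contDiffAt_ofReal_norm hk)
    fun_prop

theorem IsTest.norm_mul (hh : IsTest h) : IsTest fun k => (‖k‖ : ℂ) * h k := by
  simpa only [mul_comm] using hh.mul fun k hk => contDiffAt_ofReal_norm hk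

theorem IsTest.conj (hh : IsTest h) : IsTest fun k => conj (h k) := by
  have h0 : tsupport (fun k => (starRingEnd ℂ) (h k)) ⊆ tsupport h :=
    tsupport_comp_subset (g := fun z => (starRingEnd ℂ) z) (map_zero _) h
  exact ⟨Complex.conjCLE.contDiff.comp hh.1, hh.2.1.comp_left (map_zero _),
    fun h1 => hh.2.2 (h0 h1)⟩

theorem IsTest.memLp (hh : IsTest h) : MemLp h 2 volume :=
  hh.1.continuous.memLp_of_hasCompactSupport hh.2.1

theorem IsTest.good (hh : IsTest h) : Good h := by
  refine ⟨hh.memLp, ?_⟩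
  have h1 : IsTest fun k => h k * (((√‖k‖)⁻¹ : ℝ) : ℂ) := hh.mul fun k hk =>
    Complex.ofRealCLM.contDiff.contDiffAt.comp k
      (((contDiffAt_norm ℝ hk).sqrt (norm_ne_zero_iff.2 hk)).inv
        (Real.sqrt_ne_zero'.2 (norm_pos_iff.2 hk)))
  refine h1.memLp.congr_norm ?_ ?_
  · simpa only [div_eq_mul_inv, Complex.ofReal_inv] using h1.memLp.1
  · exact Eventually.of_forall fun k => by simp [div_eq_mul_inv]

theorem contDiffAt_formFactor (Λ μ : ℝ) {k : R3} (hk : k ≠ 0) :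
    ContDiffAt ℝ ∞ (fun k => (formFactor Λ μ k : ℂ)) k := by
  refine Complex.ofRealCLM.contDiff.contDiffAt.comp k ?_
  change ContDiffAt ℝ ∞ (fun k : R3 => Real.exp (-‖k‖ ^ 2 / Λ ^ 2) * ‖k‖ ^ (-(1 / 2) + μ)) k
  refine ContDiffAt.mul ?_ ((contDiffAt_norm ℝ hk).rpow_const_of_ne (norm_ne_zero_iff.2 hk))
  exact (((contDiffAt_norm ℝ hk).pow 2).neg.div_const _).exp

theorem integrable_norm_rpow_mul_exp {a b : ℝ} (ha : -3 < a) (hb : 0 < b) :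
    Integrable fun k : R3 => ‖k‖ ^ a * Real.exp (-b * ‖k‖ ^ 2) := by
  rw [integrable_fun_norm_addHaar volume (f := fun r => r ^ a * Real.exp (-b * r ^ 2))]
  have h1 : IntegrableOn (fun r : ℝ => r ^ (a + 2) * Real.exp (-b * r ^ 2)) (Ioi 0) :=
    (integrable_rpow_mul_exp_neg_mul_sq hb (by linarith)).integrableOn
  refine h1.congr_fun (fun r hr => ?_) measurableSet_Ioi
  have hr : 0 < r := hr
  simp only [finrank_euclideanSpace, Fintype.card_fin, smul_eq_mul]
  rw [Real.rpow_add hr, show (2 : ℝ) = ((2 : ℕ) : ℝ) by norm_num, Real.rpow_natCast]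
  ring

theorem measurable_formFactor (Λ μ : ℝ) : Measurable (formFactor Λ μ) := by
  unfold formFactor
  fun_prop

/-- Near `0` the square of `|k|^{-1/2} f` is of order `|k|^{-2 + 2μ}`, which is integrable in three
dimensions. -/
theorem good_formFactor {Λ μ : ℝ} (hΛ : 0 < Λ) (hμ : 0 < μ) :
    Good fun k => (formFactor Λ μ k : ℂ) := by
  have hm : Measurable fun k => (formFactor Λ μ k : ℂ) :=
    Complex.measurable_ofReal.comp (measurable_formFactor Λ μ)
  have hb : (0 : ℝ) < 2 / Λ ^ 2 := by positivity
  have h2 : ∀ k : R3, k ≠ 0 → formFactor Λ μ k ^ 2 =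
      ‖k‖ ^ (-1 + 2 * μ) * Real.exp (-(2 / Λ ^ 2) * ‖k‖ ^ 2) := fun k hk => by
    have hk : 0 < ‖k‖ := norm_pos_iff.2 hk
    rw [formFactor, mul_pow, ← Real.exp_nat_mul, ← Real.rpow_natCast (‖k‖ ^ _),
      ← Real.rpow_mul hk.le,
      mul_comm]
    congr 2
    · push_cast; ring
    · push_cast; ring
  constructor
  · rw [memLp_two_iff_integrable_sq_norm hm.aestronglyMeasurable]
    refine (integrable_norm_rpow_mul_exp (a := -1 + 2 * μ) (by linarith) hb).congr ?_
    filter_upwards [ae_ne_zero] with k hk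
    rw [Complex.norm_real, Real.norm_eq_abs, sq_abs, h2 k hk]
  · rw [memLp_two_iff_integrable_sq_norm]
    · refine (integrable_norm_rpow_mul_exp (a := -2 + 2 * μ) (by linarith) hb).congr ?_
      filter_upwards [ae_ne_zero] with k hk
      have hk' : 0 < ‖k‖ := norm_pos_iff.2 hk
      rw [norm_div, Complex.norm_real, Complex.norm_real, div_pow, Real.norm_eq_abs,
        Real.norm_eq_abs, sq_abs, sq_abs, Real.sq_sqrt hk'.le, h2 k hk,
        show -2 + 2 * μ = (-1 + 2 * μ) - 1 by ring, Real.rpow_sub_one hk'.ne']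
      ring
    · exact (hm.div (by fun_prop)).aestronglyMeasurable

theorem shellFn_eq (f h l : R3 → ℂ) : shellFn f h l =
    fun k => l k * radialDensity (fun k => conj (h k) * f k) ‖k‖ := by
  funext k
  rw [shellFn, radialDensity]
  split_ifs with hk
  · ring
  · rw [le_antisymm (not_lt.1 hk) (norm_nonneg k)]
    simp

theorem IsTest.conj_mul (hh : IsTest h) (hf : ∀ k ≠ 0, ContDiffAt ℝ ∞ f k) :
    IsTest fun k => (starRingEnd ℂ) (h k) * f k :=
  hh.conj.mul hf

theorem isTest_shellFn (hh : IsTest h) (hl : IsTest l) (hf : ∀ k ≠ 0, ContDiffAt ℝ ∞ f k) :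
    IsTest (shellFn f h l) := by
  rw [shellFn_eq]
  exact hl.mul fun k hk => (contDiff_radialDensity (hh.conj_mul hf)).contDiffAt.comp k
    (contDiffAt_norm ℝ hk)

end TestFunctions

/-! ### Dependence of the annihilation and creation operators on time -/

section TimeDependence

theorem Good.norm_L_le {u v : R3 → ℂ} (hu : Good u) (hv : Good v) {C : ℝ}
    (h : ∀ k, ‖u k‖ ≤ C * ‖v k‖) : ‖hu.L‖ ≤ C * ‖hv.L‖ := by
  refine Lp.norm_le_mul_norm_of_ae_le_mul ?_
  filter_upwards [hu.coe_L, hv.coe_L] with k h1 h2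
  rw [h1, h2]
  exact h k

theorem Good.norm_W_le {u v : R3 → ℂ} (hu : Good u) (hv : Good v) {C : ℝ}
    (h : ∀ k, ‖u k‖ ≤ C * ‖v k‖) : ‖hu.W‖ ≤ C * ‖hv.W‖ := by
  refine Lp.norm_le_mul_norm_of_ae_le_mul ?_
  filter_upwards [hu.memW.coeFn_toLp, hv.memW.coeFn_toLp] with k h1 h2
  rw [Good.W, Good.W, h1, h2, norm_div, norm_div, ← mul_div_assoc]
  gcongr
  exact h k

theorem norm_creQ_le {u : R3 → ℂ} (hu : Good u) (ψ : Q) :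
    ‖creQ hu ψ‖ ≤ ‖hu.W‖ * ‖sqQ ψ‖ + ‖hu.L‖ * ‖(ψ : Fock)‖ := by
  rw [← sq_le_sq₀ (norm_nonneg _) (by positivity), norm_creQ_sq]
  have h1 := pow_le_pow_left₀ (norm_nonneg _) (norm_annQ_le hu ψ) 2
  nlinarith [show 0 ≤ ‖hu.W‖ * ‖sqQ ψ‖ * (‖hu.L‖ * ‖(ψ : Fock)‖) by positivity]

theorem freeEvol_apply (h : R3 → ℂ) (t : ℝ) (k : R3) :
    freeEvol h t k = h k * Complex.exp (-(Complex.I * t * ‖k‖)) := rfl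

theorem norm_exp_neg_phase (t r : ℝ) : ‖Complex.exp (-(Complex.I * t * r))‖ = 1 := by
  rw [Complex.norm_exp]; simp

theorem norm_freeEvol_sub_le (h : R3 → ℂ) (s t : ℝ) (k : R3) :
    ‖freeEvol h s k - freeEvol h t k‖ ≤ |s - t| * ‖(‖k‖ : ℂ) * h k‖ := by
  have h1 : freeEvol h s k - freeEvol h t k = h k * Complex.exp (-(Complex.I * t * ‖k‖)) *
      (Complex.exp (Complex.I * ((-(s - t) * ‖k‖ : ℝ) : ℂ)) - 1) := by
    rw [mul_sub, mul_assoc, ← Complex.exp_add, freeEvol_apply, freeEvol_apply]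
    push_cast
    ring_nf
  rw [h1, norm_mul, norm_mul, norm_exp_neg_phase, mul_one, norm_mul, Complex.norm_real, norm_norm]
  have h2 := Real.norm_exp_I_mul_ofReal_sub_one_le (x := -(s - t) * ‖k‖)
  rw [norm_mul, norm_neg, norm_norm, Real.norm_eq_abs] at h2
  calc _ ≤ ‖h k‖ * (|s - t| * ‖k‖) := by gcongr
    _ = _ := by ring

theorem norm_exp_I_sub_one_sub_le (x : ℝ) :
    ‖Complex.exp (Complex.I * x) - 1 - Complex.I * x‖ ≤ 2 * x ^ 2 := by
  have hx : ‖Complex.I * x‖ = |x| := by simp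
  rcases le_total |x| 1 with h1 | h1
  · have h2 := Complex.norm_exp_sub_one_sub_id_le (x := Complex.I * x) (by rwa [hx])
    rw [hx, sq_abs] at h2
    nlinarith [sq_nonneg x]
  · have h2 := Real.norm_exp_I_mul_ofReal_sub_one_le (x := x)
    rw [Real.norm_eq_abs] at h2
    have h3 := norm_sub_le (Complex.exp (Complex.I * x) - 1) (Complex.I * x)
    rw [hx] at h3
    nlinarith [sq_abs x]

theorem norm_freeEvol_sub_sub_le (h : R3 → ℂ) (s t : ℝ) (k : R3) :
    ‖freeEvol h s k + (-1 * freeEvol h t k +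
      (Complex.I * (s - t)) * freeEvol (fun k => (‖k‖ : ℂ) * h k) t k)‖ ≤
      (2 * (s - t) ^ 2) * ‖(‖k‖ : ℂ) * ((‖k‖ : ℂ) * h k)‖ := by
  have h1 : freeEvol h s k + (-1 * freeEvol h t k +
      (Complex.I * (s - t)) * freeEvol (fun k => (‖k‖ : ℂ) * h k) t k) =
      h k * Complex.exp (-(Complex.I * t * ‖k‖)) *
      (Complex.exp (Complex.I * ((-(s - t) * ‖k‖ : ℝ) : ℂ)) - 1 -
        Complex.I * ((-(s - t) * ‖k‖ : ℝ) : ℂ)) := by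
    have h2 : Complex.exp (-(Complex.I * s * ‖k‖)) = Complex.exp (-(Complex.I * t * ‖k‖)) *
        Complex.exp (Complex.I * ((-(s - t) * ‖k‖ : ℝ) : ℂ)) := by
      rw [← Complex.exp_add]
      push_cast
      ring_nf
    rw [freeEvol_apply, freeEvol_apply, freeEvol_apply, h2]
    push_cast
    ring
  rw [h1, norm_mul, norm_mul, norm_exp_neg_phase, mul_one, norm_mul, norm_mul, Complex.norm_real,
    norm_norm]
  calc _ ≤ ‖h k‖ * (2 * (-(s - t) * ‖k‖) ^ 2) := by
        gcongr; exact norm_exp_I_sub_one_sub_le _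
    _ = _ := by ring

variable {h hω hωω : R3 → ℂ}

theorem norm_annQ_freeEvol_sub_le (hh : Good h) (h1 : Good fun k => (‖k‖ : ℂ) * h k) (s t : ℝ)
    (ψ : Q) : ‖annQ (hh.freeEvol s) ψ - annQ (hh.freeEvol t) ψ‖ ≤
      |s - t| * (‖h1.W‖ * ‖sqQ ψ‖) := by
  have hu := (hh.freeEvol s).add ((hh.freeEvol t).smul (-1))
  have h2 : annQ (hh.freeEvol s) ψ - annQ (hh.freeEvol t) ψ = annQ hu ψ := by
    rw [annQ_add (hh.freeEvol s) ((hh.freeEvol t).smul (-1)), annQ_smul (hh.freeEvol t)]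
    simp [sub_eq_add_neg]
  rw [h2, ← mul_assoc]
  refine (norm_annQ_le hu ψ).trans ?_
  gcongr
  refine hu.norm_W_le h1 fun k => ?_
  have := norm_freeEvol_sub_le h s t k
  rwa [sub_eq_add_neg, ← neg_one_mul] at this

/-- `(d/dt) a*(h_t) ψ = -i a*((ω h)_t) ψ` in norm, on each fixed `ψ ∈ D(H_f^{1/2})`; the moment
`ω² h` bounds the quadratic remainder. -/
theorem hasDerivAt_creQ_freeEvol (hh : Good h) (h1 : Good fun k => (‖k‖ : ℂ) * h k)
    (h2 : Good fun k => (‖k‖ : ℂ) * ((‖k‖ : ℂ) * h k)) (t : ℝ) (ψ : Q) :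
    HasDerivAt (fun s => creQ (hh.freeEvol s) ψ) (-Complex.I • creQ (h1.freeEvol t) ψ) t := by
  rw [hasDerivAt_iff_isLittleO]
  have key : ∀ s : ℝ, ‖creQ (hh.freeEvol s) ψ - creQ (hh.freeEvol t) ψ -
      (s - t) • (-Complex.I • creQ (h1.freeEvol t) ψ)‖ ≤
      (2 * ‖h2.W‖ * ‖sqQ ψ‖ + 2 * ‖h2.L‖ * ‖(ψ : Fock)‖) * ‖‖s - t‖ ^ 2‖ := by
    intro s
    have hu := (hh.freeEvol s).add
      (((hh.freeEvol t).smul (-1)).add ((h1.freeEvol t).smul (Complex.I * (s - t))))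
    have h3 : creQ (hh.freeEvol s) ψ - creQ (hh.freeEvol t) ψ -
        (s - t) • (-Complex.I • creQ (h1.freeEvol t) ψ) = creQ hu ψ := by
      rw [creQ_add (hh.freeEvol s) (((hh.freeEvol t).smul (-1)).add
        ((h1.freeEvol t).smul (Complex.I * (s - t)))), creQ_add ((hh.freeEvol t).smul (-1))
        ((h1.freeEvol t).smul (Complex.I * (s - t))), creQ_smul (hh.freeEvol t),
        creQ_smul (h1.freeEvol t)]
      have h4 : ∀ x : Fock, (s - t) • x = ((s : ℂ) - t) • x := fun x => by
        rw [← Complex.ofReal_sub]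
        exact (Complex.coe_smul (s - t) x).symm
      rw [h4]
      module
    rw [h3]
    refine (norm_creQ_le hu ψ).trans ?_
    have h4 := hu.norm_W_le h2 fun k => norm_freeEvol_sub_sub_le h s t k
    have h5 := hu.norm_L_le h2 fun k => norm_freeEvol_sub_sub_le h s t k
    rw [norm_pow, norm_norm, Real.norm_eq_abs, sq_abs]
    calc _ ≤ 2 * (s - t) ^ 2 * ‖h2.W‖ * ‖sqQ ψ‖ + 2 * (s - t) ^ 2 * ‖h2.L‖ * ‖(ψ : Fock)‖ := by
          gcongr
      _ = _ := by ring
  exact (Asymptotics.IsBigO.of_bound _ (Eventually.of_forall key)).trans_isLittleO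
    (Asymptotics.isLittleO_pow_sub_sub t one_lt_two)

theorem inner_freeEvol_L {f : R3 → ℂ} (hh : Good h) (hf : Good f) (t : ℝ) :
    inner ℂ (hh.freeEvol t).L hf.L = radialFourier (fun k => conj (h k) * f k) t := by
  rw [L2.inner_def, radialFourier]
  refine integral_congr_ae ?_
  filter_upwards [(hh.freeEvol t).coe_L, hf.coe_L] with k h1 h2
  rw [RCLike.inner_apply, h1, h2, freeEvol_apply, map_mul, ← Complex.exp_conj]
  simp only [map_neg, map_mul, Complex.conj_I, Complex.conj_ofReal, neg_mul, neg_neg]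
  ring

end TimeDependence

/-! ### Field operators on `ℂ² ⊗ Fock` -/

section Lift

theorem Hilb.inner_eq (ψ φ : Hilb) : inner ℂ ψ φ = inner ℂ (ψ 0) (φ 0) + inner ℂ (ψ 1) (φ 1) := by
  rw [PiLp.inner_apply, Fin.sum_univ_two]

theorem Hilb.norm_sq (ψ : Hilb) : ‖ψ‖ ^ 2 = ‖ψ 0‖ ^ 2 + ‖ψ 1‖ ^ 2 := by
  rw [PiLp.norm_sq_eq_of_L2, Fin.sum_univ_two]

theorem Hilb.ext {ψ φ : Hilb} (h0 : ψ 0 = φ 0) (h1 : ψ 1 = φ 1) : ψ = φ := by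
  ext1 i
  fin_cases i
  exacts [h0, h1]

theorem graph_snd_unique {X : Type*} [AddCommGroup X] [Module ℂ X] {A : X →ₗ.[ℂ] X} {x y z : X}
    (h : (x, y) ∈ A.graph) (h' : (x, z) ∈ A.graph) : y = z :=
  A.mem_graph_snd_inj h h' rfl

theorem mem_graph_fieldOp {A : Fock →ₗ.[ℂ] Fock} {ψ χ : Hilb} :
    (ψ, χ) ∈ (fieldOp A).graph ↔ ∀ i, (ψ i, χ i) ∈ A.graph := by
  unfold fieldOp
  rw [Submodule.toLinearPMap_graph_eq]
  · rfl
  · rintro ⟨ψ, χ⟩ hg h0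
    change ψ = 0 at h0
    subst h0
    ext1 i
    exact graph_snd_unique (hg i) A.graph.zero_mem

theorem mem_domain_iff_exists {X : Type*} [AddCommGroup X] [Module ℂ X] {A : X →ₗ.[ℂ] X} {x : X} :
    x ∈ A.domain ↔ ∃ y, (x, y) ∈ A.graph :=
  ⟨fun h => ⟨_, A.mem_graph ⟨x, h⟩⟩, fun ⟨_, h⟩ => LinearPMap.mem_domain_of_mem_graph h⟩

theorem mem_domain_fieldOp {A : Fock →ₗ.[ℂ] Fock} {ψ : Hilb} :
    ψ ∈ (fieldOp A).domain ↔ ∀ i, ψ i ∈ A.domain := by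
  simp only [mem_domain_iff_exists, mem_graph_fieldOp]
  constructor
  · rintro ⟨χ, h⟩ i
    exact ⟨_, h i⟩
  · intro h
    choose χ hχ using h
    exact ⟨WithLp.toLp 2 χ, hχ⟩

/-- The form domain `ℂ² ⊗ D(H_f^{1/2})`. -/
abbrev QH : Submodule ℂ Hilb := (fieldOp fieldHSqrt).domain

/-- The `i`-th spin component of a vector of the form domain. -/
def QH.comp (i : Fin 2) : QH →ₗ[ℂ] Q where
  toFun ψ := ⟨(ψ : Hilb) i, mem_domain_fieldOp.1 ψ.2 i⟩
  map_add' _ _ := rfl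
  map_smul' _ _ := rfl

theorem QH.coe_comp (i : Fin 2) (ψ : QH) : (QH.comp i ψ : Fock) = (ψ : Hilb) i := rfl

/-- `1 ⊗ T` for a linear map `T` on `D(H_f^{1/2})`. -/
def liftQ (T : Q →ₗ[ℂ] Fock) : QH →ₗ[ℂ] Hilb where
  toFun ψ := WithLp.toLp 2 fun i => T (QH.comp i ψ)
  map_add' ψ φ := by ext1 i; exact map_add T (QH.comp i ψ) (QH.comp i φ)
  map_smul' c ψ := by ext1 i; exact map_smul T c (QH.comp i ψ)

theorem liftQ_apply (T : Q →ₗ[ℂ] Fock) (ψ : QH) (i : Fin 2) : liftQ T ψ i = T (QH.comp i ψ) := rfl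

/-- `1 ⊗ H_f^{1/2}`. -/
def sqH : QH →ₗ[ℂ] Hilb := liftQ sqQ

variable {h f : R3 → ℂ} (hh : Good h) (hf : Good f)

/-- `1 ⊗ a(h)` on the form domain. -/
def annH : QH →ₗ[ℂ] Hilb := liftQ (annQ hh)

/-- `1 ⊗ a*(h)` on the form domain. -/
def creH : QH →ₗ[ℂ] Hilb := liftQ (creQ hh)

theorem sqH_apply (ψ : QH) (i : Fin 2) : sqH ψ i = sqQ (QH.comp i ψ) := rfl

theorem annH_apply (ψ : QH) (i : Fin 2) : annH hh ψ i = annQ hh (QH.comp i ψ) := rfl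

theorem creH_apply (ψ : QH) (i : Fin 2) : creH hh ψ i = creQ hh (QH.comp i ψ) := rfl

theorem norm_annH_le (ψ : QH) : ‖annH hh ψ‖ ≤ ‖hh.W‖ * ‖sqH ψ‖ := by
  rw [← sq_le_sq₀ (norm_nonneg _) (by positivity), mul_pow, Hilb.norm_sq, Hilb.norm_sq (sqH ψ),
    mul_add, ← mul_pow, ← mul_pow]
  exact add_le_add (pow_le_pow_left₀ (norm_nonneg _) (norm_annQ_le hh _) 2)
    (pow_le_pow_left₀ (norm_nonneg _) (norm_annQ_le hh _) 2)

/-- The canonical commutation relations. -/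
theorem inner_creH_creH (φ ψ : QH) : inner ℂ (creH hh φ) (creH hf ψ) =
    inner ℂ (annH hf φ) (annH hh ψ) + inner ℂ hh.L hf.L * inner ℂ (φ : Hilb) (ψ : Hilb) := by
  rw [Hilb.inner_eq, Hilb.inner_eq (annH hf φ), Hilb.inner_eq (φ : Hilb)]
  simp only [annH_apply, creH_apply, inner_creQ_creQ, QH.coe_comp]
  ring

theorem norm_creH_sq (ψ : QH) :
    ‖creH hh ψ‖ ^ 2 = ‖annH hh ψ‖ ^ 2 + ‖hh.L‖ ^ 2 * ‖(ψ : Hilb)‖ ^ 2 := by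
  have := inner_creH_creH hh hh ψ ψ
  simp only [inner_self_eq_norm_sq_to_K] at this
  exact_mod_cast this

theorem norm_creH_le (ψ : QH) :
    ‖creH hh ψ‖ ≤ ‖hh.W‖ * ‖sqH ψ‖ + ‖hh.L‖ * ‖(ψ : Hilb)‖ := by
  rw [← sq_le_sq₀ (norm_nonneg _) (by positivity), norm_creH_sq]
  have h1 := pow_le_pow_left₀ (norm_nonneg _) (norm_annH_le hh ψ) 2
  nlinarith [show 0 ≤ ‖hh.W‖ * ‖sqH ψ‖ * (‖hh.L‖ * ‖(ψ : Hilb)‖) by positivity]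

theorem inner_creH_left (φ ψ : QH) :
    inner ℂ (creH hh φ) (ψ : Hilb) = inner ℂ (φ : Hilb) (annH hh ψ) := by
  rw [Hilb.inner_eq, Hilb.inner_eq (φ : Hilb)]
  exact congrArg₂ (· + ·) (inner_creQ_left hh (QH.comp 0 φ) (QH.comp 0 ψ))
    (inner_creQ_left hh (QH.comp 1 φ) (QH.comp 1 ψ))

theorem inner_creH_right (φ ψ : QH) :
    inner ℂ (ψ : Hilb) (creH hh φ) = inner ℂ (annH hh ψ) (φ : Hilb) := by
  rw [← inner_conj_symm, inner_creH_left, inner_conj_symm]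

/-- The adjoint relation between `a*(h)` and the maximal `a(h)`. -/
theorem inner_creH_of_mem_graph (φ : QH) {x χ : Hilb} (hx : (x, χ) ∈ (fieldOp (annih h)).graph) :
    inner ℂ (creH hh φ) x = inner ℂ (φ : Hilb) χ := by
  rw [mem_graph_fieldOp] at hx
  rw [Hilb.inner_eq, Hilb.inner_eq (φ : Hilb)]
  simp only [creH_apply, inner_creQ_of_forall hh _ ((mem_graph_annih hh).1 (hx _)), QH.coe_comp]

theorem inner_creH_annH (φ ψ : QH) :
    inner ℂ (creH hf φ) (annH hh ψ) = inner ℂ (creH hh φ) (annH hf ψ) := by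
  rw [Hilb.inner_eq, Hilb.inner_eq (creH hh φ)]
  simp only [annH_apply, creH_apply, inner_creQ_annQ hh hf]

theorem annH_mem_graph (ψ : QH) : ((ψ : Hilb), annH hh ψ) ∈ (fieldOp (annih h)).graph :=
  mem_graph_fieldOp.2 fun i => annQ_mem_graph hh (QH.comp i ψ)

theorem creH_mem_graph (ψ : QH) : ((ψ : Hilb), creH hh ψ) ∈ (fieldOp (annih h)†).graph :=
  mem_graph_fieldOp.2 fun i => creQ_mem_graph hh (QH.comp i ψ)

/-- `a(h)` with its maximal domain is closed. -/
theorem mem_graph_annih_of_tendsto {h : R3 → ℂ} (hh : Good h) {ι : Type*} {F : Filter ι} [F.NeBot]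
    {ψ χ : ι → Hilb}
    {ψ₀ χ₀ : Hilb} (hg : ∀ j, (ψ j, χ j) ∈ (fieldOp (annih h)).graph)
    (hψ : Tendsto ψ F (𝓝 ψ₀)) (hχ : Tendsto χ F (𝓝 χ₀)) :
    (ψ₀, χ₀) ∈ (fieldOp (annih h)).graph := by
  rw [mem_graph_fieldOp]
  intro i
  rw [mem_graph_annih hh]
  intro n
  have hc : ∀ m, Continuous fun x : Hilb => ((x i : Fock) m : symL2 m) := fun m =>
    (lp.evalCLM ℂ (fun n => symL2 n) 2 m).continuous.comp (PiLp.continuous_apply 2 _ i)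
  refine tendsto_nhds_unique (((hc n).tendsto _).comp hχ) ?_
  refine ((((annN hh.L).continuous.comp (hc (n + 1))).tendsto _).comp hψ).congr fun j => ?_
  exact ((mem_graph_annih hh).1 (mem_graph_fieldOp.1 (hg j) i) n).symm

theorem tendsto_annH_freeEvol {F : Filter ℝ} [F.IsCountablyGenerated] (hF : F ≤ cocompact ℝ)
    (ψ : QH) : Tendsto (fun t => annH (hh.freeEvol t) ψ) F (𝓝 0) := by
  have h0 := fun i => tendsto_annQ_freeEvol hh hF (QH.comp i ψ)
  have h1 : Tendsto (fun t => ‖annH (hh.freeEvol t) ψ‖ ^ 2) F (𝓝 0) := by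
    simp only [Hilb.norm_sq, annH_apply]
    simpa using ((h0 0).norm.pow 2).add ((h0 1).norm.pow 2)
  rw [tendsto_zero_iff_norm_tendsto_zero]
  simpa only [Real.sqrt_sq (norm_nonneg _), Real.sqrt_zero] using h1.sqrt

theorem norm_annH_freeEvol_sub_le (h1 : Good fun k => (‖k‖ : ℂ) * h k) (s t : ℝ) (ψ : QH) :
    ‖annH (hh.freeEvol s) ψ - annH (hh.freeEvol t) ψ‖ ≤ |s - t| * (‖h1.W‖ * ‖sqH ψ‖) := by
  rw [← sq_le_sq₀ (norm_nonneg _) (by positivity), mul_pow, mul_pow, Hilb.norm_sq,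
    Hilb.norm_sq (sqH ψ), mul_add, mul_add, ← mul_pow, ← mul_pow, ← mul_pow, ← mul_pow]
  exact add_le_add
    (pow_le_pow_left₀ (norm_nonneg _) (norm_annQ_freeEvol_sub_le hh h1 s t _) 2)
    (pow_le_pow_left₀ (norm_nonneg _) (norm_annQ_freeEvol_sub_le hh h1 s t _) 2)

theorem hasDerivAt_creH_freeEvol (h1 : Good fun k => (‖k‖ : ℂ) * h k)
    (h2 : Good fun k => (‖k‖ : ℂ) * ((‖k‖ : ℂ) * h k)) (t : ℝ) (ψ : QH) :
    HasDerivAt (fun s => creH (hh.freeEvol s) ψ) (-Complex.I • creH (h1.freeEvol t) ψ) t := by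
  have h3 : HasDerivAt (fun s i => creQ (hh.freeEvol s) (QH.comp i ψ))
      (fun i => -Complex.I • creQ (h1.freeEvol t) (QH.comp i ψ)) t :=
    hasDerivAt_pi.2 fun i => hasDerivAt_creQ_freeEvol hh h1 h2 t (QH.comp i ψ)
  exact (PiLp.continuousLinearEquiv 2 ℝ fun _ : Fin 2 => Fock).symm.hasFDerivAt.comp_hasDerivAt t h3

theorem fieldH_domain_le_QH : (fieldOp fieldH).domain ≤ QH := fun _ hψ =>
  mem_domain_fieldOp.2 fun i => fieldH_domain_le_Q (mem_domain_fieldOp.1 hψ i)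

/-- The commutator of `H_f` with `a(h)`. -/
theorem inner_creH_fieldH (h1 : Good fun k => (‖k‖ : ℂ) * h k) {φ ψ : QH} {φ' ψ' : Hilb}
    (hφ : ((φ : Hilb), φ') ∈ (fieldOp fieldH).graph)
    (hψ : ((ψ : Hilb), ψ') ∈ (fieldOp fieldH).graph) :
    inner ℂ (creH hh φ) ψ' = inner ℂ φ' (annH hh ψ) + inner ℂ (φ : Hilb) (annH h1 ψ) := by
  rw [mem_graph_fieldOp] at hφ hψ
  rw [Hilb.inner_eq, Hilb.inner_eq φ', Hilb.inner_eq (φ : Hilb)]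
  simp only [annH_apply, creH_apply]
  rw [inner_creQ_fieldH hh h1 (fun _ => rfl) (φ := QH.comp 0 φ) (ψ := QH.comp 0 ψ) (hφ 0) (hψ 0),
    inner_creQ_fieldH hh h1 (fun _ => rfl) (φ := QH.comp 1 φ) (ψ := QH.comp 1 ψ) (hφ 1) (hψ 1)]
  simp only [QH.coe_comp]
  ring

theorem inner_sqH_sqH (φ ψ : QH) {ψ' : Hilb} (hψ : ((ψ : Hilb), ψ') ∈ (fieldOp fieldH).graph) :
    inner ℂ (sqH φ) (sqH ψ) = inner ℂ (φ : Hilb) ψ' := by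
  rw [mem_graph_fieldOp] at hψ
  rw [Hilb.inner_eq, Hilb.inner_eq (φ : Hilb)]
  simp only [sqH_apply]
  rw [inner_sqrt_sqrt (sqQ_mem (QH.comp 0 φ)) (sqQ_mem (QH.comp 0 ψ)) (hψ 0),
    inner_sqrt_sqrt (sqQ_mem (QH.comp 1 φ)) (sqQ_mem (QH.comp 1 ψ)) (hψ 1)]
  simp only [QH.coe_comp]

theorem isSymm_fieldOp_fieldH : IsSymm (fieldOp fieldH) := by
  rintro ⟨ψ, ψ'⟩ hψ ⟨φ, φ'⟩ hφ
  rw [mem_graph_fieldOp] at hψ hφ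
  change inner ℂ ψ' φ = inner ℂ ψ φ'
  rw [Hilb.inner_eq, Hilb.inner_eq ψ]
  exact congrArg₂ (· + ·) (isSymm_fieldH _ (hψ 0) _ (hφ 0)) (isSymm_fieldH _ (hψ 1) _ (hφ 1))

theorem tendsto_toLp_cutoff (χ : Hilb) : Tendsto
    (fun j => (WithLp.toLp 2 (fun i => fc (cutoffFun j) (χ i)) : Hilb)) atTop (𝓝 χ) := by
  refine ((PiLp.continuous_toLp 2 _).tendsto _).comp (tendsto_pi_nhds.2 fun i => ?_)
  exact tendsto_fc_cutoff (χ i)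

theorem toLp_cutoff_mem (χ : Hilb) (j : ℕ) :
    WithLp.toLp 2 (fun i => fc (cutoffFun j) (χ i)) ∈ (fieldOp fieldH).domain :=
  mem_domain_fieldOp.2 fun _ => fc_cutoff_mem j _

theorem dense_domain_fieldOp_fieldH : Dense ((fieldOp fieldH).domain : Set Hilb) := fun χ =>
  mem_closure_of_tendsto (tendsto_toLp_cutoff χ) (Eventually.of_forall (toLp_cutoff_mem χ))

/-- The form domain is approximated, in the form norm, by the domain of `H_f`. -/
theorem exists_tendsto_sqH (ψ : QH) : ∃ φ : ℕ → QH, (∀ j, (φ j : Hilb) ∈ (fieldOp fieldH).domain) ∧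
    Tendsto (fun j => (φ j : Hilb)) atTop (𝓝 (ψ : Hilb)) ∧
    Tendsto (fun j => sqH (φ j)) atTop (𝓝 (sqH ψ)) := by
  have hm := toLp_cutoff_mem (ψ : Hilb)
  have hs : ∀ j, sqH ⟨_, fieldH_domain_le_QH (hm j)⟩ =
      WithLp.toLp 2 (fun i => fc (cutoffFun j) (sqH ψ i)) := fun j => by
    ext1 i
    exact graph_snd_unique (sqQ_mem _) (fc_mem_graph_fieldHSqrt _ (sqQ_mem (QH.comp i ψ)))
  refine ⟨fun j => ⟨_, fieldH_domain_le_QH (hm j)⟩, hm, tendsto_toLp_cutoff _, ?_⟩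
  simp only [hs]
  exact tendsto_toLp_cutoff _

theorem sigma1_apply_zero (ψ : Hilb) : sigma1 ψ 0 = ψ 1 := by
  simp [sigma1, spinOp, Fin.sum_univ_two]

theorem sigma1_apply_one (ψ : Hilb) : sigma1 ψ 1 = ψ 0 := by
  simp [sigma1, spinOp, Fin.sum_univ_two]

theorem norm_sigma1 (ψ : Hilb) : ‖sigma1 ψ‖ = ‖ψ‖ := by
  rw [← sq_eq_sq₀ (norm_nonneg _) (norm_nonneg _), Hilb.norm_sq, Hilb.norm_sq, sigma1_apply_zero,
    sigma1_apply_one, add_comm]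

theorem inner_sigma1_left (φ ψ : Hilb) : inner ℂ (sigma1 φ) ψ = inner ℂ φ (sigma1 ψ) := by
  rw [Hilb.inner_eq, Hilb.inner_eq, sigma1_apply_zero, sigma1_apply_one, sigma1_apply_zero,
    sigma1_apply_one, add_comm]

theorem sigma1_mem_domain {A : Fock →ₗ.[ℂ] Fock} {ψ : Hilb} (hψ : ψ ∈ (fieldOp A).domain) :
    sigma1 ψ ∈ (fieldOp A).domain := by
  rw [mem_domain_fieldOp] at hψ ⊢
  intro i
  fin_cases i
  · change sigma1 ψ 0 ∈ _
    rw [sigma1_apply_zero]; exact hψ 1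
  · change sigma1 ψ 1 ∈ _
    rw [sigma1_apply_one]; exact hψ 0

theorem liftQ_sigma1 (T : Q →ₗ[ℂ] Fock) (ψ : QH) :
    liftQ T ⟨sigma1 ψ, sigma1_mem_domain ψ.2⟩ = sigma1 (liftQ T ψ) := by
  refine Hilb.ext ?_ ?_
  · rw [sigma1_apply_zero, liftQ_apply, liftQ_apply]
    congr 1
    exact Subtype.ext (sigma1_apply_zero _)
  · rw [sigma1_apply_one, liftQ_apply, liftQ_apply]
    congr 1
    exact Subtype.ext (sigma1_apply_one _)

theorem annH_sigma1 (ψ : QH) : annH hh ⟨sigma1 ψ, sigma1_mem_domain ψ.2⟩ = sigma1 (annH hh ψ) :=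
  liftQ_sigma1 _ ψ

theorem creH_sigma1 (ψ : QH) : creH hh ⟨sigma1 ψ, sigma1_mem_domain ψ.2⟩ = sigma1 (creH hh ψ) :=
  liftQ_sigma1 _ ψ

/-- The quadratic form of the point-wise creation operator integrates to `a*(h)`. -/
theorem integral_mul_creatForm (Φ : QH) (Ψ : Hilb) :
    Integrable (fun k => h k * creatForm k Φ Ψ) ∧
      ∫ k, h k * creatForm k Φ Ψ = inner ℂ (annH hh Φ) Ψ := by
  have h0 : (fun k => h k * creatForm k Φ Ψ) = fun k =>
      h k * pointForm k (QH.comp 0 Φ) (Ψ 0) + h k * pointForm k (QH.comp 1 Φ) (Ψ 1) := by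
    funext k
    rw [creatForm, Fin.sum_univ_two, mul_add]
    rfl
  have h1 := fun i => integral_mul_pointForm hh (QH.comp i Φ) (Ψ i)
  rw [h0]
  refine ⟨(h1 0).1.add (h1 1).1, ?_⟩
  rw [integral_add (h1 0).1 (h1 1).1, (h1 0).2, (h1 1).2, Hilb.inner_eq]
  rfl

end Lift

attribute [irreducible] sqH annH creH

/-! ### Self-adjointness of the Hamiltonian -/

section Hamiltonian

section LinearPMapGraph

variable {X : Type*} [AddCommGroup X] [Module ℂ X] {A B : X →ₗ.[ℂ] X} {x y z : X}

theorem add_mem_graph (h : (x, y) ∈ A.graph) (h' : (x, z) ∈ B.graph) :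
    (x, y + z) ∈ (A + B).graph := by
  obtain ⟨⟨a, ha⟩, h1, h2⟩ := (A.mem_graph_iff).1 h
  obtain ⟨⟨b, hb⟩, h3, h4⟩ := (B.mem_graph_iff).1 h'
  simp only at h1 h2 h3 h4
  subst h1 h3 h2 h4
  exact (A + B).mem_graph ⟨b, ha, hb⟩

theorem smul_mem_graph (c : ℂ) (h : (x, y) ∈ A.graph) : (x, c • y) ∈ (c • A).graph := by
  obtain ⟨⟨a, ha⟩, h1, h2⟩ := (A.mem_graph_iff).1 h
  simp only at h1 h2
  subst h1 h2
  exact (c • A).mem_graph ⟨a, ha⟩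

theorem compPMap_mem_graph (L : X →ₗ[ℂ] X) (h : (x, y) ∈ A.graph) :
    (x, L y) ∈ (L.compPMap A).graph := by
  obtain ⟨⟨a, ha⟩, h1, h2⟩ := (A.mem_graph_iff).1 h
  simp only at h1 h2
  subst h1 h2
  exact (L.compPMap A).mem_graph ⟨a, ha⟩

end LinearPMapGraph

theorem IsSymm.inner_eq {X : Type*} [NormedAddCommGroup X] [InnerProductSpace ℂ X] {A : X →ₗ.[ℂ] X}
    (hA : IsSymm A) {a b c d : X} (h : (a, b) ∈ A.graph) (h' : (c, d) ∈ A.graph) :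
    inner ℂ b c = inner ℂ a d :=
  hA _ h _ h'

theorem exists_add_eq_of_norm_le {X : Type*} [NormedAddCommGroup X] [InnerProductSpace ℂ X]
    [CompleteSpace X] (P : X →ₗ[ℂ] X) (hP : ∀ x, ‖P x‖ ≤ 1 / 2 * ‖x‖) (y : X) :
    ∃ x, x + P x = y := by
  set B : X →L[ℂ] X := LinearMap.mkContinuous (-P) (1 / 2) fun x => by simpa using hP x with hB
  have h2 : ‖B‖ < 1 :=
    lt_of_le_of_lt (LinearMap.mkContinuous_norm_le _ (by norm_num) _) (by norm_num)
  obtain ⟨u, hu⟩ := isUnit_one_sub_of_norm_lt_one h2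
  refine ⟨(↑u⁻¹ : X →L[ℂ] X) y, ?_⟩
  have h4 : (u : X →L[ℂ] X) ((↑u⁻¹ : X →L[ℂ] X) y) = y :=
    congrArg (fun T : X →L[ℂ] X => T y) u.mul_inv
  rw [hu] at h4
  refine Eq.trans ?_ h4
  exact (sub_neg_eq_add _ (P ((↑u⁻¹ : X →L[ℂ] X) y))).symm

/-- The Spin-Boson Hamiltonian with a general form factor `f`. -/
abbrev ham (e₁ g : ℝ) (f : R3 → ℂ) : Hilb →ₗ.[ℂ] Hilb := freeH e₁ + (g : ℂ) • interaction f

/-- The atomic Hamiltonian `K`. -/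
abbrev atomK (e₁ : ℝ) : Hilb →ₗ[ℂ] Hilb := spinOp !![(e₁ : ℂ), 0; 0, 0]

theorem atomK_apply_zero (e₁ : ℝ) (ψ : Hilb) : atomK e₁ ψ 0 = (e₁ : ℂ) • ψ 0 := by
  simp [spinOp, Fin.sum_univ_two]

theorem atomK_apply_one (e₁ : ℝ) (ψ : Hilb) : atomK e₁ ψ 1 = 0 := by
  simp [spinOp, Fin.sum_univ_two]

theorem norm_atomK_le (e₁ : ℝ) (ψ : Hilb) : ‖atomK e₁ ψ‖ ≤ |e₁| * ‖ψ‖ := by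
  rw [← sq_le_sq₀ (norm_nonneg _) (by positivity), mul_pow, Hilb.norm_sq, Hilb.norm_sq ψ,
    atomK_apply_zero, atomK_apply_one, norm_smul, Complex.norm_real, norm_zero, mul_pow,
    Real.norm_eq_abs]
  nlinarith [show 0 ≤ |e₁| ^ 2 * ‖ψ 1‖ ^ 2 by positivity]

theorem inner_atomK_left (e₁ : ℝ) (φ ψ : Hilb) :
    inner ℂ (atomK e₁ φ) ψ = inner ℂ φ (atomK e₁ ψ) := by
  rw [Hilb.inner_eq, Hilb.inner_eq φ, atomK_apply_zero, atomK_apply_one, atomK_apply_zero,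
    atomK_apply_one, inner_zero_left, inner_zero_right, inner_smul_left, inner_smul_right,
    Complex.conj_ofReal]

variable (e₁ g : ℝ) {f h : R3 → ℂ} (hf : Good f) (hh : Good h)

/-- The part `K + gV` of the Hamiltonian, on the form domain of `H_f`. -/
def potH : QH →ₗ[ℂ] Hilb :=
  atomK e₁ ∘ₗ QH.subtype + (g : ℂ) • (sigma1 ∘ₗ (annH hf + creH hf))

theorem potH_apply (ψ : QH) : potH e₁ g hf ψ =
    atomK e₁ ψ + (g : ℂ) • sigma1 (annH hf ψ + creH hf ψ) := rfl

theorem norm_potH_le (ψ : QH) : ‖potH e₁ g hf ψ‖ ≤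
    2 * |g| * ‖hf.W‖ * ‖sqH ψ‖ + (|e₁| + |g| * ‖hf.L‖) * ‖(ψ : Hilb)‖ := by
  rw [potH_apply]
  refine (norm_add_le _ _).trans ?_
  rw [norm_smul, norm_sigma1, Complex.norm_real, Real.norm_eq_abs]
  have h1 := norm_atomK_le e₁ (ψ : Hilb)
  have h2 := mul_le_mul_of_nonneg_left ((norm_add_le (annH hf ψ) (creH hf ψ)).trans
    (add_le_add (norm_annH_le hf ψ) (norm_creH_le hf ψ))) (abs_nonneg g)
  linarith

theorem inner_field_left (φ ψ : QH) : inner ℂ (annH hf φ + creH hf φ) (ψ : Hilb) =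
    inner ℂ (φ : Hilb) (annH hf ψ + creH hf ψ) := by
  rw [inner_add_left, inner_add_right, inner_creH_left, inner_creH_right, add_comm]

/-- `σ₁` on the form domain. -/
def sigmaQ (φ : QH) : QH := ⟨sigma1 φ, sigma1_mem_domain φ.2⟩

theorem coe_sigmaQ (φ : QH) : (sigmaQ φ : Hilb) = sigma1 φ := rfl

attribute [irreducible] sigmaQ

theorem annH_sigmaQ (φ : QH) : annH hf (sigmaQ φ) = sigma1 (annH hf φ) := by
  unfold sigmaQ; exact annH_sigma1 hf φ

theorem creH_sigmaQ (φ : QH) : creH hf (sigmaQ φ) = sigma1 (creH hf φ) := by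
  unfold sigmaQ; exact creH_sigma1 hf φ

theorem inner_interaction_left (φ ψ : QH) :
    inner ℂ (sigma1 (annH hf φ + creH hf φ)) (ψ : Hilb) =
      inner ℂ (φ : Hilb) (sigma1 (annH hf ψ + creH hf ψ)) := by
  rw [map_add, ← annH_sigmaQ, ← creH_sigmaQ, inner_field_left, coe_sigmaQ, inner_sigma1_left]

theorem inner_creH_interaction (φ ψ : QH) :
    inner ℂ (creH hh φ) (sigma1 (annH hf ψ + creH hf ψ)) =
      inner ℂ (sigma1 (annH hf φ + creH hf φ)) (annH hh ψ) +
        inner ℂ hh.L hf.L * inner ℂ (φ : Hilb) (sigma1 ψ) := by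
  have h1 : inner ℂ (φ : Hilb) (sigma1 ψ) = inner ℂ (sigmaQ φ : Hilb) ψ := by
    rw [coe_sigmaQ, inner_sigma1_left]
  rw [← inner_sigma1_left, map_add, ← annH_sigmaQ, ← creH_sigmaQ, ← creH_sigmaQ, h1,
    inner_add_right, inner_add_left, inner_creH_creH, inner_creH_annH hf hh]
  ring

theorem inner_creH_atomK (φ ψ : QH) :
    inner ℂ (creH hh φ) (atomK e₁ ψ) = inner ℂ (atomK e₁ φ) (annH hh ψ) := by
  rw [Hilb.inner_eq, Hilb.inner_eq (atomK e₁ φ), atomK_apply_zero, atomK_apply_one,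
    atomK_apply_zero, atomK_apply_one, inner_zero_left, inner_zero_right, inner_smul_left,
    inner_smul_right, Complex.conj_ofReal, creH_apply, annH_apply]
  exact congrArg (fun z => (e₁ : ℂ) * z + 0) (inner_creQ_left hh (QH.comp 0 φ) (QH.comp 0 ψ))

theorem inner_potH_left (φ ψ : QH) :
    inner ℂ (potH e₁ g hf φ) (ψ : Hilb) = inner ℂ (φ : Hilb) (potH e₁ g hf ψ) := by
  rw [potH_apply, potH_apply, inner_add_left, inner_add_right, inner_atomK_left, inner_smul_left,
    inner_smul_right, Complex.conj_ofReal, inner_interaction_left]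

/-- The commutator of `K + gV` with `a(h)` is `-g ⟨h,f⟩ σ₁`. -/
theorem inner_creH_potH (φ ψ : QH) : inner ℂ (creH hh φ) (potH e₁ g hf ψ) =
    inner ℂ (potH e₁ g hf φ) (annH hh ψ) +
      g * inner ℂ hh.L hf.L * inner ℂ (φ : Hilb) (sigma1 ψ) := by
  rw [potH_apply, potH_apply, inner_add_left, inner_add_right, inner_creH_atomK, inner_smul_left,
    inner_smul_right, Complex.conj_ofReal, inner_creH_interaction]
  ring

/-- The Hamiltonian is `H_f + (K + gV)` on exactly the domain of `H_f`. -/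
theorem mem_graph_ham {ψ χ : Hilb} : (ψ, χ) ∈ (ham e₁ g f).graph ↔
    ∃ (hψ : ψ ∈ QH) (η : Hilb), (ψ, η) ∈ (fieldOp fieldH).graph ∧
      χ = η + potH e₁ g hf ⟨ψ, hψ⟩ := by
  have key : ∀ (hψ : ψ ∈ QH) (η : Hilb), (ψ, η) ∈ (fieldOp fieldH).graph →
      (ψ, η + potH e₁ g hf ⟨ψ, hψ⟩) ∈ (ham e₁ g f).graph := by
    intro hψ η hη
    have h1 : (ψ, atomK e₁ ψ) ∈ ((atomK e₁).toPMap ⊤).graph :=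
      ((atomK e₁).toPMap ⊤).mem_graph ⟨ψ, trivial⟩
    have h2 : (ψ, annH hf ⟨ψ, hψ⟩ + creH hf ⟨ψ, hψ⟩) ∈ (fieldOp (annih f + (annih f)†)).graph :=
      mem_graph_fieldOp.2 fun i => add_mem_graph
        (mem_graph_fieldOp.1 (annH_mem_graph hf ⟨ψ, hψ⟩) i)
        (mem_graph_fieldOp.1 (creH_mem_graph hf ⟨ψ, hψ⟩) i)
    have h3 := add_mem_graph (add_mem_graph h1 hη)
      (smul_mem_graph (g : ℂ) (compPMap_mem_graph sigma1 h2))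
    have h4 : η + potH e₁ g hf ⟨ψ, hψ⟩ = atomK e₁ ψ + η +
        (g : ℂ) • sigma1 (annH hf ⟨ψ, hψ⟩ + creH hf ⟨ψ, hψ⟩) := by
      rw [potH_apply]
      abel
    rw [h4]
    exact h3
  constructor
  · intro h
    have h1 : ψ ∈ (fieldOp fieldH).domain := (LinearPMap.mem_domain_of_mem_graph h).1.2
    obtain ⟨η, hη⟩ := mem_domain_iff_exists.1 h1
    exact ⟨fieldH_domain_le_QH h1, η, hη, graph_snd_unique h (key _ η hη)⟩
  · rintro ⟨hψ, η, hη, rfl⟩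
    exact key hψ η hη

theorem exists_mem_graph_ham (e₁ g : ℝ) {f : R3 → ℂ} (hf : Good f) {ψ : Hilb}
    (hψ : ψ ∈ (fieldOp fieldH).domain) : ∃ χ, (ψ, χ) ∈ (ham e₁ g f).graph := by
  obtain ⟨η, hη⟩ := mem_domain_iff_exists.1 hψ
  exact ⟨_, (mem_graph_ham e₁ g hf).2 ⟨fieldH_domain_le_QH hψ, η, hη, rfl⟩⟩

/-- Two vectors with the same inner products against the domain of `H` are equal. -/
theorem eq_of_inner_ham (e₁ g : ℝ) {f : R3 → ℂ} (hf : Good f) {x y : Hilb}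
    (h : ∀ φ φ', (φ, φ') ∈ (ham e₁ g f).graph → inner ℂ φ x = inner ℂ φ y) : x = y := by
  refine dense_domain_fieldOp_fieldH.eq_of_inner_right ℂ fun v hv => ?_
  obtain ⟨χ, hχ⟩ := exists_mem_graph_ham e₁ g hf hv
  exact h _ _ hχ

theorem inner_ham_left (e₁ g : ℝ) {f : R3 → ℂ} (hf : Good f) {ψ χ φ ζ : Hilb}
    (hψ : (ψ, χ) ∈ (ham e₁ g f).graph)
    (hφ : (φ, ζ) ∈ (ham e₁ g f).graph) : inner ℂ χ φ = inner ℂ ψ ζ := by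
  obtain ⟨h1, η, hη, h3⟩ := (mem_graph_ham e₁ g hf).1 hψ
  obtain ⟨h2, ξ, hξ, h4⟩ := (mem_graph_ham e₁ g hf).1 hφ
  have h5 : inner ℂ η φ = inner ℂ ψ ξ := isSymm_fieldOp_fieldH.inner_eq hη hξ
  have h6 : inner ℂ (potH e₁ g hf ⟨ψ, h1⟩) φ = inner ℂ ψ (potH e₁ g hf ⟨φ, h2⟩) :=
    inner_potH_left e₁ g hf ⟨ψ, h1⟩ ⟨φ, h2⟩
  rw [h3, h4, inner_add_left, inner_add_right, h5, h6]

theorem isSymm_ham (e₁ g : ℝ) {f : R3 → ℂ} (hf : Good f) : IsSymm (ham e₁ g f) := by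
  intro p hp q hq
  exact inner_ham_left e₁ g hf hp hq

theorem norm_sqH_sq (ψ : QH) {η : Hilb} (hη : ((ψ : Hilb), η) ∈ (fieldOp fieldH).graph) :
    ‖sqH ψ‖ ^ 2 = (inner ℂ (ψ : Hilb) η).re := by
  rw [← inner_sqH_sqH ψ ψ hη, inner_self_eq_norm_sq_to_K]
  norm_cast

/-- Absorbing the cross term `2 A s p` into `s²` by completing the square. -/
theorem form_bound_arith {A B s p x q r t : ℝ} (hp : 0 ≤ p)
    (h1 : s ^ 2 = q - r) (h2 : q ≤ p * x) (h3 : -r ≤ p * t) (h4 : t ≤ A * s + B * p) :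
    s ^ 2 ≤ 2 * (p * x) + (A ^ 2 + 2 * B) * p ^ 2 := by
  have h5 := mul_le_mul_of_nonneg_left h4 hp
  nlinarith [sq_nonneg (s - A * p)]

/-- On the domain of `H`, the form of `H_f` is controlled by `H`. -/
theorem exists_norm_sqH_le (e₁ g : ℝ) {f : R3 → ℂ} (hf : Good f) :
    ∃ C, 0 ≤ C ∧ ∀ (ψ : QH) (χ : Hilb), ((ψ : Hilb), χ) ∈ (ham e₁ g f).graph →
      ‖sqH ψ‖ ^ 2 ≤ 2 * (‖(ψ : Hilb)‖ * ‖χ‖) + C * ‖(ψ : Hilb)‖ ^ 2 := by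
  set A := 2 * |g| * ‖hf.W‖
  set B := |e₁| + |g| * ‖hf.L‖
  refine ⟨A ^ 2 + 2 * B, by positivity, fun ψ χ hψ => ?_⟩
  obtain ⟨h1, η, hη, rfl⟩ := (mem_graph_ham e₁ g hf).1 hψ
  set p := potH e₁ g hf ⟨ψ, h1⟩ with hp
  have h2 : ‖p‖ ≤ A * ‖sqH ψ‖ + B * ‖(ψ : Hilb)‖ := norm_potH_le e₁ g hf ψ
  have h3 := norm_sqH_sq ψ hη
  have h4 : inner ℂ (ψ : Hilb) η = inner ℂ (ψ : Hilb) (η + p) - inner ℂ (ψ : Hilb) p := by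
    rw [inner_add_right]; ring
  have h5 := (Complex.re_le_norm _).trans (norm_inner_le_norm (𝕜 := ℂ) (ψ : Hilb) (η + p))
  have h6 := (neg_le_abs _).trans ((Complex.abs_re_le_norm _).trans
    (norm_inner_le_norm (𝕜 := ℂ) (ψ : Hilb) p))
  rw [h4, Complex.sub_re] at h3
  exact form_bound_arith (norm_nonneg _) h3 h5 h6 h2

/-- `(H_f + iκ)⁻¹` as a map into the form domain. -/
def resQ (κ : ℝ) (hκ : κ ≠ 0) : Hilb →ₗ[ℂ] QH where
  toFun ξ := ⟨WithLp.toLp 2 fun i => fc (resolventFun κ hκ) (ξ i), fieldH_domain_le_QH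
    (mem_domain_fieldOp.2 fun i =>
      LinearPMap.mem_domain_of_mem_graph (exists_fieldH_add hκ (ξ i)).1)⟩
  map_add' ξ ζ := Subtype.ext (by ext1 i; exact map_add (fc (resolventFun κ hκ)) (ξ i) (ζ i))
  map_smul' c ξ := Subtype.ext (by ext1 i; exact map_smul (fc (resolventFun κ hκ)) c (ξ i))

theorem resQ_spec {κ : ℝ} (hκ : κ ≠ 0) (ξ : Hilb) : ∃ η, ((resQ κ hκ ξ : Hilb), η) ∈
    (fieldOp fieldH).graph ∧ η + (Complex.I * κ) • (resQ κ hκ ξ : Hilb) = ξ ∧ ‖η‖ ≤ ‖ξ‖ ∧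
    ‖(resQ κ hκ ξ : Hilb)‖ ≤ |κ|⁻¹ * ‖ξ‖ := by
  refine ⟨WithLp.toLp 2 fun i => fc (mulResolventFun κ hκ) (ξ i),
    mem_graph_fieldOp.2 fun i => (exists_fieldH_add hκ (ξ i)).1, ?_, ?_, ?_⟩
  · ext1 i
    exact (exists_fieldH_add hκ (ξ i)).2
  · have h1 : ∀ i, ‖fc (mulResolventFun κ hκ) (ξ i)‖ ≤ 1 * ‖ξ i‖ := fun i => norm_fc_le _ _
    simp only [one_mul] at h1
    rw [← sq_le_sq₀ (norm_nonneg _) (norm_nonneg _), Hilb.norm_sq, Hilb.norm_sq ξ]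
    exact add_le_add (pow_le_pow_left₀ (norm_nonneg _) (h1 0) 2)
      (pow_le_pow_left₀ (norm_nonneg _) (h1 1) 2)
  · have h1 : ∀ i, ‖fc (resolventFun κ hκ) (ξ i)‖ ≤ |κ|⁻¹ * ‖ξ i‖ := fun i => norm_fc_le _ _
    rw [← sq_le_sq₀ (norm_nonneg _) (by positivity), mul_pow, Hilb.norm_sq, Hilb.norm_sq ξ, mul_add,
      ← mul_pow, ← mul_pow]
    exact add_le_add (pow_le_pow_left₀ (norm_nonneg _) (h1 0) 2)
      (pow_le_pow_left₀ (norm_nonneg _) (h1 1) 2)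

/-- Here `s² ≤ p e` is the form bound `‖H_f^{1/2} ψ‖² ≤ ‖ψ‖ ‖H_f ψ‖`, and `p ≤ x / k` makes `A s` a
small multiple of `x` for large `k`. -/
theorem relative_bound_arith {A B k s p e x : ℝ} (hA : 0 ≤ A) (hB : 0 ≤ B)
    (hs : 0 ≤ s) (hp : 0 ≤ p) (hx : 0 ≤ x) (h0 : 16 * A ^ 2 + 4 * B ≤ k) (h1 : s ^ 2 ≤ p * e)
    (h2 : e ≤ x) (h3 : k * p ≤ x) : A * s + B * p ≤ 1 / 2 * x := by
  have h4 : (16 * A ^ 2 + 4 * B) * p ≤ x := (mul_le_mul_of_nonneg_right h0 hp).trans h3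
  have h5 : 0 ≤ A ^ 2 * p := by positivity
  have h6 : 0 ≤ B * p := by positivity
  have h7 : 4 * (A * s) ≤ x := by
    rw [← sq_le_sq₀ (by positivity) hx]
    calc (4 * (A * s)) ^ 2 = 16 * A ^ 2 * s ^ 2 := by ring
      _ ≤ 16 * A ^ 2 * (p * e) := by gcongr
      _ ≤ 16 * A ^ 2 * (p * x) := by gcongr
      _ = (16 * A ^ 2 * p) * x := by ring
      _ ≤ x * x := mul_le_mul_of_nonneg_right (by linarith) hx
      _ = x ^ 2 := by ring
  linarith

/-- The relative bound: `(K + gV)(H_f + iκ)⁻¹` is small for large `κ`. -/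
theorem norm_potH_resQ_le : ∃ κ₀ : ℝ, ∀ (κ : ℝ) (hκ : κ ≠ 0), κ₀ ≤ |κ| → ∀ ξ,
    ‖potH e₁ g hf (resQ κ hκ ξ)‖ ≤ 1 / 2 * ‖ξ‖ := by
  set A := 2 * |g| * ‖hf.W‖
  set B := |e₁| + |g| * ‖hf.L‖
  have hA : 0 ≤ A := by positivity
  have hB : 0 ≤ B := by positivity
  refine ⟨16 * A ^ 2 + 4 * B, fun κ hκ h0 ξ => ?_⟩
  obtain ⟨η, h1, -, h3, h4⟩ := resQ_spec hκ ξ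
  set ψ := resQ κ hκ ξ
  have hp : ‖potH e₁ g hf ψ‖ ≤ A * ‖sqH ψ‖ + B * ‖(ψ : Hilb)‖ := norm_potH_le e₁ g hf ψ
  have hk : 0 < |κ| := abs_pos.2 hκ
  have h5 : ‖sqH ψ‖ ^ 2 ≤ ‖(ψ : Hilb)‖ * ‖η‖ := by
    rw [norm_sqH_sq ψ h1]
    exact (Complex.re_le_norm _).trans (norm_inner_le_norm _ _)
  refine hp.trans (relative_bound_arith hA hB (norm_nonneg _) (norm_nonneg _)
    (norm_nonneg _) h0 h5 h3 ?_)
  rw [inv_mul_eq_div, le_div_iff₀ hk] at h4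
  linarith

/-- Kato–Rellich: `H + in` is onto for large `|n|`, so that `H` generates a unitary group. -/
theorem isUnitaryGroupOf_evolution (e₁ g : ℝ) {f : R3 → ℂ} (hf : Good f) :
    IsUnitaryGroupOf (ham e₁ g f) (evolution (ham e₁ g f)) := by
  obtain ⟨κ₀, h0⟩ := norm_potH_resQ_le e₁ g hf
  refine IsUnitaryGroupOf.evolution ((isSymm_ham e₁ g hf).exists_isUnitaryGroupOf (κ := max κ₀ 1)
    fun n hn η => ?_)
  have hn0 : n ≠ 0 := by
    rintro rfl
    have := (le_max_right κ₀ 1).trans hn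
    simp at this
    linarith
  -- `H + in = (1 + (K + gV)(H_f + in)⁻¹)(H_f + in)`, where the first factor is invertible
  have h1 := h0 n hn0 ((le_max_left _ _).trans hn)
  have h3 : ∃ ξ, ξ + potH e₁ g hf (resQ n hn0 ξ) = η :=
    exists_add_eq_of_norm_le (potH e₁ g hf ∘ₗ resQ n hn0) h1 η
  obtain ⟨ξ, rfl⟩ := h3
  obtain ⟨ζ, h4, h5, -⟩ := resQ_spec hn0 ξ
  refine ⟨((resQ n hn0 ξ : Hilb), ζ + potH e₁ g hf (resQ n hn0 ξ)),
    (mem_graph_ham e₁ g hf).2 ⟨(resQ n hn0 ξ).2, ζ, h4, rfl⟩, ?_⟩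
  change ζ + _ + (Complex.I * n) • (resQ n hn0 ξ : Hilb) = _
  rw [add_right_comm, h5]

end Hamiltonian

/-! ### Heisenberg evolution and Duhamel integrals -/

section Heisenberg

variable {X : Type*} [NormedAddCommGroup X] [InnerProductSpace ℂ X]

theorem hasDerivAt_inner_of_eq_zero {a b : ℝ → X} {a' : X} {t : ℝ} (ha : HasDerivAt a a' t)
    (h0 : a t = 0) (hb : ContinuousAt b t) :
    HasDerivAt (fun s => (inner ℂ (a s) (b s) : ℂ)) (inner ℂ a' (b t)) t := by
  rw [hasDerivAt_iff_tendsto_slope] at ha ⊢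
  have h1 := ha.inner (𝕜 := ℂ) (hb.tendsto.mono_left nhdsWithin_le_nhds)
  refine h1.congr fun s => ?_
  simp only [slope, vsub_eq_sub, h0, sub_zero, inner_zero_left]
  rw [← Complex.coe_smul, inner_smul_left, Complex.conj_ofReal, Complex.real_smul]

variable {A : X →ₗ.[ℂ] X} {U : ℝ → X →L[ℂ] X}

theorem IsUnitaryGroupOf.continuous_apply (hU : IsUnitaryGroupOf A U) {v : ℝ → X}
    (hv : Continuous v) : Continuous fun t => U t (v t) := by
  rw [continuous_iff_continuousAt]
  intro t
  have h1 : Tendsto (fun s => U s (v s - v t)) (𝓝 t) (𝓝 0) := by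
    rw [tendsto_zero_iff_norm_tendsto_zero]
    simp only [hU.norm_map]
    have := ((hv.tendsto t).sub_const (v t)).norm
    simpa using this
  have h2 := h1.add ((hU.continuous (v t)).tendsto t)
  rw [zero_add] at h2
  refine h2.congr fun s => ?_
  rw [← map_add, sub_add_cancel]

/-- The Heisenberg evolution `e^{iτA} S e^{-iτA}` of a bounded operator. -/
def heis (U : ℝ → X →L[ℂ] X) (S : X →L[ℂ] X) (τ : ℝ) : X →L[ℂ] X := (U (-τ)).comp (S.comp (U τ))

theorem heis_apply (U : ℝ → X →L[ℂ] X) (S : X →L[ℂ] X) (τ : ℝ) (ψ : X) :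
    heis U S τ ψ = U (-τ) (S (U τ ψ)) := rfl

variable {S : X →L[ℂ] X}

theorem inner_heis_right (hU : IsUnitaryGroupOf A U) (τ : ℝ) (φ ψ : X) :
    inner ℂ φ (heis U S τ ψ) = inner ℂ (U τ φ) (S (U τ ψ)) := hU.inner_neg_right _ _ _

theorem inner_heis_left (hU : IsUnitaryGroupOf A U) (τ : ℝ) (φ ψ : X) :
    inner ℂ (heis U S τ φ) ψ = inner ℂ (S (U τ φ)) (U τ ψ) := hU.inner_neg_left _ _ _

theorem norm_heis_le (hU : IsUnitaryGroupOf A U) (hS : ∀ ψ, ‖S ψ‖ ≤ ‖ψ‖) (τ : ℝ) (ψ : X) :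
    ‖heis U S τ ψ‖ ≤ ‖ψ‖ := by
  rw [heis_apply, hU.norm_map, ← hU.norm_map τ ψ]
  exact hS _

theorem continuous_heis (hU : IsUnitaryGroupOf A U) (ψ : X) : Continuous fun τ => heis U S τ ψ :=
  (hU.continuous_apply (v := fun τ => S (U (-τ) ψ))
    (S.continuous.comp ((hU.continuous ψ).comp continuous_neg))).comp continuous_neg |>.congr
      fun τ => by simp [heis_apply]

variable {c : ℝ → ℂ}

theorem integrable_smul_heis (hU : IsUnitaryGroupOf A U) (hS : ∀ ψ, ‖S ψ‖ ≤ ‖ψ‖)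
    (hc : Integrable c) (ψ : X) : Integrable fun τ => c τ • heis U S τ ψ :=
  Integrable.mono' (hc.norm.mul_const ‖ψ‖)
    (hc.1.smul (continuous_heis hU ψ).aestronglyMeasurable) (Eventually.of_forall fun τ => by
      rw [norm_smul]
      gcongr
      exact norm_heis_le hU hS τ ψ)

/-- The Duhamel integral `∫₀ᵗ c(τ) e^{iτA} S e^{-iτA} ψ dτ`. -/
def duhamel (U : ℝ → X →L[ℂ] X) (S : X →L[ℂ] X) (c : ℝ → ℂ) (t : ℝ) (ψ : X) : X :=
  ∫ τ in (0 : ℝ)..t, c τ • heis U S τ ψ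

theorem duhamel_sub (hU : IsUnitaryGroupOf A U) (hS : ∀ ψ, ‖S ψ‖ ≤ ‖ψ‖) (hc : Integrable c) (t : ℝ)
    (ψ φ : X) : duhamel U S c t (ψ - φ) = duhamel U S c t ψ - duhamel U S c t φ := by
  unfold duhamel
  rw [← intervalIntegral.integral_sub (integrable_smul_heis hU hS hc ψ).intervalIntegrable
    (integrable_smul_heis hU hS hc φ).intervalIntegrable]
  simp only [map_sub, smul_sub]

theorem norm_duhamel_le (hU : IsUnitaryGroupOf A U) (hS : ∀ ψ, ‖S ψ‖ ≤ ‖ψ‖) (hc : Integrable c)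
    (t : ℝ) (ψ : X) : ‖duhamel U S c t ψ‖ ≤ (∫ τ, ‖c τ‖) * ‖ψ‖ := by
  rw [duhamel, intervalIntegral.norm_intervalIntegral_eq]
  refine (norm_integral_le_integral_norm _).trans ?_
  rw [← integral_mul_const]
  refine (integral_mono_of_nonneg (Eventually.of_forall fun τ => norm_nonneg _)
    (hc.norm.mul_const ‖ψ‖).integrableOn (Eventually.of_forall fun τ => ?_)).trans
    (setIntegral_le_integral (hc.norm.mul_const ‖ψ‖) (Eventually.of_forall fun τ => by positivity))
  simp only [norm_smul]
  gcongr
  exact norm_heis_le hU hS τ ψ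

theorem tendsto_duhamel_apply (hU : IsUnitaryGroupOf A U) (hS : ∀ ψ, ‖S ψ‖ ≤ ‖ψ‖)
    (hc : Integrable c) (t : ℝ) {ψ : ℕ → X} {ψ₀ : X} (hψ : Tendsto ψ atTop (𝓝 ψ₀)) :
    Tendsto (fun j => duhamel U S c t (ψ j)) atTop (𝓝 (duhamel U S c t ψ₀)) := by
  rw [tendsto_iff_norm_sub_tendsto_zero] at hψ ⊢
  refine squeeze_zero (fun j => norm_nonneg _) (fun j => ?_)
    (by simpa using hψ.const_mul (∫ τ, ‖c τ‖))
  rw [← duhamel_sub hU hS hc]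
  exact norm_duhamel_le hU hS hc t _

theorem inner_duhamel_right [CompleteSpace X] (hU : IsUnitaryGroupOf A U) (hS : ∀ ψ, ‖S ψ‖ ≤ ‖ψ‖)
    (hc : Integrable c) (t : ℝ) (φ ψ : X) : inner ℂ φ (duhamel U S c t ψ) =
      ∫ τ in (0 : ℝ)..t, c τ * inner ℂ (U τ φ) (S (U τ ψ)) := by
  have hi := integrable_smul_heis hU hS hc ψ
  simp only [← inner_heis_right hU, ← inner_smul_right]
  rw [duhamel, intervalIntegral, intervalIntegral, inner_sub_right,
    integral_inner hi.integrableOn, integral_inner hi.integrableOn]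

theorem tendsto_duhamel_atTop (hU : IsUnitaryGroupOf A U) (hS : ∀ ψ, ‖S ψ‖ ≤ ‖ψ‖)
    (hc : Integrable c) (ψ : X) : Tendsto (fun t => duhamel U S c t ψ) atTop
      (𝓝 (∫ τ in Ioi (0 : ℝ), c τ • heis U S τ ψ)) :=
  intervalIntegral_tendsto_integral_Ioi 0 (integrable_smul_heis hU hS hc ψ).integrableOn tendsto_id

theorem tendsto_duhamel_atBot (hU : IsUnitaryGroupOf A U) (hS : ∀ ψ, ‖S ψ‖ ≤ ‖ψ‖)
    (hc : Integrable c) (ψ : X) : Tendsto (fun t => duhamel U S c t ψ) atBot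
      (𝓝 (-∫ τ in Iic (0 : ℝ), c τ • heis U S τ ψ)) := by
  have h1 := (intervalIntegral_tendsto_integral_Iic 0
    (integrable_smul_heis hU hS hc ψ).integrableOn tendsto_id).neg
  refine h1.congr fun t => ?_
  rw [duhamel, intervalIntegral.integral_symm t 0]
  rfl

theorem IsUnitaryGroupOf.mem_graph_sub (hU : IsUnitaryGroupOf A U) {ψ χ : X}
    (h : (ψ, χ) ∈ A.graph) (s t : ℝ) : (U s ψ - U t ψ, U s χ - U t χ) ∈ A.graph :=
  A.graph.sub_mem (hU.mem_graph h s) (hU.mem_graph h t)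

end Heisenberg

/-! ### Cook's method -/

section Cook

/-- `σ₁` as a bounded operator. -/
def sigmaL : Hilb →L[ℂ] Hilb := LinearMap.mkContinuous sigma1 1 fun ψ => by
  rw [norm_sigma1, one_mul]

theorem sigmaL_apply (ψ : Hilb) : sigmaL ψ = sigma1 ψ := rfl

theorem norm_sigmaL_le (ψ : Hilb) : ‖sigmaL ψ‖ ≤ ‖ψ‖ := (norm_sigma1 ψ).le

theorem inner_sigmaL_left (φ ψ : Hilb) : inner ℂ (sigmaL φ) ψ = inner ℂ φ (sigmaL ψ) :=
  inner_sigma1_left φ ψ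

attribute [irreducible] sigmaL

variable {e₁ g : ℝ} {f h : R3 → ℂ} (hf : Good f)

theorem mem_QH_of_mem_graph {ψ χ : Hilb} (hψ : (ψ, χ) ∈ (ham e₁ g f).graph) : ψ ∈ QH :=
  fieldH_domain_le_QH (LinearPMap.mem_domain_of_mem_graph hψ).1.2

theorem annH_congr {h h' : R3 → ℂ} (hh : Good h) (hh' : Good h') (e : h = h') (ψ : QH) :
    annH hh ψ = annH hh' ψ := by
  subst e; rfl

theorem creH_congr {h h' : R3 → ℂ} (hh : Good h) (hh' : Good h') (e : h = h') (ψ : QH) :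
    creH hh ψ = creH hh' ψ := by
  subst e; rfl

/-- The commutator of the Hamiltonian with `a(h)`. -/
theorem inner_creH_ham (hf : Good f) (hh : Good h) (h1 : Good fun k => (‖k‖ : ℂ) * h k) {φ ψ : QH}
    {φ' ψ' : Hilb} (hφ : ((φ : Hilb), φ') ∈ (ham e₁ g f).graph)
    (hψ : ((ψ : Hilb), ψ') ∈ (ham e₁ g f).graph) :
    inner ℂ (creH hh φ) ψ' = inner ℂ φ' (annH hh ψ) + inner ℂ (φ : Hilb) (annH h1 ψ) +
      g * inner ℂ hh.L hf.L * inner ℂ (φ : Hilb) (sigmaL ψ) := by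
  obtain ⟨_, η, hη, h3⟩ := (mem_graph_ham e₁ g hf).1 hφ
  obtain ⟨_, ξ, hξ, h4⟩ := (mem_graph_ham e₁ g hf).1 hψ
  rw [h3, h4, inner_add_left, inner_add_right, inner_creH_fieldH hh h1 hη hξ,
    inner_creH_potH e₁ g hf hh, sigmaL_apply]
  ring

variable {U : ℝ → Hilb →L[ℂ] Hilb} (hU : IsUnitaryGroupOf (ham e₁ g f) U)

/-- The orbit of a vector in the domain of `H` as a curve in the form domain. -/
def orbit (hU : IsUnitaryGroupOf (ham e₁ g f) U) {ψ χ : Hilb} (hψ : (ψ, χ) ∈ (ham e₁ g f).graph)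
    (t : ℝ) : QH :=
  ⟨U t ψ, mem_QH_of_mem_graph (hU.mem_graph hψ t)⟩

theorem coe_orbit {ψ χ : Hilb} (hψ : (ψ, χ) ∈ (ham e₁ g f).graph) (t : ℝ) :
    (orbit hU hψ t : Hilb) = U t ψ := rfl

attribute [irreducible] orbit

theorem orbit_mem_graph {ψ χ : Hilb} (hψ : (ψ, χ) ∈ (ham e₁ g f).graph) (t : ℝ) :
    ((orbit hU hψ t : Hilb), U t χ) ∈ (ham e₁ g f).graph := by
  rw [coe_orbit]
  exact hU.mem_graph hψ t

theorem exists_norm_sqH_orbit_le (hf : Good f) {ψ χ : Hilb} (hψ : (ψ, χ) ∈ (ham e₁ g f).graph) :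
    ∃ C, ∀ t, ‖sqH (orbit hU hψ t)‖ ≤ C := by
  obtain ⟨C, -, h1⟩ := exists_norm_sqH_le e₁ g hf
  refine ⟨√(2 * (‖ψ‖ * ‖χ‖) + C * ‖ψ‖ ^ 2), fun t => Real.le_sqrt_of_sq_le ?_⟩
  have h2 := h1 (orbit hU hψ t) _ (orbit_mem_graph hU hψ t)
  rwa [coe_orbit, hU.norm_map, hU.norm_map] at h2

theorem tendsto_sqH_orbit (hf : Good f) {ψ χ : Hilb} (hψ : (ψ, χ) ∈ (ham e₁ g f).graph) (t : ℝ) :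
    Tendsto (fun s => ‖sqH (orbit hU hψ s - orbit hU hψ t)‖) (𝓝 t) (𝓝 0) := by
  obtain ⟨C, -, h1⟩ := exists_norm_sqH_le e₁ g hf
  have h2 : ∀ s, ‖sqH (orbit hU hψ s - orbit hU hψ t)‖ ≤
      √(2 * (‖U s ψ - U t ψ‖ * ‖U s χ - U t χ‖) + C * ‖U s ψ - U t ψ‖ ^ 2) := fun s => by
    refine Real.le_sqrt_of_sq_le ?_
    have h3 : ((orbit hU hψ s - orbit hU hψ t : QH) : Hilb) = U s ψ - U t ψ := by
      rw [Submodule.coe_sub, coe_orbit, coe_orbit]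
    have h4 := h1 (orbit hU hψ s - orbit hU hψ t) (U s χ - U t χ)
      (by rw [h3]; exact hU.mem_graph_sub hψ s t)
    rwa [h3] at h4
  refine squeeze_zero (fun s => norm_nonneg _) h2 ?_
  have h5 : ∀ x : Hilb, Tendsto (fun s => ‖U s x - U t x‖) (𝓝 t) (𝓝 0) := fun x => by
    have := (((hU.continuous x).tendsto t).sub_const (U t x)).norm
    simpa using this
  have h6 := ((((h5 ψ).mul (h5 χ)).const_mul 2).add (((h5 ψ).pow 2).const_mul C)).sqrt
  simpa using h6

theorem continuousAt_annH_orbit (hf : Good f) (hh : Good h) (h1 : Good fun k => (‖k‖ : ℂ) * h k)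
    {ψ χ : Hilb} (hψ : (ψ, χ) ∈ (ham e₁ g f).graph) (t : ℝ) :
    ContinuousAt (fun s => annH (hh.freeEvol s) (orbit hU hψ s)) t := by
  rw [ContinuousAt, tendsto_iff_norm_sub_tendsto_zero]
  have h2 : ∀ s, ‖annH (hh.freeEvol s) (orbit hU hψ s) - annH (hh.freeEvol t) (orbit hU hψ t)‖ ≤
      ‖hh.W‖ * ‖sqH (orbit hU hψ s - orbit hU hψ t)‖ +
        |s - t| * (‖h1.W‖ * ‖sqH (orbit hU hψ t)‖) := fun s => by
    have h3 : annH (hh.freeEvol s) (orbit hU hψ s) - annH (hh.freeEvol t) (orbit hU hψ t) =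
        annH (hh.freeEvol s) (orbit hU hψ s - orbit hU hψ t) +
          (annH (hh.freeEvol s) (orbit hU hψ t) - annH (hh.freeEvol t) (orbit hU hψ t)) := by
      rw [map_sub]; abel
    rw [h3]
    refine (norm_add_le _ _).trans (add_le_add ((norm_annH_le _ _).trans ?_)
      (norm_annH_freeEvol_sub_le hh h1 s t _))
    exact mul_le_mul_of_nonneg_right (hh.norm_W_freeEvol_le s) (norm_nonneg _)
  refine squeeze_zero (fun s => norm_nonneg _) h2 ?_
  have h4 : Tendsto (fun s => |s - t|) (𝓝 t) (𝓝 0) := by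
    have : Continuous fun s : ℝ => |s - t| := by fun_prop
    simpa using this.tendsto t
  simpa using ((tendsto_sqH_orbit hU hf hψ t).const_mul ‖hh.W‖).add
    (h4.mul_const (‖h1.W‖ * ‖sqH (orbit hU hψ t)‖))

/-- The derivative in Cook's method: `d/dt ⟨e^{-itH}φ, a(h_t) e^{-itH}ψ⟩` only involves the
commutator `[gV, a(h_t)] = -g ⟨h_t, f⟩ σ₁`. -/
theorem hasDerivAt_inner_annH_orbit (hf : Good f) (hh : Good h)
    (h1 : Good fun k => (‖k‖ : ℂ) * h k) (h2 : Good fun k => (‖k‖ : ℂ) * ((‖k‖ : ℂ) * h k))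
    {φ φ' ψ ψ' : Hilb} (hφ : (φ, φ') ∈ (ham e₁ g f).graph) (hψ : (ψ, ψ') ∈ (ham e₁ g f).graph)
    (t : ℝ) :
    HasDerivAt (fun s => (inner ℂ (U s φ) (annH (hh.freeEvol s) (orbit hU hψ s)) : ℂ))
      (-(Complex.I * g) *
        (inner ℂ (hh.freeEvol t).L hf.L * inner ℂ (U t φ) (sigmaL (U t ψ)))) t := by
  have a1 := hasDerivAt_inner_of_eq_zero ((hU.hasDerivAt hφ t).sub_const (U t φ)) (sub_self _)
    (continuousAt_annH_orbit hU hf hh h1 hψ t)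
  have a2 := (hasDerivAt_creH_freeEvol hh h1 h2 t (orbit hU hφ t)).inner ℂ (hU.hasDerivAt hψ t)
  have a3 := a1.add a2
  have e1 : ∀ s, (inner ℂ (U s φ - U t φ) (annH (hh.freeEvol s) (orbit hU hψ s)) : ℂ) +
      inner ℂ (creH (hh.freeEvol s) (orbit hU hφ t)) (U s ψ) =
      inner ℂ (U s φ) (annH (hh.freeEvol s) (orbit hU hψ s)) := fun s => by
    have := inner_creH_left (hh.freeEvol s) (orbit hU hφ t) (orbit hU hψ s)
    rw [coe_orbit, coe_orbit] at this
    rw [this, inner_sub_left, sub_add_cancel]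
  have h1t : Good fun k => (‖k‖ : ℂ) * freeEvol h t k := by
    have e2 : (fun k : R3 => (‖k‖ : ℂ) * freeEvol h t k) =
        freeEvol (fun k => (‖k‖ : ℂ) * h k) t := by
      funext k
      simp only [freeEvol_apply]
      ring
    rw [e2]
    exact h1.freeEvol t
  have e3 := inner_creH_ham hf (hh.freeEvol t) h1t (orbit_mem_graph hU hφ t)
    (orbit_mem_graph hU hψ t)
  have e4 : inner ℂ (creH (h1.freeEvol t) (orbit hU hφ t)) (U t ψ) =
      inner ℂ (U t φ) (annH h1t (orbit hU hψ t)) := by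
    have := inner_creH_left (h1.freeEvol t) (orbit hU hφ t) (orbit hU hψ t)
    rw [coe_orbit, coe_orbit] at this
    rw [this]
    congr 1
    refine annH_congr _ _ ?_ _
    funext k
    simp only [freeEvol_apply]
    ring
  rw [coe_orbit, coe_orbit] at e3
  refine (a3.congr_of_eventuallyEq (Eventually.of_forall fun s => (e1 s).symm)).congr_deriv ?_
  rw [inner_smul_left, inner_smul_left, inner_smul_right, e3, e4]
  simp only [map_neg, Complex.conj_I]
  ring

/-- The coupling function `c(t) = ⟨h_t, f⟩` is integrable, because it is the Fourier transform of
a smooth compactly supported function of the energy. -/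
theorem integrable_coupling (ht : IsTest h) (hs : ∀ k ≠ 0, ContDiffAt ℝ ∞ f k) :
    Integrable (radialFourier fun k => conj (h k) * f k) :=
  integrable_radialFourier (ht.conj_mul hs)

theorem inner_annH_orbit_eq (hf : Good f) (ht : IsTest h) (hs : ∀ k ≠ 0, ContDiffAt ℝ ∞ f k)
    {φ φ' ψ ψ' : Hilb} (hφ : (φ, φ') ∈ (ham e₁ g f).graph) (hψ : (ψ, ψ') ∈ (ham e₁ g f).graph)
    (t : ℝ) : inner ℂ (U t φ) (annH (ht.good.freeEvol t) (orbit hU hψ t)) =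
      inner ℂ φ (annH ht.good ⟨ψ, mem_QH_of_mem_graph hψ⟩) - (Complex.I * g) *
        ∫ τ in (0 : ℝ)..t, radialFourier (fun k => conj (h k) * f k) τ *
          inner ℂ (U τ φ) (sigmaL (U τ ψ)) := by
  have hd : ∀ s, HasDerivAt
      (fun s => (inner ℂ (U s φ) (annH (ht.good.freeEvol s) (orbit hU hψ s)) : ℂ))
      (-(Complex.I * g) * (radialFourier (fun k => conj (h k) * f k) s *
        inner ℂ (U s φ) (sigmaL (U s ψ)))) s := fun s => by
    rw [← inner_freeEvol_L ht.good hf s]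
    exact hasDerivAt_inner_annH_orbit hU hf ht.good ht.norm_mul.good
      ht.norm_mul.norm_mul.good hφ hψ s
  have hc := integrable_coupling ht hs
  have hi : Integrable fun τ => radialFourier (fun k => conj (h k) * f k) τ *
      inner ℂ (U τ φ) (sigmaL (U τ ψ)) := by
    refine hc.mul_bdd (c := ‖φ‖ * ‖ψ‖) ?_ (Eventually.of_forall fun τ => ?_)
    · exact ((hU.continuous φ).inner
        (sigmaL.continuous.comp (hU.continuous ψ))).aestronglyMeasurable
    · refine (norm_inner_le_norm _ _).trans ?_
      rw [hU.norm_map]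
      exact mul_le_mul_of_nonneg_left ((norm_sigmaL_le _).trans (hU.norm_map τ ψ).le)
        (norm_nonneg _)
  have h3 := intervalIntegral.integral_eq_sub_of_hasDerivAt (a := 0) (b := t) (fun s _ => hd s)
    (hi.const_mul _).intervalIntegrable
  rw [intervalIntegral.integral_const_mul] at h3
  have h4 : annH (ht.good.freeEvol 0) (orbit hU hψ 0) =
      annH ht.good ⟨ψ, mem_QH_of_mem_graph hψ⟩ := by
    rw [annH_congr (ht.good.freeEvol 0) ht.good (by funext k; simp [freeEvol_apply])]
    congr 1
    exact Subtype.ext (by rw [coe_orbit, hU.apply_zero])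
  rw [h4, hU.apply_zero] at h3
  linear_combination -h3

/-- `a_t(h) ψ = a(h) ψ - ig ∫₀ᵗ ⟨h_τ, f⟩ σ₁(τ) ψ dτ` on the domain of `H`. -/
theorem annH_orbit (hf : Good f) (ht : IsTest h) (hs : ∀ k ≠ 0, ContDiffAt ℝ ∞ f k)
    {ψ ψ' : Hilb} (hψ : (ψ, ψ') ∈ (ham e₁ g f).graph) (t : ℝ) :
    U (-t) (annH (ht.good.freeEvol t) (orbit hU hψ t)) =
      annH ht.good ⟨ψ, mem_QH_of_mem_graph hψ⟩ - (Complex.I * g) •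
        duhamel U sigmaL (radialFourier fun k => conj (h k) * f k) t ψ := by
  refine eq_of_inner_ham e₁ g hf fun φ φ' hφ => ?_
  rw [hU.inner_neg_right, inner_annH_orbit_eq hU hf ht hs hφ hψ, inner_sub_right, inner_smul_right,
    inner_duhamel_right hU norm_sigmaL_le (integrable_coupling ht hs)]

/-- The formula for `a_t(h)` extends to the form domain, because `a(h_t)` is closed. -/
theorem annih_mem_graph_evolution {e₁ g : ℝ} {f h : R3 → ℂ} {U : ℝ → Hilb →L[ℂ] Hilb}
    (hU : IsUnitaryGroupOf (ham e₁ g f) U) (hf : Good f) (ht : IsTest h)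
    (hs : ∀ k ≠ 0, ContDiffAt ℝ ∞ f k)
    (ψ : QH) (t : ℝ) :
    (U t ψ, U t (annH ht.good ψ - (Complex.I * g) •
      duhamel U sigmaL (radialFourier fun k => conj (h k) * f k) t ψ)) ∈
      (fieldOp (annih (freeEvol h t))).graph := by
  obtain ⟨φ, h1, h2, h3⟩ := exists_tendsto_sqH ψ
  choose φ' hφ' using fun j => exists_mem_graph_ham e₁ g hf (h1 j)
  refine mem_graph_annih_of_tendsto (ht.good.freeEvol t) (ψ := fun j => U t (φ j))
    (χ := fun j => U t (annH ht.good (φ j) - (Complex.I * g) •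
      duhamel U sigmaL (radialFourier fun k => conj (h k) * f k) t (φ j))) (fun j => ?_)
    (((U t).continuous.tendsto _).comp h2) (((U t).continuous.tendsto _).comp
      (Tendsto.sub ?_ (Tendsto.const_smul ?_ _)))
  · have h4 := annH_orbit hU hf ht hs (hφ' j) t
    have h5 : (⟨(φ j : Hilb), mem_QH_of_mem_graph (hφ' j)⟩ : QH) = φ j := rfl
    rw [h5] at h4
    rw [← h4, hU.apply_neg, ← coe_orbit hU (hφ' j)]
    exact annH_mem_graph _ _
  · rw [tendsto_iff_norm_sub_tendsto_zero] at h3 ⊢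
    refine squeeze_zero (fun j => norm_nonneg _) (fun j => ?_)
      (by simpa using h3.const_mul ‖ht.good.W‖)
    rw [← map_sub, ← map_sub]
    exact norm_annH_le _ _
  · exact tendsto_duhamel_apply hU norm_sigmaL_le (integrable_coupling ht hs) t h2

/-- `e^{itH} a*(h_t) e^{-itH} ψ = a*(h) ψ + ig ∫₀ᵗ ⟨f, h_τ⟩ σ₁(τ) ψ dτ` on the domain of `H`. -/
theorem creH_orbit (hf : Good f) (ht : IsTest h) (hs : ∀ k ≠ 0, ContDiffAt ℝ ∞ f k)
    {ψ ψ' : Hilb} (hψ : (ψ, ψ') ∈ (ham e₁ g f).graph) (t : ℝ) :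
    U (-t) (creH (ht.good.freeEvol t) (orbit hU hψ t)) =
      creH ht.good ⟨ψ, mem_QH_of_mem_graph hψ⟩ + (Complex.I * g) •
        duhamel U sigmaL (fun τ => conj (radialFourier (fun k => conj (h k) * f k) τ)) t ψ := by
  have hc := integrable_coupling ht hs
  have hc' : Integrable fun τ => conj (radialFourier (fun k => conj (h k) * f k) τ) :=
    Complex.conjLIE.toContinuousLinearEquiv.toContinuousLinearMap.integrable_comp hc
  refine eq_of_inner_ham e₁ g hf fun φ φ' hφ => ?_
  have h1 := inner_annH_orbit_eq hU hf ht hs hψ hφ t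
  have h2 := inner_creH_left (ht.good.freeEvol t) (orbit hU hψ t) (orbit hU hφ t)
  have h3 := inner_creH_left ht.good ⟨ψ, mem_QH_of_mem_graph hψ⟩ ⟨φ, mem_QH_of_mem_graph hφ⟩
  have h4 : ∫ τ in (0 : ℝ)..t, conj (radialFourier (fun k => conj (h k) * f k) τ) *
      inner ℂ (U τ φ) (sigmaL (U τ ψ)) = conj (∫ τ in (0 : ℝ)..t,
        radialFourier (fun k => conj (h k) * f k) τ * inner ℂ (U τ ψ) (sigmaL (U τ φ))) := by
    rw [intervalIntegral, intervalIntegral, map_sub, ← integral_conj, ← integral_conj]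
    simp only [map_mul, inner_conj_symm, inner_sigmaL_left]
  rw [coe_orbit, coe_orbit, h1, ← h3] at h2
  have h5 := congrArg conj h2
  rw [map_sub, inner_conj_symm, inner_conj_symm, map_mul, ← h4, map_mul, Complex.conj_I,
    Complex.conj_ofReal] at h5
  rw [hU.inner_neg_right, inner_add_right, inner_smul_right,
    inner_duhamel_right hU norm_sigmaL_le hc', h5]
  ring

end Cook

/-! ### The asymptotic annihilation and creation operators -/

section Asymptotic

theorem annihAt_apply {H : Hilb →ₗ.[ℂ] Hilb} {t : ℝ} {h : R3 → ℂ} {ψ χ : Hilb}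
    (hg : (evolution H t ψ, χ) ∈ (fieldOp (annih (freeEvol h t))).graph) :
    ∃ hp : ψ ∈ (annihAt H t h).domain, annihAt H t h ⟨ψ, hp⟩ = evolution H (-t) χ := by
  have hp : evolution H t ψ ∈ (fieldOp (annih (freeEvol h t))).domain :=
    LinearPMap.mem_domain_of_mem_graph hg
  refine ⟨hp, ?_⟩
  have h1 := (fieldOp (annih (freeEvol h t))).mem_graph ⟨evolution H t ψ, hp⟩
  exact congrArg (evolution H (-t)) (graph_snd_unique h1 hg)

theorem mem_graph_annihAsymp {H : Hilb →ₗ.[ℂ] Hilb} {F : Filter ℝ} [F.NeBot] {h : R3 → ℂ}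
    {ψ χ : Hilb} : (ψ, χ) ∈ (annihAsymp H F h).graph ↔ ψ ∈ QH ∧
      ∃ hp : ∀ t, ψ ∈ (annihAt H t h).domain,
        Tendsto (fun t => annihAt H t h ⟨ψ, hp t⟩) F (𝓝 χ) := by
  unfold annihAsymp
  rw [Submodule.toLinearPMap_graph_eq]
  · rfl
  · rintro ⟨ψ, χ⟩ ⟨-, hp, hlim⟩ h0
    change ψ = 0 at h0
    subst h0
    have h1 : ∀ t, annihAt H t h ⟨0, hp t⟩ = 0 := fun t => LinearPMap.map_zero _
    simp only [h1] at hlim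
    exact tendsto_nhds_unique hlim tendsto_const_nhds

variable {e₁ g : ℝ} {f h : R3 → ℂ}

/-- Convergence of all Duhamel integrals along `F`. -/
def DuhamelConv (U : ℝ → Hilb →L[ℂ] Hilb) (F : Filter ℝ) : Prop :=
  ∀ c : ℝ → ℂ, Integrable c → ∀ ψ, ∃ d, Tendsto (fun t => duhamel U sigmaL c t ψ) F (𝓝 d)

theorem duhamelConv_atTop {U : ℝ → Hilb →L[ℂ] Hilb} (hU : IsUnitaryGroupOf (ham e₁ g f) U) :
    DuhamelConv U atTop :=
  fun _ hc ψ => ⟨_, tendsto_duhamel_atTop hU norm_sigmaL_le hc ψ⟩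

theorem duhamelConv_atBot {U : ℝ → Hilb →L[ℂ] Hilb} (hU : IsUnitaryGroupOf (ham e₁ g f) U) :
    DuhamelConv U atBot :=
  fun _ hc ψ => ⟨_, tendsto_duhamel_atBot hU norm_sigmaL_le hc ψ⟩

/-- The evolution of the Spin-Boson Hamiltonian. -/
abbrev evol (e₁ g : ℝ) (f : R3 → ℂ) : ℝ → Hilb →L[ℂ] Hilb := evolution (ham e₁ g f)

/-- `a_t(h) ψ` written as a Duhamel integral. -/
def annDuhamel (e₁ g : ℝ) (f : R3 → ℂ) (ht : IsTest h) (t : ℝ) (ψ : QH) : Hilb :=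
  annH ht.good ψ - (Complex.I * g) •
    duhamel (evol e₁ g f) sigmaL (radialFourier fun k => conj (h k) * f k) t ψ

theorem annDuhamel_mem_graph (hf : Good f) (hs : ∀ k ≠ 0, ContDiffAt ℝ ∞ f k) (ht : IsTest h)
    (t : ℝ) (ψ : QH) :
    (evol e₁ g f t ψ, evol e₁ g f t (annDuhamel e₁ g f ht t ψ)) ∈
      (fieldOp (annih (freeEvol h t))).graph :=
  annih_mem_graph_evolution (isUnitaryGroupOf_evolution e₁ g hf) hf ht hs ψ t

/-- On the form domain, `a_±(h) ψ` is the limit of `a(h) ψ` plus a Duhamel integral. -/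
theorem mem_graph_annihAsymp_iff (hf : Good f) (hs : ∀ k ≠ 0, ContDiffAt ℝ ∞ f k)
    (ht : IsTest h) {F : Filter ℝ} [F.NeBot] {ψ : QH} {χ : Hilb} :
    ((ψ : Hilb), χ) ∈ (annihAsymp (ham e₁ g f) F h).graph ↔
      Tendsto (fun t => annDuhamel e₁ g f ht t ψ) F (𝓝 χ) := by
  have hU := isUnitaryGroupOf_evolution e₁ g hf
  have h1 : ∀ t (hp : (ψ : Hilb) ∈ (annihAt (ham e₁ g f) t h).domain),
      annihAt (ham e₁ g f) t h ⟨ψ, hp⟩ = annDuhamel e₁ g f ht t ψ := fun t hp => by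
    obtain ⟨_, h2⟩ := annihAt_apply (annDuhamel_mem_graph (e₁ := e₁) (g := g) hf hs ht t ψ)
    rw [h2, hU.neg_apply]
  rw [mem_graph_annihAsymp]
  constructor
  · rintro ⟨-, hp, h2⟩
    exact h2.congr fun t => h1 t (hp t)
  · intro h2
    have hp : ∀ t, (ψ : Hilb) ∈ (annihAt (ham e₁ g f) t h).domain := fun t =>
      (annihAt_apply (annDuhamel_mem_graph (e₁ := e₁) (g := g) hf hs ht t ψ)).1
    exact ⟨ψ.2, hp, h2.congr fun t => (h1 t (hp t)).symm⟩

/-- The limits defining `a_±(h)` exist on the whole form domain. -/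
theorem domain_annihAsymp (hf : Good f) (hs : ∀ k ≠ 0, ContDiffAt ℝ ∞ f k) (ht : IsTest h)
    {F : Filter ℝ} [F.NeBot] (hF : DuhamelConv (evol e₁ g f) F) :
    (annihAsymp (ham e₁ g f) F h).domain = QH := by
  ext ψ
  constructor
  · intro hψ
    obtain ⟨χ, hχ⟩ := mem_domain_iff_exists.1 hψ
    exact (mem_graph_annihAsymp.1 hχ).1
  · intro hψ
    obtain ⟨d, hd⟩ := hF _ (integrable_coupling ht hs) ψ
    exact LinearPMap.mem_domain_of_mem_graph ((mem_graph_annihAsymp_iff hf hs ht (ψ := ⟨ψ, hψ⟩)).2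
      (tendsto_const_nhds.sub (hd.const_smul _)))

variable {Ψ Ψ' : Hilb}

/-- `e^{itH} a*(h_t) e^{-itH} Ψ`. -/
def creEvol (hf : Good f) (hΨ : (Ψ, Ψ') ∈ (ham e₁ g f).graph) (hh : Good h) (t : ℝ) : Hilb :=
  evol e₁ g f (-t) (creH (hh.freeEvol t) (orbit (isUnitaryGroupOf_evolution e₁ g hf) hΨ t))

/-- A strong limit of `e^{itH} a*(h_t) e^{-itH} Ψ` is the value of the adjoint of `a_±(h)`. -/
theorem opApply_creatAsymp (hf : Good f) (hs : ∀ k ≠ 0, ContDiffAt ℝ ∞ f k) (ht : IsTest h)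
    (hΨ : (Ψ, Ψ') ∈ (ham e₁ g f).graph) {F : Filter ℝ} [F.NeBot]
    (hF : DuhamelConv (evol e₁ g f) F) {w : Hilb}
    (hw : Tendsto (creEvol hf hΨ ht.good) F (𝓝 w)) :
    Ψ ∈ (creatAsymp (ham e₁ g f) F h).domain ∧ opApply (creatAsymp (ham e₁ g f) F h) Ψ = w := by
  have hU := isUnitaryGroupOf_evolution e₁ g hf
  have h1 : ∀ x : (annihAsymp (ham e₁ g f) F h).domain,
      inner ℂ w (x : Hilb) = inner ℂ Ψ (annihAsymp (ham e₁ g f) F h x) := fun x => by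
    have hx := (annihAsymp (ham e₁ g f) F h).mem_graph x
    have hq := (mem_graph_annihAsymp.1 hx).1
    have h2 := (mem_graph_annihAsymp_iff hf hs ht (ψ := ⟨x, hq⟩)).1 hx
    refine tendsto_nhds_unique (hw.inner (𝕜 := ℂ) tendsto_const_nhds)
      ((tendsto_const_nhds.inner (𝕜 := ℂ) h2).congr fun t => ?_)
    rw [creEvol, hU.inner_neg_left, inner_creH_of_mem_graph (ht.good.freeEvol t) _
      (annDuhamel_mem_graph hf hs ht t ⟨x, hq⟩), coe_orbit, hU.inner_map_map]
  have h2 : Ψ ∈ (creatAsymp (ham e₁ g f) F h).domain :=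
    LinearPMap.mem_adjoint_domain_of_exists _ ⟨w, h1⟩
  have h3 : Dense ((annihAsymp (ham e₁ g f) F h).domain : Set Hilb) := by
    rw [domain_annihAsymp hf hs ht hF]
    exact dense_domain_fieldOp_fieldH.mono fieldH_domain_le_QH
  refine ⟨h2, ?_⟩
  rw [opApply, dif_pos h2]
  exact LinearPMap.adjoint_apply_eq h3 ⟨Ψ, h2⟩ h1

/-- The coupling functions of creation operators are integrable. -/
theorem integrable_conj_coupling (hs : ∀ k ≠ 0, ContDiffAt ℝ ∞ f k) (ht : IsTest h) :
    Integrable fun τ => conj (radialFourier (fun k => conj (h k) * f k) τ) :=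
  Complex.conjLIE.toContinuousLinearEquiv.toContinuousLinearMap.integrable_comp
    (integrable_coupling ht hs)

/-- The integrand of the Duhamel formula for the asymptotic creation operators. -/
abbrev creIntegrand (e₁ g : ℝ) (f h : R3 → ℂ) (Ψ : Hilb) (τ : ℝ) : Hilb :=
  conj (radialFourier (fun k => conj (h k) * f k) τ) • heis (evol e₁ g f) sigmaL τ Ψ

/-- The vector `a_-(h)* Ψ`. -/
def inVec (hΨ : (Ψ, Ψ') ∈ (ham e₁ g f).graph) (hh : Good h) : Hilb :=
  creH hh ⟨Ψ, mem_QH_of_mem_graph hΨ⟩ -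
    (Complex.I * g) • ∫ τ in Iic (0 : ℝ), creIntegrand e₁ g f h Ψ τ

/-- The vector `a_+(h)* Ψ`. -/
def outVec (hΨ : (Ψ, Ψ') ∈ (ham e₁ g f).graph) (hh : Good h) : Hilb :=
  creH hh ⟨Ψ, mem_QH_of_mem_graph hΨ⟩ +
    (Complex.I * g) • ∫ τ in Ioi (0 : ℝ), creIntegrand e₁ g f h Ψ τ

theorem tendsto_creEvol_atBot (hf : Good f) (hs : ∀ k ≠ 0, ContDiffAt ℝ ∞ f k) (ht : IsTest h)
    (hΨ : (Ψ, Ψ') ∈ (ham e₁ g f).graph) :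
    Tendsto (creEvol hf hΨ ht.good) atBot (𝓝 (inVec hΨ ht.good)) := by
  have hU := isUnitaryGroupOf_evolution e₁ g hf
  have h1 := tendsto_const_nhds (x := creH ht.good ⟨Ψ, mem_QH_of_mem_graph hΨ⟩) |>.add
    ((tendsto_duhamel_atBot hU norm_sigmaL_le (integrable_conj_coupling hs ht) Ψ).const_smul
      (Complex.I * g))
  rw [smul_neg, ← sub_eq_add_neg] at h1
  exact h1.congr fun t => (creH_orbit hU hf ht hs hΨ t).symm

theorem tendsto_creEvol_atTop (hf : Good f) (hs : ∀ k ≠ 0, ContDiffAt ℝ ∞ f k) (ht : IsTest h)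
    (hΨ : (Ψ, Ψ') ∈ (ham e₁ g f).graph) :
    Tendsto (creEvol hf hΨ ht.good) atTop (𝓝 (outVec hΨ ht.good)) := by
  have hU := isUnitaryGroupOf_evolution e₁ g hf
  have h1 := tendsto_const_nhds (x := creH ht.good ⟨Ψ, mem_QH_of_mem_graph hΨ⟩) |>.add
    ((tendsto_duhamel_atTop hU norm_sigmaL_le (integrable_conj_coupling hs ht) Ψ).const_smul
      (Complex.I * g))
  exact h1.congr fun t => (creH_orbit hU hf ht hs hΨ t).symm

/-- The Duhamel formula between `t = -∞` and `t = +∞`. -/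
theorem outVec_eq (hf : Good f) (hs : ∀ k ≠ 0, ContDiffAt ℝ ∞ f k) (ht : IsTest h)
    (hΨ : (Ψ, Ψ') ∈ (ham e₁ g f).graph) : outVec hΨ ht.good = inVec hΨ ht.good +
    (Complex.I * g) • ∫ τ, creIntegrand e₁ g f h Ψ τ := by
  have hi := integrable_smul_heis (isUnitaryGroupOf_evolution e₁ g hf) norm_sigmaL_le
    (integrable_conj_coupling hs ht) Ψ
  rw [outVec, inVec, ← intervalIntegral.integral_Iic_add_Ioi (b := 0) hi.integrableOn
    hi.integrableOn, smul_add]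
  abel

end Asymptotic

/-! ### Scattering on an eigenvector -/

section Scattering

variable {e₁ g : ℝ} {f h l : R3 → ℂ} {Ψ : Hilb} {E : ℝ}

/-- The evolution of an eigenvector in the form domain. -/
theorem orbit_eigenvector (hf : Good f) (hΨ : (Ψ, (E : ℂ) • Ψ) ∈ (ham e₁ g f).graph) (t : ℝ) :
    orbit (isUnitaryGroupOf_evolution e₁ g hf) hΨ t =
      Complex.exp (-(Complex.I * t * E)) • (⟨Ψ, mem_QH_of_mem_graph hΨ⟩ : QH) :=
  Subtype.ext (by
    rw [coe_orbit, (isUnitaryGroupOf_evolution e₁ g hf).eigenvector hΨ]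
    rfl)

/-- Canonical commutation relations for the incoming vectors: the annihilation part vanishes
because `a(h_t)Ψ → 0`. -/
theorem inner_inVec_inVec (hf : Good f) (hs : ∀ k ≠ 0, ContDiffAt ℝ ∞ f k) (ht : IsTest h)
    (hl : IsTest l) (hΨ : (Ψ, (E : ℂ) • Ψ) ∈ (ham e₁ g f).graph) :
    inner ℂ (inVec hΨ ht.good) (inVec hΨ hl.good) =
      (∫ k, conj (h k) * l k) * (‖Ψ‖ ^ 2 : ℂ) := by
  have hU := isUnitaryGroupOf_evolution e₁ g hf
  have h1 := (tendsto_creEvol_atBot hf hs ht hΨ).inner (𝕜 := ℂ) (tendsto_creEvol_atBot hf hs hl hΨ)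
  refine tendsto_nhds_unique h1 ?_
  have h2 : ∀ (m : R3 → ℂ) (hm : IsTest m), Tendsto
      (fun t => annH (hm.good.freeEvol t) (orbit hU hΨ t)) atBot (𝓝 0) := fun m hm => by
    have h3 := tendsto_annH_freeEvol hm.good (F := atBot) atBot_le_cocompact
      ⟨Ψ, mem_QH_of_mem_graph hΨ⟩
    rw [tendsto_zero_iff_norm_tendsto_zero] at h3 ⊢
    refine h3.congr fun t => ?_
    rw [orbit_eigenvector hf hΨ, map_smul, norm_smul, norm_exp_neg_phase, one_mul]
  have h4 := ((h2 l hl).inner (𝕜 := ℂ) (h2 h ht)).add_const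
    ((∫ k, conj (h k) * l k) * (‖Ψ‖ ^ 2 : ℂ))
  rw [inner_zero_left, zero_add] at h4
  refine h4.congr fun t => ?_
  rw [creEvol, creEvol, hU.inner_map_map, inner_creH_creH, coe_orbit, hU.inner_map_map,
    inner_self_eq_norm_sq_to_K]
  congr 2
  rw [L2.inner_def]
  refine integral_congr_ae ?_
  filter_upwards [(ht.good.freeEvol t).coe_L, (hl.good.freeEvol t).coe_L] with k h5 h6
  rw [RCLike.inner_apply, h5, h6, freeEvol_apply, freeEvol_apply, map_mul, ← Complex.exp_conj]
  have h7 : Complex.exp (-(Complex.I * t * ‖k‖)) *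
      Complex.exp (conj (-(Complex.I * t * ‖k‖))) = 1 := by
    rw [← Complex.exp_add]
    simp
  linear_combination (-(l k * conj (h k))) * h7

theorem freeEvol_freeEvol (l : R3 → ℂ) (s t : ℝ) :
    freeEvol (freeEvol l t) s = freeEvol l (s + t) := by
  funext k
  rw [freeEvol_apply, freeEvol_apply, freeEvol_apply, mul_assoc, ← Complex.exp_add]
  push_cast
  ring_nf

/-- Covariance of the incoming vectors under the time evolution. -/
theorem evol_inVec (hf : Good f) (hs : ∀ k ≠ 0, ContDiffAt ℝ ∞ f k) (hl : IsTest l)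
    (hΨ : (Ψ, (E : ℂ) • Ψ) ∈ (ham e₁ g f).graph) (τ : ℝ) :
    evol e₁ g f τ (inVec hΨ hl.good) =
      Complex.exp (-(Complex.I * τ * E)) • inVec hΨ (hl.freeEvol τ).good := by
  have hU := isUnitaryGroupOf_evolution e₁ g hf
  have h1 := ((evol e₁ g f τ).continuous.tendsto _).comp
    ((tendsto_creEvol_atBot hf hs hl hΨ).comp (tendsto_atBot_add_const_right atBot τ tendsto_id))
  have h2 := (tendsto_creEvol_atBot hf hs (hl.freeEvol τ) hΨ).const_smul
    (Complex.exp (-(Complex.I * τ * E)))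
  refine tendsto_nhds_unique h1 (h2.congr fun s => ?_)
  simp only [Function.comp, id]
  rw [creEvol, creEvol, ← hU.apply_add, show τ + -(s + τ) = -s by ring, ← map_smul,
    ← map_smul, creH_congr ((hl.freeEvol τ).good.freeEvol s) (hl.good.freeEvol (s + τ))
      (freeEvol_freeEvol l s τ), orbit_eigenvector hf hΨ, orbit_eigenvector hf hΨ, smul_smul,
    ← Complex.exp_add]
  congr 5
  push_cast
  ring

/-- Shifting the time `τ` from `σ₁` to the test function; the phases of the eigenvector on the two
sides cancel. -/
theorem inner_heis_inVec (hf : Good f) (hs : ∀ k ≠ 0, ContDiffAt ℝ ∞ f k) (hl : IsTest l)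
    (hΨ : (Ψ, (E : ℂ) • Ψ) ∈ (ham e₁ g f).graph) (τ : ℝ) :
    inner ℂ (heis (evol e₁ g f) sigmaL τ Ψ) (inVec hΨ hl.good) =
      inner ℂ (sigmaL Ψ) (inVec hΨ (hl.freeEvol τ).good) := by
  have hU := isUnitaryGroupOf_evolution e₁ g hf
  rw [inner_heis_left hU, evol_inVec hf hs hl hΨ, hU.eigenvector hΨ, map_smul, inner_smul_left,
    inner_smul_right, ← mul_assoc, ← Complex.exp_conj, ← Complex.exp_add]
  simp

theorem exists_sigma_mem_graph (hf : Good f) {Ψ' : Hilb} (hΨ : (Ψ, Ψ') ∈ (ham e₁ g f).graph) :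
    ∃ χ, (sigma1 Ψ, χ) ∈ (ham e₁ g f).graph :=
  exists_mem_graph_ham e₁ g hf
    (sigma1_mem_domain (LinearPMap.mem_domain_of_mem_graph hΨ).1.2)

/-- `⟨σ₁Ψ, e^{itH} a*(m_t) e^{-itH}Ψ⟩ = ∫ m(k) ⟨σ₁Ψ, a_t(k)*Ψ⟩ dk`. -/
theorem inner_sigma_creEvol (hf : Good f) {Ψ' : Hilb} (hΨ : (Ψ, Ψ') ∈ (ham e₁ g f).graph)
    (hh : Good h) (t : ℝ) :
    Integrable (fun k => h k * creatFormAt (ham e₁ g f) t k (sigma1 Ψ) Ψ) ∧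
      ∫ k, h k * creatFormAt (ham e₁ g f) t k (sigma1 Ψ) Ψ =
        inner ℂ (sigmaL Ψ) (creEvol hf hΨ hh t) := by
  have hU := isUnitaryGroupOf_evolution e₁ g hf
  obtain ⟨χ, hχ⟩ := exists_sigma_mem_graph hf hΨ
  have h1 := integral_mul_creatForm (hh.freeEvol t) (orbit hU hχ t) (evol e₁ g f t Ψ)
  have h2 : (fun k => freeEvol h t k * creatForm k (orbit hU hχ t) (evol e₁ g f t Ψ)) =
      fun k => h k * creatFormAt (ham e₁ g f) t k (sigma1 Ψ) Ψ := by
    funext k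
    rw [coe_orbit, freeEvol_apply, creatFormAt, mul_assoc]
  rw [h2] at h1
  refine ⟨h1.1, h1.2.trans ?_⟩
  have h3 := inner_creH_right (hh.freeEvol t) (orbit hU hΨ t) (orbit hU hχ t)
  rw [coe_orbit, coe_orbit] at h3
  rw [creEvol, hU.inner_neg_right, ← h3, sigmaL_apply]

theorem exists_norm_inner_sigma_creEvol_le (hf : Good f) {Ψ' : Hilb}
    (hΨ : (Ψ, Ψ') ∈ (ham e₁ g f).graph) : ∃ C, ∀ (h : R3 → ℂ) (hh : Good h) (t : ℝ),
      ‖inner ℂ (sigmaL Ψ) (creEvol hf hΨ hh t)‖ ≤ ‖hh.W‖ * C := by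
  have hU := isUnitaryGroupOf_evolution e₁ g hf
  obtain ⟨χ, hχ⟩ := exists_sigma_mem_graph hf hΨ
  obtain ⟨C, hC⟩ := exists_norm_sqH_orbit_le hU hf hχ
  refine ⟨C * ‖Ψ‖, fun h hh t => ?_⟩
  have h3 := inner_creH_right (hh.freeEvol t) (orbit hU hΨ t) (orbit hU hχ t)
  rw [coe_orbit, coe_orbit] at h3
  rw [creEvol, hU.inner_neg_right, sigmaL_apply, h3, ← mul_assoc]
  refine (norm_inner_le_norm _ _).trans ?_
  rw [hU.norm_map]
  refine mul_le_mul_of_nonneg_right ((norm_annH_le _ _).trans ?_) (norm_nonneg _)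
  exact mul_le_mul (hh.norm_W_freeEvol_le t) (hC t) (norm_nonneg _) (norm_nonneg _)

theorem continuous_phase_mul :
    Continuous fun p : ℝ × R3 => Complex.exp (-(Complex.I * p.1 * ‖p.2‖)) := by
  fun_prop

/-- Fubini's theorem turns the time integral against `c = ⟨h_τ, f⟩` into the restriction to the
energy shell. -/
theorem integral_coupling_mul (hf : Good f) (hs : ∀ k ≠ 0, ContDiffAt ℝ ∞ f k) (ht : IsTest h)
    (hl : IsTest l) {Ψ' : Hilb} (hΨ : (Ψ, Ψ') ∈ (ham e₁ g f).graph) (t : ℝ) :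
    Integrable (fun τ => radialFourier (fun k => conj (h k) * f k) τ *
      inner ℂ (sigmaL Ψ) (creEvol hf hΨ (hl.freeEvol τ).good t)) ∧
    ∫ τ, radialFourier (fun k => conj (h k) * f k) τ *
      inner ℂ (sigmaL Ψ) (creEvol hf hΨ (hl.freeEvol τ).good t) =
      2 * Real.pi * inner ℂ (sigmaL Ψ) (creEvol hf hΨ (isTest_shellFn ht hl hs).good t) := by
  set F : R3 → ℂ := fun k => creatFormAt (ham e₁ g f) t k (sigma1 Ψ) Ψ with hF
  set c := radialFourier (fun k => conj (h k) * f k) with hc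
  have hi : Integrable (fun p : ℝ × R3 => c p.1 * (l p.2 * F p.2) *
      Complex.exp (-(Complex.I * p.1 * ‖p.2‖))) (volume.prod volume) :=
    ((integrable_coupling ht hs).mul_prod (inner_sigma_creEvol hf hΨ hl.good t).1).mul_bdd (c := 1)
      continuous_phase_mul.aestronglyMeasurable
      (Eventually.of_forall fun p => (norm_exp_neg_phase _ _).le)
  have h1 : ∀ τ, c τ * inner ℂ (sigmaL Ψ) (creEvol hf hΨ (hl.freeEvol τ).good t) =
      ∫ k : R3, c τ * (l k * F k) * Complex.exp (-(Complex.I * τ * ‖k‖)) := fun τ => by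
    rw [← (inner_sigma_creEvol hf hΨ (hl.freeEvol τ).good t).2, ← integral_const_mul]
    refine integral_congr_ae (Eventually.of_forall fun k => ?_)
    simp only [freeEvol_apply, hF]
    ring
  simp only [h1]
  refine ⟨hi.integral_prod_left, ?_⟩
  rw [integral_integral_swap hi, ← (inner_sigma_creEvol hf hΨ (isTest_shellFn ht hl hs).good t).2,
    ← integral_const_mul]
  refine integral_congr_ae (Eventually.of_forall fun k => ?_)
  simp only
  have h2 := integral_radialFourier_mul_exp (ht.conj_mul hs) ‖k‖
  calc ∫ τ, c τ * (l k * F k) * Complex.exp (-(Complex.I * τ * ‖k‖))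
      = ∫ τ, (l k * F k) * (c τ * Complex.exp (-(Complex.I * τ * ‖k‖))) := by
        congr 1; funext τ; ring
    _ = (l k * F k) * ∫ τ, c τ * Complex.exp (-(Complex.I * τ * ‖k‖)) := integral_const_mul _ _
    _ = _ := by
        rw [hc, h2, shellFn_eq]
        ring

/-- The limit `t → -∞` of `integral_coupling_mul`, by dominated convergence: the inner products are
bounded uniformly in `t` and `τ`. -/
theorem integral_coupling_inVec (hf : Good f) (hs : ∀ k ≠ 0, ContDiffAt ℝ ∞ f k) (ht : IsTest h)
    (hl : IsTest l) {Ψ' : Hilb} (hΨ : (Ψ, Ψ') ∈ (ham e₁ g f).graph) :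
    ∫ τ, radialFourier (fun k => conj (h k) * f k) τ *
      inner ℂ (sigmaL Ψ) (inVec hΨ (hl.freeEvol τ).good) =
      2 * Real.pi * inner ℂ (sigmaL Ψ) (inVec hΨ (isTest_shellFn ht hl hs).good) := by
  obtain ⟨C, hC⟩ := exists_norm_inner_sigma_creEvol_le hf hΨ
  have hC0 : 0 ≤ ‖hl.good.W‖ * C := (norm_nonneg _).trans (hC l hl.good 0)
  have h0 : ∀ (m : R3 → ℂ) (hm : IsTest m), Tendsto
      (fun t => (inner ℂ (sigmaL Ψ) (creEvol hf hΨ hm.good t) : ℂ)) atBot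
      (𝓝 (inner ℂ (sigmaL Ψ) (inVec hΨ hm.good))) := fun m hm =>
    tendsto_const_nhds.inner (tendsto_creEvol_atBot hf hs hm hΨ)
  have h1 := (h0 _ (isTest_shellFn ht hl hs)).const_mul (2 * Real.pi : ℂ)
  simp only [← (integral_coupling_mul hf hs ht hl hΨ _).2] at h1
  refine tendsto_nhds_unique (tendsto_integral_filter_of_dominated_convergence
    (fun τ => ‖radialFourier (fun k => conj (h k) * f k) τ‖ * (‖hl.good.W‖ * C))
    (Eventually.of_forall fun t => (integral_coupling_mul hf hs ht hl hΨ t).1.1)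
    (Eventually.of_forall fun t => Eventually.of_forall fun τ => ?_)
    ((integrable_coupling ht hs).norm.mul_const _)
    (Eventually.of_forall fun τ => (h0 _ (hl.freeEvol τ)).const_mul _)) h1
  rw [norm_mul]
  refine mul_le_mul_of_nonneg_left ((hC _ (hl.freeEvol τ).good t).trans ?_) (norm_nonneg _)
  rcases le_or_gt 0 C with h2 | h2
  · exact mul_le_mul_of_nonneg_right (hl.good.norm_W_freeEvol_le τ) h2
  · exact (mul_nonpos_of_nonneg_of_nonpos (norm_nonneg _) h2.le).trans hC0

/-- The transition coefficient in terms of the incoming vectors. -/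
theorem inner_outVec_inVec (hf : Good f) (hs : ∀ k ≠ 0, ContDiffAt ℝ ∞ f k) (ht : IsTest h)
    (hl : IsTest l) (hΨ : (Ψ, (E : ℂ) • Ψ) ∈ (ham e₁ g f).graph) :
    inner ℂ (outVec hΨ ht.good) (inVec hΨ hl.good) =
      (∫ k, conj (h k) * l k) * (‖Ψ‖ ^ 2 : ℂ) - 2 * Real.pi * Complex.I * g *
        inner ℂ (sigma1 Ψ) (inVec hΨ (isTest_shellFn ht hl hs).good) := by
  have hi := integrable_smul_heis (isUnitaryGroupOf_evolution e₁ g hf) norm_sigmaL_le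
    (integrable_conj_coupling hs ht) Ψ
  have h1 : inner ℂ (∫ τ, creIntegrand e₁ g f h Ψ τ) (inVec hΨ hl.good) =
      ∫ τ, radialFourier (fun k => conj (h k) * f k) τ *
        inner ℂ (sigmaL Ψ) (inVec hΨ (hl.freeEvol τ).good) := by
    rw [← inner_conj_symm, ← integral_inner hi, ← integral_conj]
    refine integral_congr_ae (Eventually.of_forall fun τ => ?_)
    simp only
    rw [inner_conj_symm, inner_smul_left, Complex.conj_conj, inner_heis_inVec hf hs hl hΨ]
  rw [outVec_eq hf hs ht hΨ, inner_add_left, inner_smul_left, inner_inVec_inVec hf hs ht hl hΨ, h1,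
    integral_coupling_inVec hf hs ht hl hΨ, sigmaL_apply, map_mul, Complex.conj_I,
    Complex.conj_ofReal]
  ring

end Scattering

/-! ### The energy shell -/

section Shell

/-- The map `(r, Σ, Σ') ↦ ((r, Σ'), Σ)`. -/
def shellEquiv : ℝ × S2 × S2 ≃ᵐ (ℝ × S2) × S2 :=
  ((MeasurableEquiv.refl ℝ).prodCongr MeasurableEquiv.prodComm).trans MeasurableEquiv.prodAssoc.symm

theorem shellEquiv_apply (p : ℝ × S2 × S2) : shellEquiv p = ((p.1, p.2.2), p.2.1) := rfl

theorem measurePreserving_shellEquiv : MeasurePreserving shellEquiv shellMeasure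
    (((volume.restrict (Ioi 0)).prod solidAngle).prod solidAngle) := by
  have h1 : MeasurePreserving (Prod.map id Prod.swap : ℝ × S2 × S2 → ℝ × S2 × S2) shellMeasure
      ((volume.restrict (Ioi 0)).prod (solidAngle.prod solidAngle)) :=
    (MeasurePreserving.id _).prod Measure.measurePreserving_swap
  exact (measurePreserving_prodAssoc (volume.restrict (Ioi (0 : ℝ))) solidAngle
    solidAngle).symm.comp h1

/-- Integration over the energy shell: for a test function `u` and an integrable `v`,
`∫ r⁴ u(rΣ) v(rΣ') dr dΣ dΣ' = ∫ (r² ∫ u(rΣ) dΣ)(|k|) v(k) dk`. -/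
theorem integral_shell {u v : R3 → ℂ} (hu : IsTest u) (hv : Integrable v) :
    Integrable (fun p : ℝ × S2 × S2 =>
      (p.1 ^ 4 : ℂ) * u (p.1 • (p.2.1 : R3)) * v (p.1 • (p.2.2 : R3))) shellMeasure ∧
    ∫ p : ℝ × S2 × S2, (p.1 ^ 4 : ℂ) * u (p.1 • (p.2.1 : R3)) * v (p.1 • (p.2.2 : R3))
      ∂shellMeasure = ∫ k, radialDensity u ‖k‖ * v k := by
  set G : (ℝ × S2) × S2 → ℂ := fun q =>
    (q.1.1 ^ 2 • v (q.1.1 • (q.1.2 : R3))) * ((q.1.1 ^ 2 : ℂ) * u (q.1.1 • (q.2 : R3))) with hG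
  have h0 : (fun p : ℝ × S2 × S2 =>
      (p.1 ^ 4 : ℂ) * u (p.1 • (p.2.1 : R3)) * v (p.1 • (p.2.2 : R3))) = G ∘ shellEquiv := by
    funext p
    simp only [hG, Function.comp, shellEquiv_apply, Complex.real_smul]
    push_cast
    ring
  have hu2 : IsTest fun k => u k * ((‖k‖ : ℂ) * ‖k‖) :=
    hu.mul fun k hk => (contDiffAt_ofReal_norm hk).mul (contDiffAt_ofReal_norm hk)
  obtain ⟨C, hC⟩ := hu2.2.1.exists_bound_of_continuous hu2.1.continuous
  have hnorm : ∀ (r : ℝ) (s : S2), ‖r • (s : R3)‖ = |r| := fun r s => by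
    rw [norm_smul, norm_eq_of_mem_sphere, mul_one, Real.norm_eq_abs]
  have hi : Integrable G (((volume.restrict (Ioi 0)).prod solidAngle).prod solidAngle) := by
    have h1 : Integrable (fun q : (ℝ × S2) × S2 => q.1.1 ^ 2 • v (q.1.1 • (q.1.2 : R3)))
        (((volume.restrict (Ioi 0)).prod solidAngle).prod solidAngle) :=
      (integrable_polar hv).comp_fst solidAngle
    refine h1.mul_bdd (c := C) ?_ (Eventually.of_forall fun q => ?_)
    · have : Continuous fun q : (ℝ × S2) × S2 => (q.1.1 ^ 2 : ℂ) * u (q.1.1 • (q.2 : R3)) := by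
        have := hu.1.continuous
        fun_prop
      exact this.aestronglyMeasurable
    · refine le_of_eq_of_le ?_ (hC (q.1.1 • (q.2 : R3)))
      rw [hnorm, mul_comm (u _), ← Complex.ofReal_mul, abs_mul_abs_self]
      push_cast
      ring_nf
  rw [h0]
  refine ⟨(measurePreserving_shellEquiv.integrable_comp_emb
    shellEquiv.measurableEmbedding).2 hi, ?_⟩
  have h2 := measurePreserving_shellEquiv.integral_comp' G
  refine h2.trans ?_
  have hm : AEStronglyMeasurable (fun k => radialDensity u ‖k‖ * v k) volume :=
    ((contDiff_radialDensity hu).continuous.comp continuous_norm).aestronglyMeasurable.mul hv.1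
  rw [integral_prod _ hi, integral_polar hm]
  refine integral_congr_ae ?_
  have h3 : ∀ᵐ p : ℝ × S2 ∂((volume.restrict (Ioi 0)).prod solidAngle), 0 < p.1 :=
    Measure.quasiMeasurePreserving_fst.ae (ae_restrict_mem measurableSet_Ioi)
  filter_upwards [h3] with p hp
  simp only [hG]
  rw [integral_const_mul, integral_const_mul, hnorm, abs_of_pos hp, radialDensity, if_pos hp]
  simp only [Complex.real_smul]
  ring

end Shell

end SpinBoson

end

open SpinBoson in
theorem theorem4p2 (e₁ Λ μ g : ℝ) (he₁ : 0 < e₁) (hΛ : 0 < Λ) (hμ : μ ∈ Ioo (0 : ℝ) (1 / 2))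
    (hg : 0 < g) (H : Hilb →ₗ.[ℂ] Hilb) (hH : H = spinBosonH e₁ Λ μ g)
    (f : R3 → ℂ) (hf : f = fun k => (formFactor Λ μ k : ℂ))
    (Ψ : Hilb) (hΨ : IsGroundState H Ψ) :
    -- well-definedness of the asymptotic annihilation operators on `ℂ² ⊗ D(H_f^{1/2})`, and of
    -- the asymptotic creation operators on the ground state
    (∀ m : R3 → ℂ, IsTest m →
      (annihAsymp H atTop m).domain = (fieldOp fieldHSqrt).domain ∧
      (annihAsymp H atBot m).domain = (fieldOp fieldHSqrt).domain ∧
      Ψ ∈ (creatAsymp H atTop m).domain ∧ Ψ ∈ (creatAsymp H atBot m).domain) ∧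
    ∀ h l : R3 → ℂ, IsTest h → IsTest l →
      IsTest (shellFn f h l) ∧
      transCoeff H Ψ h l = -2 * Real.pi * Complex.I * g * (‖Ψ‖ ^ 2 : ℂ)⁻¹ *
        inner ℂ (sigma1 Ψ) (opApply (creatAsymp H atBot (shellFn f h l)) Ψ) ∧
      (∀ t : ℝ, Integrable (shellIntegrand h l (transKernel H g f Ψ t)) shellMeasure) ∧
      Tendsto (fun t : ℝ => ∫ p, shellIntegrand h l (transKernel H g f Ψ t) p ∂shellMeasure)
        atBot (𝓝 (transCoeff H Ψ h l)) := by
  have hgood : Good f := by rw [hf]; exact good_formFactor hΛ hμ.1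
  have hs : ∀ k ≠ 0, ContDiffAt ℝ ∞ f k := by
    rw [hf]
    exact fun k hk => contDiffAt_formFactor Λ μ hk
  have hham : H = ham e₁ g f := by rw [hH, hf]; rfl
  obtain ⟨hΨ0, hE⟩ := hΨ
  rw [hham] at hE
  generalize specInf (ham e₁ g f) = E at hE
  subst hham
  have hU := isUnitaryGroupOf_evolution e₁ g hgood
  have htop := fun (m : R3 → ℂ) (hm : IsTest m) => opApply_creatAsymp hgood hs hm hE
    (duhamelConv_atTop hU) (tendsto_creEvol_atTop hgood hs hm hE)
  have hbot := fun (m : R3 → ℂ) (hm : IsTest m) => opApply_creatAsymp hgood hs hm hE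
    (duhamelConv_atBot hU) (tendsto_creEvol_atBot hgood hs hm hE)
  refine ⟨fun m hm => ⟨domain_annihAsymp hgood hs hm (duhamelConv_atTop hU),
    domain_annihAsymp hgood hs hm (duhamelConv_atBot hU), (htop m hm).1, (hbot m hm).1⟩,
    fun h l hh hl => ?_⟩
  have hW : IsTest (shellFn f h l) := isTest_shellFn hh hl hs
  have hT : transCoeff (ham e₁ g f) Ψ h l = -2 * Real.pi * Complex.I * g * (‖Ψ‖ ^ 2 : ℂ)⁻¹ *
      inner ℂ (sigma1 Ψ) (inVec hE hW.good) := by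
    have hne : (‖Ψ‖ ^ 2 : ℂ) ≠ 0 := by
      have : ‖Ψ‖ ≠ 0 := norm_ne_zero_iff.2 hΨ0
      exact_mod_cast pow_ne_zero 2 this
    rw [transCoeff, scatCoeff, (htop h hh).2, (hbot l hl).2,
      inner_outVec_inVec hgood hs hh hl hE]
    linear_combination (∫ k, conj (h k) * l k) * inv_mul_cancel₀ hne
  -- the integrand on the energy shell factors into the two solid angles
  have hshell : ∀ t, shellIntegrand h l (transKernel (ham e₁ g f) g f Ψ t) = fun p =>
      (-2 * Real.pi * Complex.I * g * (‖Ψ‖ ^ 2 : ℂ)⁻¹) *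
        ((p.1 ^ 4 : ℂ) * (conj (h (p.1 • (p.2.1 : R3))) * f (p.1 • (p.2.1 : R3))) *
          (l (p.1 • (p.2.2 : R3)) *
            creatFormAt (ham e₁ g f) t (p.1 • (p.2.2 : R3)) (sigma1 Ψ) Ψ)) := fun t => by
    funext p
    rw [shellIntegrand, transKernel]
    ring
  have hint := fun t => integral_shell (hh.conj_mul hs) (inner_sigma_creEvol hgood hE hl.good t).1
  refine ⟨hW, ?_, fun t => ?_, ?_⟩
  · rw [hT, (hbot _ hW).2]
  · rw [hshell]
    exact (hint t).1.const_mul _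
  · have hval : ∀ t, ∫ p, shellIntegrand h l (transKernel (ham e₁ g f) g f Ψ t) p ∂shellMeasure =
        (-2 * Real.pi * Complex.I * g * (‖Ψ‖ ^ 2 : ℂ)⁻¹) *
          inner ℂ (sigmaL Ψ) (creEvol hgood hE hW.good t) := fun t => by
      rw [hshell, integral_const_mul, (hint t).2, ← (inner_sigma_creEvol hgood hE hW.good t).2]
      congr 2
      funext k
      rw [shellFn_eq]
      ring
    simp only [hval]
    rw [hT, ← sigmaL_apply]
    exact (tendsto_const_nhds.inner (tendsto_creEvol_atBot hgood hs hW hE)).const_mul _
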